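/- \textbf{Model.} A discrete-time system has $M\ge 2$ identical servers, each with $R_i\ge 0$ units of resource $i$, and $J$ types of jobs; a type-$j$ job needs $r_{i,j}\ge 0$ units of resource $i$ (for every $j$ some $r_{i,j}>0$) and has an integer size between $1$ and $D_{\max}$. A configuration $s\in\mathbb Z_+^J$ is feasible if $\sum_j s_jr_{i,j}\le R_i$ for all $i$, and maximal if no $s+e_j$ is feasible. $\mathcal C_m^*$ is the convex hull of the maximal configurations, $\mathcal C_m=\{s\ge 0: s\le s^*\text{ for some }s^*\in\mathcal C_m^*\}$, $\mathcal C=\{s\ge 0: s\le\sum_m s^m\text{ for some }s^m\in\mathcal C_m\}$, and $s_{\max}$ is the maximal number of jobs of one type in a feasible configuration. Write $\mathcal C=\{s\ge0:\langle c^{(k)},s\rangle\le b^{(k)},\ k=1,\dots,K\}$ with $\|c^{(k)}\|=1$, $c^{(k)}\ge0$, $b^{(k)}\ge0$ and no inequality redundant. Let $\mathcal H^{(k)}=\{s:\langle c^{(k)},s\rangle=b^{(k)}\}$ and $\mathcal F^{(k)}=\mathcal C\cap\mathcal H^{(k)}$; for $\lambda\in\mathrm{int}\,\mathcal C$ let $\epsilon^{(k)}=\mathrm{dist}(\lambda,\mathcal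 H^{(k)})$ and $\lambda^{(k)}=\lambda+\epsilon^{(k)}c^{(k)}$, and let $\mathcal K^o_\lambda$ be the set of $k$ with $\lambda^{(k)}\in\mathcal C$ and $\lambda^{(k)}$ in the relative interior of $\mathcal F^{(k)}$. In each slot a random finite list of jobs of each type arrives, i.i.d. over slots; the type-$j$ workload (total size) $a_j$ has mean $\lambda_j$, finite variance $\sigma_j^2$, and $\Pr(a_j=0)>\epsilon_A$ for some $\epsilon_A>0$ and all $j$. Each server keeps a queue of jobs for each type; $q_{j,m}$ is the total residual size of the type-$j$ jobs at server $m$. A policy, using the state, the arrivals and fresh randomness independent of the arrivals and the past, sends the arrivals of each type to one server, picks a feasible configuration $\overline{s^m}$ at each server, and serves $s_j^m\le\overline{s_j^m}$ of the type-$j$ jobs present (including new arrivals), each for one unit of work. The lists of residual job sizes form a Markov chain. \emph{Power-of-two-choices routing with MaxWeight scheduling}: for each type $j$, independently of the arrivals, a set of two distinct servers is drawn uniformly, and all type-$j$ arrivals go to the one with the smaller $q_{j,m}$ (any tie-breaking); server $m$ picks a configuration $\overline{s^m}\in\mathcal C_m^*$ maximizing $\sum_j s_jq_{j,m}$ over $s\in\mathcal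 C_m^*$ (any tie-breaking), and serves as many type-$j$ jobs as possible up to $\overline{s_j^m}$ (any choice of the jobs). Put $V(\mathbf q)=\sum_{j,m}q_{j,m}^2$, $\mathbf c^{(k)}_{j,m}=c^{(k)}_j/\sqrt M$, $\mathbf q_\perp^{(k)}=\mathbf q-\langle\mathbf c^{(k)},\mathbf q\rangle\mathbf c^{(k)}$, and $\zeta^{(\epsilon,k)}=\frac1{\sqrt M}\sum_j(c^{(k)}_j)^2\sigma_j^2+\frac{(\epsilon^{(k)})^2}{\sqrt M}$. \textbf{Theorem.} Under power-of-two-choices routing with MaxWeight scheduling: (1) \emph{Drift.} In every state, with queue lengths $\mathbf q$, the one-step drift of $V$ is integrable and $$\mathbb E[\Delta V]\le K'+\sum_j2\lambda_j\sum_m\frac{q_{j,m}}M-\mathbb E\Big[\sum_{m}\sum_j2q_{j,m}s_j^m\Big],\qquad K'=M\Big(\sum_j(\lambda_j^2+\sigma_j^2)+2Js_{\max}^2(1+D_{\max})\Big).$$ (2) \emph{Steady state.} If $\lambda\in\mathrm{int}\,\mathcal C$, the chain has a stationary distribution. (3) \emph{Lower bound.} If $\lambda\in\mathrm{int}\,\mathcal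 C$, the $a_j$ are pairwise uncorrelated and $k\in\mathcal K^o_\lambda$, then in every steady state of every policy (in particular of the present one) $$\epsilon^{(k)}\,\mathbb E\langle\mathbf c^{(k)},\mathbf q\rangle\ge\frac{\zeta^{(\epsilon,k)}}2-\frac{b^{(k)}\epsilon^{(k)}}2 .$$ Now fix $k$, and consider a family of arrival laws, with workloads $a_j$ bounded almost surely by one constant, whose rates $\lambda$ lie in $\mathrm{int}\,\mathcal C$ and approach the $k$-th face along its normal: all of them have the same point $\lambda^{(k)}$, and $k\in\mathcal K^o_\lambda$. (4) \emph{State-space collapse.} There are finite constants $N_r$, $r=0,1,2,\dots$, with $\mathbb E\|\mathbf q_\perp^{(k)}\|^r\le N_r$ in every steady state of every member of the family. If moreover, for each member, the $a_j$ are pairwise uncorrelated, then: (5) \emph{Upper bound.} There is a constant $B$ such that in every steady state of every member of the family $\epsilon^{(k)}\,\mathbb E\langle\mathbf c^{(k)},\mathbf q\rangle\le\frac{\zeta^{(\epsilon,k)}}2+B\sqrt{\epsilon^{(k)}}$. (6) \emph{Heavy-traffic optimality.} As $\epsilon^{(k)}\downarrow0$ along the family with standard deviations converging to $\sigma$, $\epsilon^{(k)}\,\mathbb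 E\langle\mathbf c^{(k)},\mathbf q\rangle\to\frac{\zeta^{(k)}}2$ in steady state, where $\zeta^{(k)}=\frac1{\sqrt M}\sum_j(c_j^{(k)})^2\sigma_j^2$; and for any policies (possibly depending on the member) and any steady states of theirs, $\liminf\epsilon^{(k)}\,\mathbb E\langle\mathbf c^{(k)},\mathbf q\rangle\ge\frac{\zeta^{(k)}}2$. -/

import Mathlib

open MeasureTheory ProbabilityTheory Filter Topology
open scoped ENNReal

/-! ### Resources, configurations and the capacity region -/

/-- Vectors indexed by job types, with the Euclidean norm. -/
abbrev JobVec (J : ℕ) := EuclideanSpace ℝ (Fin J)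

/-- Vectors indexed by (job type, server), with the Euclidean norm. -/
abbrev QueueVec (J M : ℕ) := EuclideanSpace ℝ (Fin J × Fin M)

/-- `M` servers with `I` kinds of resources and `J` types of jobs. Server `m` has `R i m` units of
resource `i`, a job of type `j` needs `r i j` units of it, and sizes of jobs are at most `Dmax`.
Every type of job needs some resource (so a server runs boundedly many jobs). -/
structure CloudSystem (I J M : ℕ) where
  R : Fin I → Fin M → ℝ
  r : Fin I → Fin J → ℝ
  Dmax : ℕ
  R_nonneg : ∀ i m, 0 ≤ R i m
  r_nonneg : ∀ i j, 0 ≤ r i j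
  exists_r_pos : ∀ j, ∃ i, 0 < r i j

/-- A configuration as a real vector. -/
noncomputable def configVec {J : ℕ} (s : Fin J → ℕ) : JobVec J :=
  WithLp.toLp 2 fun j => (s j : ℝ)

namespace CloudSystem

variable {I J M : ℕ} (S : CloudSystem I J M)

/-- All servers are identical. -/
def Identical : Prop := ∀ i m m', S.R i m = S.R i m'

/-- The feasible configurations of server `m`. -/
def feasible (m : Fin M) : Set (Fin J → ℕ) :=
  {s | ∀ i, ∑ j, (s j : ℝ) * S.r i j ≤ S.R i m}

/-- The maximal configurations of server `m`: no further job can be accommodated. -/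
def maximal (m : Fin M) : Set (Fin J → ℕ) :=
  {s | s ∈ S.feasible m ∧ ∀ j, s + Pi.single j 1 ∉ S.feasible m}

/-- The convex hull of the maximal configurations of server `m`. -/
def hullMaximal (m : Fin M) : Set (JobVec J) :=
  convexHull ℝ (configVec '' S.maximal m)

/-- The capacity region of server `m`. -/
def serverCapacity (m : Fin M) : Set (JobVec J) :=
  {s | (∀ j, 0 ≤ s j) ∧ ∃ t ∈ S.hullMaximal m, ∀ j, s j ≤ t j}

/-- The capacity region of the system. -/
def capacity : Set (JobVec J) :=
  {s | (∀ j, 0 ≤ s j) ∧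
    ∃ t : Fin M → JobVec J, (∀ m, t m ∈ S.serverCapacity m) ∧ ∀ j, s j ≤ ∑ m, t m j}

/-- The maximum number of jobs of one type that can be scheduled on one server. -/
noncomputable def smax : ℕ :=
  sSup {n | ∃ m, ∃ s ∈ S.feasible m, ∃ j, s j = n}

end CloudSystem

/-! ### Hyperplanes bounding the capacity region -/

/-- A description of `C` as the set of nonnegative vectors satisfying finitely many inequalities
`⟪c k, s⟫ ≤ b k` with unit nonnegative normals, none of which can be dropped. -/
structure HyperplaneDescription {J : ℕ} (C : Set (JobVec J)) where
  K : ℕ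
  c : Fin K → JobVec J
  b : Fin K → ℝ
  norm_c : ∀ k, ‖c k‖ = 1
  c_nonneg : ∀ k j, 0 ≤ c k j
  b_nonneg : ∀ k, 0 ≤ b k
  eq_set : C = {s | (∀ j, 0 ≤ s j) ∧ ∀ k, inner ℝ (c k) s ≤ b k}
  irredundant : ∀ k₀, C ≠ {s | (∀ j, 0 ≤ s j) ∧ ∀ k, k ≠ k₀ → inner ℝ (c k) s ≤ b k}

namespace HyperplaneDescription

variable {J : ℕ} {C : Set (JobVec J)} (H : HyperplaneDescription C)

/-- The `k`-th hyperplane. -/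
def plane (k : Fin H.K) : Set (JobVec J) := {s | inner ℝ (H.c k) s = H.b k}

/-- The distance from `lam` to the `k`-th hyperplane. -/
noncomputable def dist (k : Fin H.K) (lam : JobVec J) : ℝ := Metric.infDist lam (H.plane k)

/-- The point of the `k`-th hyperplane closest to `lam` (for `lam` in the region). -/
noncomputable def proj (k : Fin H.K) (lam : JobVec J) : JobVec J := lam + H.dist k lam • H.c k

/-- The face of the region on the `k`-th hyperplane. -/
def face (k : Fin H.K) : Set (JobVec J) := C ∩ H.plane k

/-- The dominant hyperplanes. -/
def dominant (lam : JobVec J) : Set (Fin H.K) := {k | H.proj k lam ∈ C}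

/-- The dominant hyperplanes for which the closest point to `lam` is in the relative interior
of the face. -/
def strictlyDominant (lam : JobVec J) : Set (Fin H.K) :=
  {k | k ∈ H.dominant lam ∧ H.proj k lam ∈ intrinsicInterior ℝ (H.face k)}

end HyperplaneDescription

/-! ### Jobs, queues and arrivals -/

/-- The (residual) size of a job that is present. -/
abbrev JobSize (D : ℕ) := {d : ℕ // 1 ≤ d ∧ d ≤ D}

/-- A list of jobs, each given by its (residual) size. -/
abbrev Queue (D : ℕ) := List (JobSize D)

instance Queue.instMeasurableSpace (D : ℕ) : MeasurableSpace (Queue D) := ⊤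

instance Queue.instDiscrete (D : ℕ) : DiscreteMeasurableSpace (Queue D) := ⟨fun _ => trivial⟩

/-- The total size of the jobs in a list. -/
def work {D : ℕ} (l : Queue D) : ℕ := (l.map Subtype.val).sum

/-- Serve for one time slot the jobs of `l` whose positions (from `0`) are in `T`: their sizes
go down by one, and jobs of size zero leave. -/
def serveJobs {D : ℕ} (l : Queue D) (T : Finset ℕ) : Queue D :=
  l.zipIdx.filterMap fun p =>
    if p.2 ∈ T then
      if h : 2 ≤ p.1.1 then
        some ⟨p.1.1 - 1, Nat.le_sub_one_of_lt h, (Nat.sub_le _ _).trans p.1.2.2⟩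
      else none
    else some p.1

/-- The jobs arriving in a time slot: a list for every type. -/
abbrev Arrivals (J D : ℕ) := Fin J → Queue D

/-- The state: the list of jobs of type `j` present at server `m`. -/
abbrev QueueState (J M D : ℕ) := Fin J → Fin M → Queue D

/-- The distribution of the arrivals in a time slot (arrivals in different time slots are
independent with this law). The workloads have finite second moments, and with probability
bounded away from zero a given type has no arrivals. -/
structure ArrivalLaw (J D : ℕ) where
  law : Measure (Arrivals J D)
  isProbabilityMeasure : IsProbabilityMeasure law
  memLp : ∀ j, MemLp (fun A : Arrivals J D => (work (A j) : ℝ)) 2 law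
  idle : ∃ p : ℝ≥0∞, 0 < p ∧ ∀ j, p < law {A | work (A j) = 0}

namespace ArrivalLaw

variable {J D : ℕ} (α : ArrivalLaw J D)

/-- The arrival rates `λ j = 𝔼[a j]`. -/
noncomputable def rate : JobVec J := WithLp.toLp 2 fun j => ∫ A, (work (A j) : ℝ) ∂α.law

/-- The variances `σ j ^ 2` of the arriving workloads. -/
noncomputable def var (j : Fin J) : ℝ :=
  variance (fun A : Arrivals J D => (work (A j) : ℝ)) α.law

/-- The workloads of different types are uncorrelated. -/
def Uncorrelated : Prop :=
  ∀ i j, i ≠ j →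
    covariance (fun A : Arrivals J D => (work (A i) : ℝ))
      (fun A : Arrivals J D => (work (A j) : ℝ)) α.law = 0

end ArrivalLaw

/-- The state after the arrivals `A` have been routed: type `j` goes to server `route j`. -/
def afterArrivals {J M D : ℕ} (y : QueueState J M D) (A : Arrivals J D) (route : Fin J → Fin M) :
    QueueState J M D :=
  fun j m => if m = route j then y j m ++ A j else y j m

/-- The queue lengths (backlogged workloads) in a state. -/
noncomputable def queueVec {J M D : ℕ} (y : QueueState J M D) : QueueVec J M :=
  WithLp.toLp 2 fun p => (work (y p.1 p.2) : ℝ)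

/-! ### Policies and their Markov chains -/

/-- A routing and scheduling policy. In each slot, given the state `y`, the arrivals and a random
seed independent of the arrivals and of the past, it chooses a server for the arrivals of each type,
a feasible configuration (allotted service) for each server, and the jobs that are served, at most
as many as allotted. -/
structure Policy {I J M : ℕ} (S : CloudSystem I J M) where
  Seed : Type
  seedMeasurableSpace : MeasurableSpace Seed
  seedLaw : Measure Seed
  seedProb : IsProbabilityMeasure seedLaw
  route : QueueState J M S.Dmax → Arrivals J S.Dmax × Seed → Fin J → Fin M
  sched : QueueState J M S.Dmax → Arrivals J S.Dmax × Seed → Fin M → Fin J → ℕ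
  serve : QueueState J M S.Dmax → Arrivals J S.Dmax × Seed → Fin J → Fin M → Finset ℕ
  sched_feasible : ∀ y ω m, sched y ω m ∈ S.feasible m
  serve_subset : ∀ y ω j m,
    serve y ω j m ⊆ Finset.range (afterArrivals y ω.1 (route y ω) j m).length
  serve_card_le : ∀ y ω j m, (serve y ω j m).card ≤ sched y ω m j
  measurable_route : ∀ y j m, MeasurableSet {ω | route y ω j = m}
  measurable_sched : ∀ y m s, MeasurableSet {ω | sched y ω m = s}
  measurable_serve : ∀ y j m T, MeasurableSet {ω | serve y ω j m = T}

namespace Policy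

variable {I J M : ℕ} {S : CloudSystem I J M} (P : Policy S)

instance : MeasurableSpace P.Seed := P.seedMeasurableSpace

/-- The joint law of the arrivals and of the seed in a time slot. -/
noncomputable def slotLaw (α : ArrivalLaw J S.Dmax) : Measure (Arrivals J S.Dmax × P.Seed) :=
  α.law.prod P.seedLaw

/-- The number of jobs of type `j` actually served at server `m`. -/
def served (y : QueueState J M S.Dmax) (ω : Arrivals J S.Dmax × P.Seed) (j : Fin J) (m : Fin M) :
    ℕ :=
  (P.serve y ω j m).card

/-- The next state. -/
def next (y : QueueState J M S.Dmax) (ω : Arrivals J S.Dmax × P.Seed) : QueueState J M S.Dmax :=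
  fun j m => serveJobs (afterArrivals y ω.1 (P.route y ω) j m) (P.serve y ω j m)

/-- The next state is a random variable. -/
theorem measurable_next (y : QueueState J M S.Dmax) : Measurable (P.next y) := by
  refine measurable_pi_iff.2 fun j => measurable_pi_iff.2 fun m => ?_
  refine measurable_to_countable' fun z => ?_
  have : (fun ω => P.next y ω j m) ⁻¹' {z} =
      ⋃ (a : Arrivals J S.Dmax) (t : Fin M) (T : Finset ℕ),
        ⋃ (_ : serveJobs (if m = t then y j m ++ a j else y j m) T = z),
        ({ω | ω.1 = a} ∩ {ω | P.route y ω j = t} ∩ {ω | P.serve y ω j m = T}) := by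
    ext ω
    simp [Policy.next, afterArrivals]
  rw [this]
  refine .iUnion fun a => .iUnion fun t => .iUnion fun T => .iUnion fun _ => ?_
  exact ((measurable_fst (measurableSet_singleton a)).inter (P.measurable_route y j t)).inter
    (P.measurable_serve y j m T)

/-- The transition kernel of the Markov chain of states. -/
noncomputable def kernel (α : ArrivalLaw J S.Dmax) :
    Kernel (QueueState J M S.Dmax) (QueueState J M S.Dmax) :=
  Kernel.ofFunOfCountable fun y => (P.slotLaw α).map (P.next y)

/-- `π` is a steady-state distribution of the chain. -/
def IsSteadyState (α : ArrivalLaw J S.Dmax) (π : Measure (QueueState J M S.Dmax)) : Prop :=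
  IsProbabilityMeasure π ∧ (P.kernel α).Invariant π

/-- Power-of-two-choices routing: for each type, a set of two servers is drawn uniformly from the
sets of two servers, independently of the arrivals, and all arrivals of the type join one of these
two with the shorter queue for the type. -/
def IsPowerOfTwoRouting : Prop :=
  ∃ pair : P.Seed → Fin J → Finset (Fin M),
    (∀ ξ j, (pair ξ j).card = 2) ∧
    (∀ j T, T.card = 2 → MeasurableSet {ξ | pair ξ j = T} ∧
      P.seedLaw {ξ | pair ξ j = T} = ((M.choose 2 : ℕ) : ℝ≥0∞)⁻¹) ∧
    ∀ y A ξ j, P.route y (A, ξ) j ∈ pair ξ j ∧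
      ∀ m ∈ pair ξ j, work (y j (P.route y (A, ξ) j)) ≤ work (y j m)

/-- MaxWeight scheduling: server `m` picks a configuration in the convex hull of its maximal
configurations that maximizes `∑ j, s j * q j m` over this hull, and then serves as many jobs as
are allotted and present. -/
def IsMaxWeightScheduling : Prop :=
  (∀ y ω m, configVec (P.sched y ω m) ∈ S.hullMaximal m ∧
    ∀ t ∈ S.hullMaximal m,
      ∑ j, t j * (work (y j m) : ℝ) ≤ ∑ j, (P.sched y ω m j : ℝ) * (work (y j m) : ℝ)) ∧
  ∀ y ω j m, P.served y ω j m =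
    min (P.sched y ω m j) (afterArrivals y ω.1 (P.route y ω) j m).length

end Policy

/-! ### Quantities in the heavy-traffic bounds -/

/-- The Lyapunov function `V`. -/
noncomputable def lyapunovV {J M : ℕ} (q : QueueVec J M) : ℝ := ∑ m, ∑ j, q (j, m) ^ 2

/-- The unit vector in the space of queue lengths with entries `c j / √M`. -/
noncomputable def spread {J : ℕ} (M : ℕ) (c : JobVec J) : QueueVec J M :=
  WithLp.toLp 2 fun p => c p.1 / √(M : ℝ)

/-- The component of `q` perpendicular to the unit vector `d`. -/
noncomputable def perp {J M : ℕ} (d q : QueueVec J M) : QueueVec J M := q - inner ℝ d q • d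

/-- The expectation, in `[0, ∞]`, of `⟪d, q⟫` in the distribution `π`, for `d ≥ 0`. -/
noncomputable def meanWeighted {J M D : ℕ} (π : Measure (QueueState J M D)) (d : QueueVec J M) :
    ℝ≥0∞ :=
  ∫⁻ y, ENNReal.ofReal (inner ℝ d (queueVec y)) ∂π

/-- `ζ = (1 / √M) ∑ j, c j ^ 2 σ j ^ 2 + ε ^ 2 / √M`. -/
noncomputable def zeta {J : ℕ} (M : ℕ) (c : JobVec J) (var : Fin J → ℝ) (ε : ℝ) : ℝ :=
  (∑ j, c j ^ 2 * var j) / √(M : ℝ) + ε ^ 2 / √(M : ℝ)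

/-- The constant `K'` of the drift inequality. -/
noncomputable def driftConst {I J M : ℕ} (S : CloudSystem I J M) (α : ArrivalLaw J S.Dmax) : ℝ :=
  (M : ℝ) * (∑ j, (α.rate j ^ 2 + α.var j) + 2 * (J : ℝ) * (S.smax : ℝ) ^ 2 * (1 + (S.Dmax : ℝ)))

/-!
# Power-of-two-choices routing with MaxWeight scheduling in heavy traffic

For a unit vector `c` normal to a face `⟪c, s⟫ ≤ b` of the capacity region, the weighted workload
`X = ∑ c j * q j m` behaves like the backlog of a single-server queue: in one slot it moves to
`X' = X + (A - b) + U`, where `A = ∑ c j * a j` is independent of `X`, the net input `A - b` has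
mean `-ε`, and the unused service `U = b - ∑ c j * s j m` lies in `[0, b]`, whatever the policy
(`Policy.weightedWork_next`, `Policy.unused_nonneg`). Stationarity of `X` gives `E U = ε`, and
stationarity of `X ^ 2` gives `2 ε E X = E (A - b) ^ 2 + 2 E [X' U] - E U ^ 2`.

*Lower bound.* Since `X' U ≥ 0` and `E U ^ 2 ≤ b ε`, the identity yields
`2 ε E X ≥ E (A - b) ^ 2 - b ε`. Second moments of `X` need not exist, so `x ^ 2` is replaced by
functions that are linear beyond `N` (`integral_sq_le_of_stationary_queue`).

*Drift.* The length of the queue chosen by power-of-two-choices routing is the minimum over the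
sampled pair. It is independent of the arrivals and its mean is below the mean queue by a multiple
of the distance of any two queues (`Policy.IsPowerOfTwoRouting.integral_work_route_le`). MaxWeight
serves, up to a constant, at least as well as any vectors `x m` of the capacity region. Together
these bound the drift of `V` (`Policy.integral_drift_le_of_capacity`). For `x m = λ + δ (1, …, 1)`
the drift is negative outside a finite set, which makes the Cesàro averages of the chain tight
(`ProbabilityTheory.Kernel.exists_invariant_of_drift`).

*State-space collapse.* As no inequality is redundant, the face spans its hyperplane, and around the
point `λ + ε c` of its relative interior the hyperplane lies in the region. Choosing `x m` in this
neighbourhood, in the direction of the component of the queues of server `m` perpendicular to `c`,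
gives a drift of the perpendicular component of all the queues that is negative uniformly in `ε`, as
long as the arrival rates are bounded below; the term proportional to `ε` cancels against the growth
of the parallel component. Where rates become small, `ε` is bounded below and the queue lengths
themselves have negative drift. Jumps are bounded, so exponential moments are bounded
(`exists_moment_bound_of_drift`).

*Upper bound.* Unless the perpendicular component is comparable to `X`, the chosen configurations
are optimal in the direction `c` and all types with `c j > 0` use their allotment, so that `U = 0`
(`Policy.exists_weightedWork_mul_unused_le`). Hence `E [X U]` is bounded by the correlation of `U`
with the perpendicular component, which is of order `√ε` as `E U ^ 2 ≤ b ε`.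
-/

/-! ### Lists of jobs and their total size -/

theorem work_append {D : ℕ} (l l' : Queue D) : work (l ++ l') = work l + work l' := by
  simp [work]

theorem length_le_work {D : ℕ} (l : Queue D) : l.length ≤ work l := by
  induction l with
  | nil => simp [work]
  | cons a l ih =>
    have := a.2.1
    simp only [work, List.map_cons, List.sum_cons, List.length_cons] at ih ⊢
    omega

theorem work_le_mul_length {D : ℕ} (l : Queue D) : work l ≤ D * l.length := by
  induction l with
  | nil => simp [work]
  | cons a l ih =>
    have := a.2.2
    simp only [work, List.map_cons, List.sum_cons, List.length_cons, Nat.mul_succ] at ih ⊢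
    omega

/-- Serving lowers the total size by the number of served positions, since every job that is
present has size at least one. -/
theorem work_serveJobs_add_card {D : ℕ} (l : Queue D) (T : Finset ℕ)
    (hT : T ⊆ Finset.range l.length) : work (serveJobs l T) + T.card = work l := by
  have key : ∀ (l : Queue D) (n : ℕ),
      work ((l.zipIdx n).filterMap fun p : JobSize D × ℕ =>
        if p.2 ∈ T then
          if h : 2 ≤ p.1.1 then
            some ⟨p.1.1 - 1, Nat.le_sub_one_of_lt h, (Nat.sub_le _ _).trans p.1.2.2⟩
          else none
        else some p.1) + (T.filter fun i => n ≤ i ∧ i < n + l.length).card = work l := by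
    intro l
    induction l with
    | nil =>
      intro n
      simp [work]
    | cons a l ih =>
      intro n
      have h1 := a.2.1
      have hcard : (T.filter fun i => n ≤ i ∧ i < n + (a :: l).length).card =
          (if n ∈ T then 1 else 0) +
            (T.filter fun i => n + 1 ≤ i ∧ i < n + 1 + l.length).card := by
        have : (T.filter fun i => n ≤ i ∧ i < n + (a :: l).length) =
            (T.filter fun i => i = n) ∪
              (T.filter fun i => n + 1 ≤ i ∧ i < n + 1 + l.length) := by
          ext i
          simp only [Finset.mem_filter, Finset.mem_union, List.length_cons]
          constructor
          · rintro ⟨h, h', h''⟩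
            by_cases hi : i = n
            · exact Or.inl ⟨h, hi⟩
            · exact Or.inr ⟨h, by omega, by omega⟩
          · rintro (⟨h, h'⟩ | ⟨h, h', h''⟩)
            · exact ⟨h, by omega, by omega⟩
            · exact ⟨h, by omega, by omega⟩
        rw [this, Finset.card_union_of_disjoint]
        · congr 1
          rw [Finset.filter_eq']
          split_ifs <;> simp
        · rw [Finset.disjoint_left]
          intro i hi hi'
          simp only [Finset.mem_filter] at hi hi'
          omega
      rw [hcard]
      have hih := ih (n + 1)
      rw [List.zipIdx_cons]
      by_cases hn : n ∈ T
      · by_cases h2 : 2 ≤ a.1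
        · simp only [List.filterMap_cons, hn, if_true, h2, dite_true]
          simp only [work, List.map_cons, List.sum_cons] at hih ⊢
          omega
        · simp only [List.filterMap_cons, hn, if_true, h2, dite_false]
          simp only [work, List.map_cons, List.sum_cons] at hih ⊢
          omega
      · simp only [List.filterMap_cons, hn, if_false]
        simp only [work, List.map_cons, List.sum_cons] at hih ⊢
        omega
  have h := key l 0
  have hfilter : (T.filter fun i => 0 ≤ i ∧ i < 0 + l.length) = T := by
    rw [Finset.filter_eq_self]
    intro i hi
    have := Finset.mem_range.1 (hT hi)
    omega
  rw [hfilter] at h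
  exact h

/-- There are finitely many lists of bounded total size, as all jobs have size at least one. -/
theorem finite_setOf_work_le {D : ℕ} (n : ℕ) : {l : Queue D | work l ≤ n}.Finite := by
  have : Finite (JobSize D) := (Set.finite_Icc 1 D).to_subtype
  refine (List.finite_length_le (JobSize D) n).subset fun l hl => ?_
  exact (length_le_work l).trans hl

/-! ### Configurations and the capacity region -/

@[simp] theorem configVec_apply {J : ℕ} (s : Fin J → ℕ) (j : Fin J) : configVec s j = (s j : ℝ) :=
  rfl

theorem JobVec.inner_eq_sum {J : ℕ} (x y : JobVec J) : inner ℝ x y = ∑ j, x j * y j := by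
  simp [PiLp.inner_apply, mul_comm]

namespace CloudSystem

variable {I J M : ℕ} (S : CloudSystem I J M)

/-- Every type of job needs some resource, so feasible configurations are bounded and the
supremum that defines `smax` is over a bounded set. -/
theorem exists_feasible_le : ∃ B : ℕ, ∀ m, ∀ s ∈ S.feasible m, ∀ j, s j ≤ B := by
  choose i hi using S.exists_r_pos
  refine ⟨∑ j, ∑ m, ⌈S.R (i j) m / S.r (i j) j⌉₊, fun m s hs j => ?_⟩
  have h1 : (s j : ℝ) * S.r (i j) j ≤ S.R (i j) m :=
    (Finset.single_le_sum (f := fun j' => (s j' : ℝ) * S.r (i j) j')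
      (fun j' _ => mul_nonneg (Nat.cast_nonneg _) (S.r_nonneg _ _)) (Finset.mem_univ j)).trans
      (hs (i j))
  have h2 : (s j : ℝ) ≤ ⌈S.R (i j) m / S.r (i j) j⌉₊ :=
    ((le_div_iff₀ (hi j)).2 h1).trans (Nat.le_ceil _)
  have h3 : s j ≤ ⌈S.R (i j) m / S.r (i j) j⌉₊ := by exact_mod_cast h2
  refine h3.trans (le_trans ?_ (Finset.single_le_sum
    (f := fun j => ∑ m, ⌈S.R (i j) m / S.r (i j) j⌉₊) (fun _ _ => Nat.zero_le _)
    (Finset.mem_univ j)))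
  exact Finset.single_le_sum (f := fun m => ⌈S.R (i j) m / S.r (i j) j⌉₊)
    (fun _ _ => Nat.zero_le _) (Finset.mem_univ m)

theorem le_smax {m : Fin M} {s : Fin J → ℕ} (hs : s ∈ S.feasible m) (j : Fin J) :
    s j ≤ S.smax := by
  obtain ⟨B, hB⟩ := S.exists_feasible_le
  refine le_csSup ⟨B, ?_⟩ ⟨m, s, hs, j, rfl⟩
  rintro n ⟨m, s, hs, j, rfl⟩
  exact hB m s hs j

theorem finite_feasible (m : Fin M) : (S.feasible m).Finite := by
  refine (Set.finite_Iic (fun _ : Fin J => S.smax)).subset fun s hs => ?_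
  exact fun j => S.le_smax hs j

/-- Adding jobs one by one to a feasible configuration ends in a maximal one. -/
theorem exists_maximal_ge {m : Fin M} {s : Fin J → ℕ} (hs : s ∈ S.feasible m) :
    ∃ t ∈ S.maximal m, s ≤ t := by
  obtain ⟨t, hst, ht⟩ := (S.finite_feasible m).exists_le_maximal hs
  refine ⟨t, ⟨ht.prop, fun j hj => ?_⟩, hst⟩
  have := ht.le_of_ge hj (by intro i; simp) j
  simp at this

theorem configVec_mem_serverCapacity {m : Fin M} {s : Fin J → ℕ} (hs : s ∈ S.feasible m) :
    configVec s ∈ S.serverCapacity m := by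
  obtain ⟨t, ht, hst⟩ := S.exists_maximal_ge hs
  refine ⟨fun j => by simp, configVec t, subset_convexHull ℝ _ ⟨t, ht, rfl⟩, fun j => ?_⟩
  simpa using hst j

theorem sum_configVec_mem_capacity {s : Fin M → Fin J → ℕ} (hs : ∀ m, s m ∈ S.feasible m) :
    (WithLp.toLp 2 fun j => ∑ m, (s m j : ℝ) : JobVec J) ∈ S.capacity :=
  ⟨fun j => by simpa using Finset.sum_nonneg fun m _ => Nat.cast_nonneg (s m j),
    fun m => configVec (s m), fun m => S.configVec_mem_serverCapacity (hs m), fun j => le_rfl⟩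

variable {S}

theorem Identical.hullMaximal_eq (hid : S.Identical) (m m' : Fin M) :
    S.hullMaximal m = S.hullMaximal m' := by
  have hf : S.feasible m = S.feasible m' := by
    ext s
    simp only [feasible, Set.mem_ofPred_eq]
    exact forall_congr' fun i => by rw [hid i m m']
  simp only [hullMaximal, maximal, hf]

/-- With identical servers, every vector of the capacity region is dominated by `M` times a vector
of the convex hull of maximal configurations of any one server. -/
theorem Identical.exists_hullMaximal_of_mem_capacity (hid : S.Identical) {x : JobVec J}
    (hx : x ∈ S.capacity) (m : Fin M) : ∃ t ∈ S.hullMaximal m, ∀ j, x j ≤ M * t j := by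
  obtain ⟨-, t, ht, hxt⟩ := hx
  choose u hu htu using fun m => (ht m).2
  have hMpos : (0 : ℝ) < M := by
    have : 0 < M := m.pos
    exact_mod_cast this
  refine ⟨∑ m' : Fin M, (1 / (M : ℝ)) • u m', ?_, fun j => ?_⟩
  · refine (convex_convexHull ℝ _).sum_mem (fun _ _ => by positivity) ?_ fun m' _ => ?_
    · simp [hMpos.ne']
    · have := hu m'
      rwa [hid.hullMaximal_eq m' m] at this
  · have : (∑ m' : Fin M, (1 / (M : ℝ)) • u m') j = (1 / (M : ℝ)) * ∑ m', u m' j := by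
      simp [Finset.mul_sum]
    rw [this, ← mul_assoc, mul_one_div_cancel hMpos.ne', one_mul]
    exact (hxt j).trans (Finset.sum_le_sum fun m' _ => htu m' j)

end CloudSystem

/-! ### One step of the queue lengths -/

section Step

variable {I J M : ℕ} {S : CloudSystem I J M}

theorem work_afterArrivals {D : ℕ} (y : QueueState J M D) (A : Arrivals J D)
    (route : Fin J → Fin M) (j : Fin J) (m : Fin M) :
    work (afterArrivals y A route j m) = work (y j m) + if m = route j then work (A j) else 0 := by
  unfold afterArrivals
  split_ifs <;> simp [work_append]

namespace Policy

variable (P : Policy S)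

/-- The amount of work of type `j` that is sent to server `m`. -/
noncomputable def routed (y : QueueState J M S.Dmax) (ω : Arrivals J S.Dmax × P.Seed) (j : Fin J)
    (m : Fin M) : ℝ := if m = P.route y ω j then (work (ω.1 j) : ℝ) else 0

theorem routed_nonneg (y : QueueState J M S.Dmax) (ω : Arrivals J S.Dmax × P.Seed) (j : Fin J)
    (m : Fin M) : 0 ≤ P.routed y ω j m := by
  unfold routed
  split_ifs <;> positivity

theorem routed_le (y : QueueState J M S.Dmax) (ω : Arrivals J S.Dmax × P.Seed) (j : Fin J)
    (m : Fin M) : P.routed y ω j m ≤ work (ω.1 j) := by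
  unfold routed
  split_ifs
  · exact le_rfl
  · positivity

theorem sum_mul_routed (y : QueueState J M S.Dmax) (ω : Arrivals J S.Dmax × P.Seed) (j : Fin J)
    (f : Fin M → ℝ) : ∑ m, f m * P.routed y ω j m = f (P.route y ω j) * work (ω.1 j) := by
  simp [routed]

theorem sum_routed (y : QueueState J M S.Dmax) (ω : Arrivals J S.Dmax × P.Seed) (j : Fin J) :
    ∑ m, P.routed y ω j m = work (ω.1 j) := by
  simp [routed]

theorem sum_routed_sq (y : QueueState J M S.Dmax) (ω : Arrivals J S.Dmax × P.Seed) (j : Fin J) :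
    ∑ m, P.routed y ω j m ^ 2 = (work (ω.1 j) : ℝ) ^ 2 := by
  simp [routed, ite_pow]

theorem work_next (y : QueueState J M S.Dmax) (ω : Arrivals J S.Dmax × P.Seed) (j : Fin J)
    (m : Fin M) : (work (P.next y ω j m) : ℝ) =
      work (y j m) + P.routed y ω j m - P.served y ω j m := by
  have h1 := work_serveJobs_add_card _ _ (P.serve_subset y ω j m)
  rw [work_afterArrivals] at h1
  have h2 : (work (P.next y ω j m) : ℝ) + P.served y ω j m =
      work (y j m) + P.routed y ω j m := by
    unfold routed next served
    by_cases h : m = P.route y ω j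
    · rw [if_pos h] at h1 ⊢
      exact_mod_cast h1
    · rw [if_neg h] at h1 ⊢
      exact_mod_cast h1
  linarith

theorem served_le_smax (y : QueueState J M S.Dmax) (ω : Arrivals J S.Dmax × P.Seed) (j : Fin J)
    (m : Fin M) : P.served y ω j m ≤ S.smax :=
  (P.serve_card_le y ω j m).trans (S.le_smax (P.sched_feasible y ω m) j)

variable {P}

/-- A MaxWeight configuration has at least the weight of the fair share of any vector in the
capacity region. -/
theorem IsMaxWeightScheduling.sum_mul_work_le (h : P.IsMaxWeightScheduling) (hid : S.Identical)
    {x : JobVec J} (hx : x ∈ S.capacity) (y : QueueState J M S.Dmax)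
    (ω : Arrivals J S.Dmax × P.Seed) (m : Fin M) :
    ∑ j, x j * (work (y j m) : ℝ) ≤ M * ∑ j, (P.sched y ω m j : ℝ) * work (y j m) := by
  obtain ⟨t, ht, hxt⟩ := hid.exists_hullMaximal_of_mem_capacity hx m
  calc ∑ j, x j * (work (y j m) : ℝ) ≤ ∑ j, M * t j * (work (y j m) : ℝ) :=
        Finset.sum_le_sum fun j _ => mul_le_mul_of_nonneg_right (hxt j) (Nat.cast_nonneg _)
    _ = M * ∑ j, t j * (work (y j m) : ℝ) := by simp [Finset.mul_sum, mul_assoc]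
    _ ≤ _ := mul_le_mul_of_nonneg_left ((h.1 y ω m).2 t ht) (Nat.cast_nonneg _)

/-- If a server does not use its full allotment for a type, then all jobs of this type are being
served, hence there are few of them. -/
theorem IsMaxWeightScheduling.work_le_of_served_lt (h : P.IsMaxWeightScheduling)
    {y : QueueState J M S.Dmax} {ω : Arrivals J S.Dmax × P.Seed} {j : Fin J} {m : Fin M}
    (hlt : P.served y ω j m < P.sched y ω m j) : work (y j m) ≤ S.Dmax * S.smax := by
  have h1 := h.2 y ω j m
  have h2 : (afterArrivals y ω.1 (P.route y ω) j m).length ≤ S.smax := by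
    have := P.served_le_smax y ω j m
    omega
  have h3 := work_le_mul_length (afterArrivals y ω.1 (P.route y ω) j m)
  rw [work_afterArrivals] at h3
  exact (Nat.le_add_right _ _).trans (h3.trans (Nat.mul_le_mul_left _ h2))

theorem IsMaxWeightScheduling.work_mul_sched_le (h : P.IsMaxWeightScheduling)
    (y : QueueState J M S.Dmax) (ω : Arrivals J S.Dmax × P.Seed) (j : Fin J) (m : Fin M) :
    (P.sched y ω m j : ℝ) * work (y j m) ≤
      work (y j m) * P.served y ω j m + S.Dmax * (S.smax : ℝ) ^ 2 := by
  rcases lt_or_ge (P.served y ω j m) (P.sched y ω m j) with hlt | hge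
  · have h1 : (work (y j m) : ℝ) ≤ S.Dmax * S.smax := by
      exact_mod_cast h.work_le_of_served_lt hlt
    have h2 : (P.sched y ω m j : ℝ) ≤ S.smax := by
      exact_mod_cast S.le_smax (P.sched_feasible y ω m) j
    calc (P.sched y ω m j : ℝ) * work (y j m) ≤ S.smax * (S.Dmax * S.smax) := by gcongr
      _ = 0 + S.Dmax * (S.smax : ℝ) ^ 2 := by ring
      _ ≤ _ := by gcongr; positivity
  · have h1 : (P.sched y ω m j : ℝ) ≤ P.served y ω j m := by exact_mod_cast hge
    calc (P.sched y ω m j : ℝ) * work (y j m) ≤ P.served y ω j m * work (y j m) := by gcongr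
      _ = work (y j m) * P.served y ω j m + 0 := by ring
      _ ≤ _ := by gcongr; positivity

end Policy

end Step

/-! ### Markov chains on countable spaces: existence of a stationary distribution -/

/-- The **Foster–Lyapunov criterion** for the existence of an invariant probability measure. The
drift condition bounds the time averages of `f`, so the Cesàro averages of the laws of the chain are
tight; every limit point is invariant, because on a discrete space all functions are continuous. No
irreducibility is needed. -/
theorem ProbabilityTheory.Kernel.exists_invariant_of_drift {Y : Type*} [MeasurableSpace Y]
    [DiscreteMeasurableSpace Y] [Nonempty Y] (κ : Kernel Y Y) [IsMarkovKernel κ]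
    (V f : Y → ℝ≥0∞) (K : ℝ≥0∞) (hV : ∀ y, V y ≠ ∞) (hK : K ≠ ∞)
    (hdrift : ∀ y, ∫⁻ z, V z ∂κ y + f y ≤ V y + K) (hf : ∀ n : ℕ, {y | f y < n}.Finite) :
    ∃ π, IsProbabilityMeasure π ∧ κ.Invariant π := by
  obtain ⟨y₀⟩ := ‹Nonempty Y›
  let _ : TopologicalSpace Y := ⊥
  have : DiscreteTopology Y := ⟨rfl⟩
  have : BorelSpace Y := ⟨by
    rw [borel_eq_top_of_discrete]
    exact le_antisymm le_top fun s _ => MeasurableSet.of_discrete⟩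
  -- the law of the chain at time `n`
  let μ : ℕ → Measure Y := fun n => (fun m => m.bind κ)^[n] (Measure.dirac y₀)
  have hμs : ∀ n, μ (n + 1) = (μ n).bind κ := fun n => Function.iterate_succ_apply' _ _ _
  have hμp : ∀ n, IsProbabilityMeasure (μ n) := by
    intro n
    induction n with
    | zero => exact Measure.dirac.isProbabilityMeasure
    | succ n ih =>
      refine ⟨?_⟩
      rw [hμs, Measure.bind_apply .univ (Kernel.aemeasurable κ)]
      simp
  have hsum : ∀ n, ∫⁻ z, V z ∂(μ n) + ∑ i ∈ Finset.range n, ∫⁻ z, f z ∂(μ i) ≤ V y₀ + n * K := by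
    intro n
    induction n with
    | zero => simp [μ]
    | succ n ih =>
      have h1 : ∫⁻ z, V z ∂(μ (n + 1)) + ∫⁻ z, f z ∂(μ n) ≤ ∫⁻ z, V z ∂(μ n) + K := by
        rw [hμs, Measure.lintegral_bind (Kernel.aemeasurable κ)
          (Measurable.of_discrete.aemeasurable), ← lintegral_add_left Measurable.of_discrete]
        calc ∫⁻ y, (∫⁻ z, V z ∂κ y + f y) ∂(μ n) ≤ ∫⁻ y, (V y + K) ∂(μ n) :=
              lintegral_mono hdrift
          _ = _ := by
              rw [lintegral_add_left Measurable.of_discrete]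
              simp
      rw [Finset.sum_range_succ]
      calc ∫⁻ z, V z ∂(μ (n + 1)) +
            (∑ i ∈ Finset.range n, ∫⁻ z, f z ∂(μ i) + ∫⁻ z, f z ∂(μ n))
          = (∫⁻ z, V z ∂(μ (n + 1)) + ∫⁻ z, f z ∂(μ n)) +
            ∑ i ∈ Finset.range n, ∫⁻ z, f z ∂(μ i) := by ring
        _ ≤ (∫⁻ z, V z ∂(μ n) + K) + ∑ i ∈ Finset.range n, ∫⁻ z, f z ∂(μ i) := by gcongr
        _ = (∫⁻ z, V z ∂(μ n) + ∑ i ∈ Finset.range n, ∫⁻ z, f z ∂(μ i)) + K := by ring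
        _ ≤ V y₀ + n * K + K := by gcongr
        _ = _ := by push_cast; ring
  -- the Cesàro averages
  let ν : ℕ → Measure Y := fun n => ((n : ℝ≥0∞) + 1)⁻¹ • ∑ i ∈ Finset.range (n + 1), μ i
  have hn0 : ∀ n : ℕ, (n : ℝ≥0∞) + 1 ≠ 0 := fun n => by simp
  have hnt : ∀ n : ℕ, (n : ℝ≥0∞) + 1 ≠ ∞ := fun n => by simp
  have hνp : ∀ n, IsProbabilityMeasure (ν n) := by
    intro n
    refine ⟨?_⟩
    simp only [ν, Measure.smul_apply, Measure.finsetSum_apply, measure_univ, Finset.sum_const,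
      Finset.card_range, nsmul_eq_mul, mul_one, smul_eq_mul, Nat.cast_add, Nat.cast_one]
    exact ENNReal.inv_mul_cancel (hn0 n) (hnt n)
  have hνf : ∀ n, ∫⁻ z, f z ∂(ν n) ≤ V y₀ + K := by
    intro n
    simp only [ν, lintegral_smul_measure, lintegral_finsetSum_measure, smul_eq_mul]
    have h1 := (le_add_self).trans (hsum (n + 1))
    calc ((n : ℝ≥0∞) + 1)⁻¹ * ∑ i ∈ Finset.range (n + 1), ∫⁻ z, f z ∂(μ i)
        ≤ ((n : ℝ≥0∞) + 1)⁻¹ * (((n : ℝ≥0∞) + 1) * (V y₀ + K)) := by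
          gcongr
          refine h1.trans ?_
          rw [mul_add]
          push_cast
          gcongr
          exact le_mul_of_one_le_left zero_le le_add_self
      _ = V y₀ + K := by
          rw [← mul_assoc, ENNReal.inv_mul_cancel (hn0 n) (hnt n), one_mul]
  let ν' : ℕ → ProbabilityMeasure Y := fun n => ⟨ν n, hνp n⟩
  have htight : IsTightMeasureSet
      {((m : ProbabilityMeasure Y) : Measure Y) | m ∈ Set.range ν'} := by
    rw [isTightMeasureSet_iff_exists_isCompact_measure_compl_le]
    intro ε hε
    have hC : V y₀ + K ≠ ∞ := ENNReal.add_ne_top.2 ⟨hV _, hK⟩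
    obtain ⟨N, hN⟩ : ∃ N : ℕ, (V y₀ + K) / ε < N := by
      rcases eq_or_ne ε ∞ with rfl | hε'
      · exact ⟨1, by simp⟩
      · exact ENNReal.exists_nat_gt (ENNReal.div_ne_top hC hε.ne')
    have hN0 : (N : ℝ≥0∞) ≠ 0 := (zero_le.trans_lt hN).ne'
    refine ⟨{y | f y < N}, (hf N).isCompact, ?_⟩
    rintro _ ⟨_, ⟨n, rfl⟩, rfl⟩
    have h2 : {y | f y < (N : ℝ≥0∞)}ᶜ = {y | (N : ℝ≥0∞) ≤ f y} := by
      ext y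
      simp
    rw [h2]
    refine (meas_ge_le_lintegral_div Measurable.of_discrete.aemeasurable hN0
      (ENNReal.natCast_ne_top N)).trans ?_
    refine (ENNReal.div_le_div_right (hνf n) _).trans ?_
    refine ENNReal.div_le_of_le_mul ?_
    rcases eq_or_ne ε ∞ with rfl | hε'
    · rw [ENNReal.top_mul hN0]
      exact le_top
    · have := (ENNReal.div_lt_iff (Or.inl hε.ne') (Or.inl hε')).1 hN
      rw [mul_comm]
      exact this.le
  have hcomp := isCompact_closure_of_isTightMeasureSet htight
  obtain ⟨π, -, hπ⟩ := hcomp.ultrafilter_le_nhds ((hyperfilter ℕ).map ν') (by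
    rw [le_principal_iff]
    exact Filter.univ_mem' (f := (hyperfilter ℕ : Filter ℕ)) fun n => subset_closure ⟨n, rfl⟩)
  have hlim : Tendsto ν' (hyperfilter ℕ) (𝓝 π) := hπ
  rw [ProbabilityMeasure.tendsto_iff_forall_lintegral_tendsto] at hlim
  refine ⟨π, inferInstance, ?_⟩
  have hle : (π : Measure Y) ≤ (π : Measure Y).bind κ := by
    intro s
    have hs : MeasurableSet s := MeasurableSet.of_discrete
    rw [Measure.bind_apply hs (Kernel.aemeasurable κ)]
    have hb : ∀ g : Y → ℝ≥0∞, (∀ y, g y ≤ 1) →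
        Tendsto (fun n => ∫⁻ y, g y ∂(ν n)) (hyperfilter ℕ) (𝓝 (∫⁻ y, g y ∂π)) := by
      intro g hg
      have hg' : ∀ y, ((g y).toNNReal : ℝ≥0∞) = g y := fun y =>
        ENNReal.coe_toNNReal ((hg y).trans_lt ENNReal.one_lt_top).ne
      have h1 : ∀ y, (g y).toNNReal ≤ 1 := fun y => by
        rw [← ENNReal.coe_le_coe, hg']
        exact hg y
      have := hlim (BoundedContinuousFunction.mkOfBound
        ⟨fun y => (g y).toNNReal, continuous_of_discreteTopology⟩ 1 fun x y => by
          have hx : (((g x).toNNReal : NNReal) : ℝ) ≤ 1 := h1 x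
          have hy : (((g y).toNNReal : NNReal) : ℝ) ≤ 1 := h1 y
          have hx' := (g x).toNNReal.coe_nonneg
          have hy' := (g y).toNNReal.coe_nonneg
          simp only [ContinuousMap.coe_mk, NNReal.dist_eq, abs_le]
          constructor <;> linarith)
      simp only [BoundedContinuousFunction.mkOfBound_coe, ContinuousMap.coe_mk, hg'] at this
      exact this
    have hA := hb (s.indicator 1) fun y => Set.indicator_le_self' (by simp) y
    have hB := hb (fun y => κ y s) fun y => prob_le_one
    rw [lintegral_indicator_one hs] at hA
    have hC : Tendsto (fun n : ℕ => ((n : ℝ≥0∞) + 1)⁻¹) (hyperfilter ℕ) (𝓝 0) := by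
      have := (tendsto_add_atTop_iff_nat 1).2 ENNReal.tendsto_inv_nat_nhds_zero
      refine Tendsto.mono_left ?_ (Nat.hyperfilter_le_atTop)
      simpa using this
    have hD := hB.add hC
    rw [add_zero] at hD
    refine le_of_tendsto_of_tendsto' hA hD fun n => ?_
    rw [lintegral_indicator_one hs]
    simp only [ν, lintegral_smul_measure, lintegral_finsetSum_measure, smul_eq_mul,
      Measure.smul_apply, Measure.finsetSum_apply]
    rw [Finset.sum_range_succ']
    have h3 : ∀ i, ∫⁻ y, κ y s ∂(μ i) = μ (i + 1) s := fun i => by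
      rw [hμs, Measure.bind_apply hs (Kernel.aemeasurable κ)]
    simp only [h3]
    rw [Finset.sum_range_succ, mul_add]
    have h4 := hμp 0
    refine add_le_add ?_ ?_
    · gcongr
      exact le_self_add
    · exact mul_le_of_le_one_right zero_le prob_le_one
  exact (Measure.eq_of_le_of_isProbabilityMeasure hle).symm

/-! ### Moments of a stationary process with negative drift and bounded jumps -/

section Hajek

variable {Y Ω : Type*} [MeasurableSpace Y] [DiscreteMeasurableSpace Y] [MeasurableSpace Ω]
  {T : Y → Ω → Y} {W : Y → ℝ}

/-- One step of a process whose square has drift at most `K - 2 η W` contracts `exp (θ W)`, up to an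
additive constant, where `θ = min (1 / D) (η / (4 D ^ 2))`. -/
theorem integral_exp_step_le {ν : Measure Ω} [IsProbabilityMeasure ν] {D K η θ : ℝ} (hD : 0 < D)
    (hK : 0 < K) (hη : 0 < η) (hθ : θ = min (1 / D) (η / (4 * D ^ 2))) (y : Y)
    (hT : Measurable (T y)) (hjump : ∀ᵐ ω ∂ν, |W (T y ω) - W y| ≤ D)
    (hdrift : ∫ ω, (W (T y ω) ^ 2 - W y ^ 2) ∂ν ≤ K - 2 * η * W y) :
    Integrable (fun ω => Real.exp (θ * W (T y ω))) ν ∧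
    ∫ ω, Real.exp (θ * W (T y ω)) ∂ν + θ * η / 4 * Real.exp (θ * W y) ≤
      Real.exp (θ * W y) +
        (Real.exp (θ * (K / η + D)) + θ * η / 4 * Real.exp (θ * (K / η))) := by
  have hθ0 : 0 < θ := hθ ▸ lt_min (by positivity) (by positivity)
  have hθD : θ * D ≤ 1 := by
    have : θ ≤ 1 / D := hθ ▸ min_le_left _ _
    calc θ * D ≤ 1 / D * D := by gcongr
      _ = 1 := by field_simp
  have hθη : θ ^ 2 * D ^ 2 ≤ θ * η / 4 := by
    have h1 : θ ≤ η / (4 * D ^ 2) := hθ ▸ min_le_right _ _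
    calc θ ^ 2 * D ^ 2 = θ * (θ * D ^ 2) := by ring
      _ ≤ θ * (η / (4 * D ^ 2) * D ^ 2) := by gcongr
      _ = θ * η / 4 := by field_simp
  have hWm : Measurable fun ω => W (T y ω) := (Measurable.of_discrete (f := W)).comp hT
  have hint : Integrable (fun ω => Real.exp (θ * W (T y ω))) ν := by
    refine Integrable.of_bound (C := Real.exp (θ * (W y + D)))
      (hWm.const_mul θ).exp.aestronglyMeasurable ?_
    filter_upwards [hjump] with ω hω
    rw [Real.norm_eq_abs, Real.abs_exp, Real.exp_le_exp]
    have := (abs_le.1 hω).2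
    gcongr
    linarith
  refine ⟨hint, ?_⟩
  rcases lt_or_ge (W y) (K / η) with hlt | hge
  · -- near the origin the jump bound suffices
    have h1 : ∫ ω, Real.exp (θ * W (T y ω)) ∂ν ≤ Real.exp (θ * (K / η + D)) := by
      calc ∫ ω, Real.exp (θ * W (T y ω)) ∂ν ≤ ∫ ω, Real.exp (θ * (K / η + D)) ∂ν := by
            refine integral_mono_ae hint (integrable_const _) ?_
            filter_upwards [hjump] with ω hω
            have := (abs_le.1 hω).2
            rw [Real.exp_le_exp]
            gcongr
            linarith
        _ = _ := by simp
    have h2 : θ * η / 4 * Real.exp (θ * W y) ≤ θ * η / 4 * Real.exp (θ * (K / η)) := by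
      gcongr
    have h3 := Real.exp_pos (θ * W y)
    linarith
  · have hWy : 0 < W y := lt_of_lt_of_le (by positivity) hge
    have hsq : Integrable (fun ω => W (T y ω) ^ 2 - W y ^ 2) ν := by
      refine Integrable.of_bound (C := D * (2 * W y + D))
        ((hWm.pow_const 2).sub_const _).aestronglyMeasurable ?_
      filter_upwards [hjump] with ω hω
      rw [Real.norm_eq_abs, show W (T y ω) ^ 2 - W y ^ 2 =
        (W (T y ω) - W y) * (2 * W y + (W (T y ω) - W y)) by ring, abs_mul]
      gcongr
      refine (abs_add_le _ _).trans ?_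
      rw [abs_of_pos (by positivity : (0 : ℝ) < 2 * W y)]
      gcongr
    have h1 : ∫ ω, Real.exp (θ * W (T y ω)) ∂ν ≤
        ∫ ω, Real.exp (θ * W y) *
          ((1 + θ ^ 2 * D ^ 2) + θ / (2 * W y) * (W (T y ω) ^ 2 - W y ^ 2)) ∂ν := by
      refine integral_mono_ae hint
        (((integrable_const _).add (hsq.const_mul _)).const_mul _) ?_
      filter_upwards [hjump] with ω hω
      set x := W (T y ω) - W y with hx
      have hx1 : |θ * x| ≤ 1 := by
        rw [abs_mul, abs_of_pos hθ0]
        exact (by gcongr : θ * |x| ≤ θ * D).trans hθD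
      have h4 := (abs_le.1 (Real.abs_exp_sub_one_sub_id_le hx1)).2
      have h5 : (θ * x) ^ 2 ≤ θ ^ 2 * D ^ 2 := by
        rw [mul_pow]
        exact mul_le_mul_of_nonneg_left (sq_le_sq' (abs_le.1 hω).1 (abs_le.1 hω).2) (sq_nonneg θ)
      -- concavity of the square root
      have h6 : x ≤ 1 / (2 * W y) * (W (T y ω) ^ 2 - W y ^ 2) := by
        rw [one_div, ← div_eq_inv_mul, le_div_iff₀ (by positivity)]
        nlinarith [sq_nonneg x]
      have h7 : θ * x ≤ θ / (2 * W y) * (W (T y ω) ^ 2 - W y ^ 2) := by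
        calc θ * x ≤ θ * (1 / (2 * W y) * (W (T y ω) ^ 2 - W y ^ 2)) := by gcongr
          _ = _ := by ring
      calc Real.exp (θ * W (T y ω)) = Real.exp (θ * W y) * Real.exp (θ * x) := by
            rw [← Real.exp_add]
            congr 1
            rw [hx]
            ring
        _ ≤ _ := by
            gcongr
            linarith
    rw [integral_const_mul, integral_add (integrable_const _) (hsq.const_mul _),
      integral_const_mul] at h1
    simp only [integral_const, probReal_univ, one_smul] at h1
    have h2 : θ / (2 * W y) * ∫ ω, (W (T y ω) ^ 2 - W y ^ 2) ∂ν ≤ -(θ * η / 2) := by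
      calc θ / (2 * W y) * ∫ ω, (W (T y ω) ^ 2 - W y ^ 2) ∂ν
          ≤ θ / (2 * W y) * (K - 2 * η * W y) := by gcongr
        _ ≤ θ / (2 * W y) * (η * W y - 2 * η * W y) := by
            gcongr
            rw [div_le_iff₀ hη] at hge
            linarith
        _ = -(θ * η / 2) := by
            field_simp
            ring
    have h3 : ∫ ω, Real.exp (θ * W (T y ω)) ∂ν ≤ Real.exp (θ * W y) * (1 - θ * η / 4) := by
      refine h1.trans ?_
      gcongr
      linarith
    have h4 : 0 ≤ Real.exp (θ * (K / η + D)) + θ * η / 4 * Real.exp (θ * (K / η)) := by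
      positivity
    linarith

/-- If `W` has jumps bounded by `D`, and its square has drift at most `K - 2 η W`, then all moments
of `W` in any stationary distribution are bounded by constants depending on `D`, `K`, `η` only.
Stationarity is applied to the bounded functions `min (exp (θ W)) n`, as `exp (θ W)` is not known to
be integrable beforehand. -/
theorem exists_moment_bound_of_drift (W : Y → ℝ) (T : Y → Ω → Y) (hT : ∀ y, Measurable (T y))
    (hW : ∀ y, 0 ≤ W y) {D K η : ℝ} (hD : 0 < D) (hK : 0 < K) (hη : 0 < η) :
    ∃ N : ℕ → ℝ, ∀ (π : Measure Y) (ν : Measure Ω), IsProbabilityMeasure π →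
      IsProbabilityMeasure ν →
      (∀ f : Y → ℝ≥0∞, ∫⁻ y, f y ∂π = ∫⁻ y, ∫⁻ ω, f (T y ω) ∂ν ∂π) →
      (∀ y, ∀ᵐ ω ∂ν, |W (T y ω) - W y| ≤ D) →
      (∀ y, ∫ ω, (W (T y ω) ^ 2 - W y ^ 2) ∂ν ≤ K - 2 * η * W y) →
      ∀ n : ℕ, ∫⁻ y, ENNReal.ofReal (W y ^ n) ∂π ≤ ENNReal.ofReal (N n) := by
  obtain ⟨θ, hθ⟩ : ∃ θ, θ = min (1 / D) (η / (4 * D ^ 2)) := ⟨_, rfl⟩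
  have hθ0 : 0 < θ := hθ ▸ lt_min (by positivity) (by positivity)
  obtain ⟨C, hC⟩ : ∃ C, C = Real.exp (θ * (K / η + D)) + θ * η / 4 * Real.exp (θ * (K / η)) :=
    ⟨_, rfl⟩
  have hC0 : 0 < C := hC ▸ by positivity
  refine ⟨fun n => n.factorial / θ ^ n * (C / (θ * η / 4)), ?_⟩
  intro π ν hπ hν hst hjump hdrift n
  let F : Y → ℝ≥0∞ := fun y => ENNReal.ofReal (Real.exp (θ * W y))
  have hstep : ∀ y, ∫⁻ ω, F (T y ω) ∂ν + ENNReal.ofReal (θ * η / 4) * F y ≤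
      F y + ENNReal.ofReal C := by
    intro y
    obtain ⟨h1, h2⟩ := integral_exp_step_le hD hK hη hθ y (hT y) (hjump y) (hdrift y)
    simp only [F]
    rw [← ofReal_integral_eq_lintegral_ofReal h1 (ae_of_all _ fun _ => (Real.exp_pos _).le),
      ← ENNReal.ofReal_mul (by positivity), ← ENNReal.ofReal_add _ (by positivity),
      ← ENNReal.ofReal_add (by positivity) hC0.le, hC]
    · exact ENNReal.ofReal_le_ofReal h2
    · exact integral_nonneg fun _ => (Real.exp_pos _).le
  have htrunc : ∀ N : ℕ, ENNReal.ofReal (θ * η / 4) *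
      ∫⁻ y, {y | F y < N}.indicator F y ∂π ≤ ENNReal.ofReal C := by
    intro N
    have hfin : ∫⁻ y, min (F y) N ∂π ≠ ∞ := by
      refine ne_top_of_le_ne_top (b := (N : ℝ≥0∞)) (by simp) ?_
      calc ∫⁻ y, min (F y) N ∂π ≤ ∫⁻ y, (N : ℝ≥0∞) ∂π := lintegral_mono fun y => min_le_right _ _
        _ = N := by simp
    have hpt : ∀ y, ∫⁻ ω, min (F (T y ω)) N ∂ν +
        ENNReal.ofReal (θ * η / 4) * {y | F y < N}.indicator F y ≤
          min (F y) N + ENNReal.ofReal C := by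
      intro y
      by_cases hy : F y < N
      · rw [Set.indicator_of_mem (show y ∈ {y | F y < N} from hy), min_eq_left hy.le]
        refine le_trans ?_ (hstep y)
        gcongr
        exact min_le_left _ _
      · rw [Set.indicator_of_notMem (show y ∉ {y | F y < N} from hy), mul_zero, add_zero,
          min_eq_right (not_lt.1 hy)]
        refine le_trans ?_ le_self_add
        calc ∫⁻ ω, min (F (T y ω)) N ∂ν ≤ ∫⁻ ω, (N : ℝ≥0∞) ∂ν :=
              lintegral_mono fun y => min_le_right _ _
          _ = N := by simp
    have h1 := lintegral_mono (μ := π) hpt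
    rw [lintegral_add_left Measurable.of_discrete, lintegral_add_left Measurable.of_discrete,
      lintegral_const_mul _ Measurable.of_discrete, ← hst (fun y => min (F y) N)] at h1
    simp only [lintegral_const, measure_univ, mul_one] at h1
    exact (ENNReal.add_le_add_iff_left hfin).1 h1
  have hF : ENNReal.ofReal (θ * η / 4) * ∫⁻ y, F y ∂π ≤ ENNReal.ofReal C := by
    have hsup : ∀ y, F y = ⨆ N : ℕ, {y | F y < (N : ℝ≥0∞)}.indicator F y := by
      intro y
      refine le_antisymm ?_ (iSup_le fun N => Set.indicator_le_self' (fun _ _ => zero_le) _)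
      obtain ⟨N, hN⟩ := ENNReal.exists_nat_gt (show F y ≠ ∞ from ENNReal.ofReal_ne_top)
      refine le_iSup_of_le N ?_
      rw [Set.indicator_of_mem (show y ∈ {y | F y < N} from hN)]
    rw [lintegral_congr hsup, lintegral_iSup (fun N => Measurable.of_discrete), ENNReal.mul_iSup]
    · exact iSup_le htrunc
    · intro N N' hNN' y
      refine Set.indicator_le_indicator_of_subset (fun y hy => ?_) (fun _ => zero_le) y
      exact lt_of_lt_of_le (b := (N : ℝ≥0∞)) hy (by exact_mod_cast hNN')
  have hF' : ∫⁻ y, F y ∂π ≤ ENNReal.ofReal (C / (θ * η / 4)) := by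
    rw [ENNReal.ofReal_div_of_pos (by positivity),
      ENNReal.le_div_iff_mul_le (Or.inl (by simp; positivity)) (Or.inl ENNReal.ofReal_ne_top),
      mul_comm]
    exact hF
  calc ∫⁻ y, ENNReal.ofReal (W y ^ n) ∂π
      ≤ ∫⁻ y, ENNReal.ofReal (n.factorial / θ ^ n) * F y ∂π := by
        refine lintegral_mono fun y => ?_
        simp only [F]
        rw [← ENNReal.ofReal_mul (by positivity)]
        refine ENNReal.ofReal_le_ofReal ?_
        have h1 := Real.pow_div_factorial_le_exp (θ * W y) (mul_nonneg hθ0.le (hW y)) n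
        rw [mul_pow, div_le_iff₀ (by positivity)] at h1
        rw [div_mul_eq_mul_div, le_div_iff₀ (by positivity)]
        linarith
    _ = ENNReal.ofReal (n.factorial / θ ^ n) * ∫⁻ y, F y ∂π :=
        lintegral_const_mul _ Measurable.of_discrete
    _ ≤ ENNReal.ofReal (n.factorial / θ ^ n) * ENNReal.ofReal (C / (θ * η / 4)) := by gcongr
    _ = _ := by rw [← ENNReal.ofReal_mul (by positivity)]

end Hajek

/-! ### A stationary single-server queue -/

section SingleQueue

variable {Ω : Type*} [MeasurableSpace Ω] {μ : Measure Ω} {X Y U : Ω → ℝ}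
  {b ε : ℝ}

/-- In a stationary queue, the mean unused service `U` balances the mean net input `-ε`. -/
theorem integral_unused_eq (hX : Integrable X μ) (hY : Integrable Y μ) (hU : Integrable U μ)
    (hst : IdentDistrib X (fun ω => X ω + Y ω + U ω) μ μ) (hYm : ∫ ω, Y ω ∂μ = -ε) :
    ∫ ω, U ω ∂μ = ε := by
  have h1 := hst.integral_eq
  have h2 : Integrable (fun ω => X ω + Y ω) μ := hX.add hY
  rw [integral_add h2 hU, integral_add hX hY, hYm] at h1
  linarith

variable [IsProbabilityMeasure μ]

/-- The quadratic function, continued linearly beyond `N`, that serves as a test function where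
second moments need not exist. -/
noncomputable def truncSq (N x : ℝ) : ℝ := x ^ 2 - max (x - N) 0 ^ 2

theorem truncSq_nonneg {N x : ℝ} (hN : 0 ≤ N) (hx : 0 ≤ x) : 0 ≤ truncSq N x := by
  unfold truncSq
  rcases le_total x N with h | h
  · rw [max_eq_right (by linarith)]
    nlinarith
  · rw [max_eq_left (by linarith)]
    nlinarith

theorem truncSq_le {N x : ℝ} (hN : 0 ≤ N) (hx : 0 ≤ x) : truncSq N x ≤ 2 * N * x := by
  unfold truncSq
  rcases le_total x N with h | h
  · rw [max_eq_right (by linarith)]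
    nlinarith
  · rw [max_eq_left (by linarith)]
    nlinarith

theorem measurable_truncSq (N : ℝ) : Measurable (truncSq N) := by
  unfold truncSq
  fun_prop

/-- The increment of `truncSq N` over a step `y + u` that ends in a nonnegative point, where
`u ∈ [0, b]` is unused service. -/
theorem truncSq_step {N x y u b : ℝ} (hN : 0 ≤ N) (hu : 0 ≤ u) (hub : u ≤ b)
    (hx' : 0 ≤ x + y + u) :
    truncSq N x + 2 * min x N * y + (if x ≤ N ∧ x + y ≤ N then y ^ 2 else 0) ≤
      truncSq N (x + y + u) + b * u := by
  have h1 : truncSq N (x + y) ≤ truncSq N (x + y + u) + u ^ 2 := by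
    unfold truncSq
    rcases le_total (x + y) N with h | h
    · rw [max_eq_right (by linarith : x + y - N ≤ 0)]
      rcases le_total (x + y + u) N with h' | h'
      · rw [max_eq_right (by linarith : x + y + u - N ≤ 0)]
        nlinarith
      · rw [max_eq_left (by linarith : 0 ≤ x + y + u - N)]
        nlinarith
    · rw [max_eq_left (by linarith : 0 ≤ x + y - N),
        max_eq_left (by linarith : 0 ≤ x + y + u - N)]
      nlinarith
  have h2 : truncSq N x + 2 * min x N * y + (if x ≤ N ∧ x + y ≤ N then y ^ 2 else 0) ≤
      truncSq N (x + y) := by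
    unfold truncSq
    rcases le_or_gt x N with h | h
    · rw [max_eq_right (by linarith : x - N ≤ 0), min_eq_left h]
      rcases le_or_gt (x + y) N with h' | h'
      · rw [max_eq_right (by linarith : x + y - N ≤ 0), if_pos ⟨h, h'⟩]
        nlinarith
      · rw [max_eq_left (by linarith : 0 ≤ x + y - N), if_neg (by intro h; linarith [h.2])]
        nlinarith
    · rw [max_eq_left (by linarith : 0 ≤ x - N), min_eq_right h.le,
        if_neg (by intro h; linarith [h.1])]
      rcases le_total (x + y) N with h' | h'
      · rw [max_eq_right (by linarith : x + y - N ≤ 0)]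
        nlinarith [sq_nonneg (N - x - y)]
      · rw [max_eq_left (by linarith : 0 ≤ x + y - N)]
        nlinarith
  nlinarith

/-- **Lower bound for a single queue.** A stationary queue with net input `Y` of mean `-ε`,
independent of the backlog, and unused service at most `b` satisfies
`E Y ^ 2 ≤ 2 ε E X + b ε`. -/
theorem integral_sq_le_of_stationary_queue (hXm : Measurable X) (hYm : Measurable Y)
    (hX0 : ∀ ω, 0 ≤ X ω) (hX'0 : ∀ ω, 0 ≤ X ω + Y ω + U ω) (hU0 : ∀ ω, 0 ≤ U ω)
    (hUb : ∀ ω, U ω ≤ b) (hX : Integrable X μ) (hY : MemLp Y 2 μ) (hU : Integrable U μ)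
    (hind : IndepFun X Y μ) (hst : IdentDistrib X (fun ω => X ω + Y ω + U ω) μ μ)
    (hYmean : ∫ ω, Y ω ∂μ = -ε) (hε : 0 ≤ ε) :
    ∫ ω, Y ω ^ 2 ∂μ ≤ 2 * ε * ∫ ω, X ω ∂μ + b * ε := by
  have hY1 : Integrable Y μ := hY.integrable (by norm_num)
  have hUm := integral_unused_eq hX hY1 hU hst hYmean
  let G : ℕ → Ω → ℝ := fun N ω => if X ω ≤ N ∧ X ω + Y ω ≤ N then Y ω ^ 2 else 0
  have hGm : ∀ N, Measurable (G N) := fun N =>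
    Measurable.ite ((measurableSet_le hXm measurable_const).inter
      (measurableSet_le (hXm.add hYm) measurable_const)) (hYm.pow_const 2) measurable_const
  have hGle : ∀ N ω, ‖G N ω‖ ≤ Y ω ^ 2 := by
    intro N ω
    simp only [G]
    split_ifs
    · rw [Real.norm_of_nonneg (sq_nonneg _)]
    · simp [sq_nonneg]
  have hGi : ∀ N, Integrable (G N) μ := fun N =>
    hY.integrable_sq.mono' (hGm N).aestronglyMeasurable (ae_of_all _ (hGle N))
  have hbound : ∀ N : ℕ, ∫ ω, G N ω ∂μ ≤ 2 * ε * ∫ ω, X ω ∂μ + b * ε := by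
    intro N
    have hN : (0 : ℝ) ≤ N := Nat.cast_nonneg N
    have hst' := hst.comp (measurable_truncSq N)
    have hi1 : Integrable (truncSq N ∘ X) μ := by
      refine (hX.const_mul (2 * (N : ℝ))).mono'
        ((measurable_truncSq N).comp hXm).aestronglyMeasurable (ae_of_all _ fun ω => ?_)
      rw [Function.comp, Real.norm_of_nonneg (truncSq_nonneg hN (hX0 ω))]
      exact truncSq_le hN (hX0 ω)
    have hi2 := hst'.integrable_iff.1 hi1
    have hmin : Integrable (fun ω => min (X ω) N) μ := by
      refine hX.mono' (hXm.min measurable_const).aestronglyMeasurable (ae_of_all _ fun ω => ?_)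
      rw [Real.norm_of_nonneg (le_min (hX0 ω) hN)]
      exact min_le_left _ _
    have hind' : IndepFun (fun ω => min (X ω) N) Y μ :=
      hind.comp (φ := fun x => min x (N : ℝ)) (measurable_id.min measurable_const) measurable_id
    have hprod := hind'.integral_fun_mul_eq_mul_integral hmin.aestronglyMeasurable
      hY1.aestronglyMeasurable
    have hi3 : Integrable (fun ω => min (X ω) N * Y ω) μ := hind'.integrable_mul hmin hY1
    have hi4 : Integrable (fun ω => 2 * (min (X ω) N * Y ω) + G N ω) μ :=
      (hi3.const_mul 2).add (hGi N)
    have h1 : ∫ ω, ((truncSq N ∘ X) ω + (2 * (min (X ω) N * Y ω) + G N ω)) ∂μ ≤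
        ∫ ω, ((truncSq N ∘ fun ω => X ω + Y ω + U ω) ω + b * U ω) ∂μ := by
      refine integral_mono (hi1.add hi4)
        (hi2.add (hU.const_mul b)) fun ω => ?_
      have := truncSq_step (N := N) hN (hU0 ω) (hUb ω) (hX'0 ω)
      simp only [Function.comp, G]
      linarith
    rw [integral_add hi1 hi4, integral_add hi2 (hU.const_mul b),
      integral_add (hi3.const_mul 2) (hGi N), integral_const_mul, integral_const_mul, hprod,
      hst'.integral_eq, hYmean, hUm] at h1
    have h2 : ∫ ω, min (X ω) N ∂μ ≤ ∫ ω, X ω ∂μ :=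
      integral_mono hmin hX fun ω => min_le_left _ _
    nlinarith
  refine le_of_tendsto' (tendsto_integral_of_dominated_convergence (F := G) (fun ω => Y ω ^ 2)
    (fun N => (hGm N).aestronglyMeasurable) hY.integrable_sq
    (fun N => ae_of_all _ (hGle N)) (ae_of_all _ fun ω => ?_)) hbound
  refine tendsto_const_nhds.congr' ?_
  obtain ⟨N₀, hN₀⟩ := exists_nat_ge (max (X ω) (X ω + Y ω))
  filter_upwards [eventually_ge_atTop N₀] with N hN
  have h1 : (N₀ : ℝ) ≤ N := by exact_mod_cast hN
  simp only [G]
  rw [if_pos ⟨((le_max_left _ _).trans hN₀).trans h1, ((le_max_right _ _).trans hN₀).trans h1⟩]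

/-- **Upper bound for a single queue.** A stationary queue with second moments and net input `Y` of
mean `-ε`, independent of the backlog, satisfies `2 ε E X ≤ E Y ^ 2 + 2 E [X' U]`, where `X'` is the
backlog after the step and `U` is the unused service. -/
theorem stationary_queue_le_integral (hX : MemLp X 2 μ) (hY : MemLp Y 2 μ) (hU : MemLp U 2 μ)
    (hind : IndepFun X Y μ) (hst : IdentDistrib X (fun ω => X ω + Y ω + U ω) μ μ)
    (hYmean : ∫ ω, Y ω ∂μ = -ε) :
    2 * ε * ∫ ω, X ω ∂μ ≤ ∫ ω, Y ω ^ 2 ∂μ + 2 * ∫ ω, (X ω + Y ω + U ω) * U ω ∂μ := by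
  have hX1 : Integrable X μ := hX.integrable (by norm_num)
  have hY1 : Integrable Y μ := hY.integrable (by norm_num)
  have hX' : MemLp (fun ω => X ω + Y ω + U ω) 2 μ := (hX.add hY).add hU
  have hprod := hind.integral_fun_mul_eq_mul_integral hX1.aestronglyMeasurable
      hY1.aestronglyMeasurable
  have hi : Integrable (fun ω => X ω * Y ω) μ := hind.integrable_mul hX1 hY1
  have hi2 : Integrable (fun ω => (X ω + Y ω + U ω) * U ω) μ := hX'.integrable_mul hU
  have hi3 : Integrable (fun ω => Y ω ^ 2 + 2 * ((X ω + Y ω + U ω) * U ω)) μ :=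
    hY.integrable_sq.add (hi2.const_mul 2)
  have hi4 : Integrable
      (fun ω => 2 * (X ω * Y ω) + (Y ω ^ 2 + 2 * ((X ω + Y ω + U ω) * U ω))) μ :=
    (hi.const_mul 2).add hi3
  have hst' : ∫ ω, X ω ^ 2 ∂μ = ∫ ω, (X ω + Y ω + U ω) ^ 2 ∂μ :=
    (hst.comp (measurable_id.pow_const 2)).integral_eq
  have h1 : ∫ ω, (X ω + Y ω + U ω) ^ 2 ∂μ ≤
      ∫ ω, (X ω ^ 2 + (2 * (X ω * Y ω) + (Y ω ^ 2 + 2 * ((X ω + Y ω + U ω) * U ω)))) ∂μ := by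
    refine integral_mono hX'.integrable_sq (hX.integrable_sq.add hi4) fun ω => ?_
    nlinarith [sq_nonneg (U ω)]
  rw [integral_add hX.integrable_sq hi4, integral_add (hi.const_mul 2) hi3,
    integral_add hY.integrable_sq (hi2.const_mul 2), integral_const_mul, integral_const_mul,
    hprod, hYmean, ← hst'] at h1
  linarith

end SingleQueue

/-! ### Expectations over a time slot -/

section Slot

variable {I J M : ℕ} {S : CloudSystem I J M}

instance ArrivalLaw.instIsProbabilityMeasureLaw {J D : ℕ} (α : ArrivalLaw J D) :
    IsProbabilityMeasure α.law := α.isProbabilityMeasure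

theorem ArrivalLaw.integral_sq {J D : ℕ} (α : ArrivalLaw J D) (j : Fin J) :
    ∫ A, (work (A j) : ℝ) ^ 2 ∂α.law = α.rate j ^ 2 + α.var j := by
  have h := variance_eq_sub (α.memLp j)
  have h1 : α.rate j = ∫ A, (work (A j) : ℝ) ∂α.law := rfl
  have h2 : α.var j = Var[fun A : Arrivals J D => (work (A j) : ℝ); α.law] := rfl
  rw [h1, h2, h]
  simp

theorem ArrivalLaw.rate_nonneg {J D : ℕ} (α : ArrivalLaw J D) (j : Fin J) : 0 ≤ α.rate j :=
  integral_nonneg fun A : Arrivals J D => Nat.cast_nonneg (work (A j))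

theorem ArrivalLaw.var_nonneg {J D : ℕ} (α : ArrivalLaw J D) (j : Fin J) : 0 ≤ α.var j :=
  variance_nonneg _ _

namespace Policy

variable (P : Policy S) (α : ArrivalLaw J S.Dmax)

instance instIsProbabilityMeasureSeedLaw : IsProbabilityMeasure P.seedLaw := P.seedProb

instance instIsProbabilityMeasureSlotLaw : IsProbabilityMeasure (P.slotLaw α) := by
  unfold slotLaw
  infer_instance

theorem measurePreserving_arrivals : MeasurePreserving Prod.fst (P.slotLaw α) α.law :=
  measurePreserving_fst

theorem memLp_work_arrivals (j : Fin J) :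
    MemLp (fun ω : Arrivals J S.Dmax × P.Seed => (work (ω.1 j) : ℝ)) 2 (P.slotLaw α) :=
  (α.memLp j).comp_measurePreserving (P.measurePreserving_arrivals α)

theorem integral_arrivals (f : Arrivals J S.Dmax → ℝ) :
    ∫ ω, f ω.1 ∂(P.slotLaw α) = ∫ A, f A ∂α.law := by
  unfold slotLaw
  rw [integral_fun_fst]
  simp

theorem integral_work_arrivals (j : Fin J) :
    ∫ ω, (work (ω.1 j) : ℝ) ∂(P.slotLaw α) = α.rate j :=
  P.integral_arrivals α fun A => (work (A j) : ℝ)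

theorem measurable_work_arrivals (j : Fin J) :
    Measurable fun ω : Arrivals J S.Dmax × P.Seed => (work (ω.1 j) : ℝ) :=
  (Measurable.of_discrete (f := fun A : Arrivals J S.Dmax => (work (A j) : ℝ))).comp measurable_fst

theorem measurable_routed (y : QueueState J M S.Dmax) (j : Fin J) (m : Fin M) :
    Measurable fun ω => P.routed y ω j m := by
  unfold routed
  refine Measurable.ite ?_ (P.measurable_work_arrivals j) measurable_const
  have : {ω | m = P.route y ω j} = {ω | P.route y ω j = m} := by
    ext
    exact eq_comm
  rw [this]
  exact P.measurable_route y j m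

theorem measurable_served (y : QueueState J M S.Dmax) (j : Fin J) (m : Fin M) :
    Measurable fun ω => (P.served y ω j m : ℝ) := by
  have h : Measurable fun ω => P.served y ω j m := by
    refine measurable_to_countable' fun n => ?_
    have : (fun ω => P.served y ω j m) ⁻¹' {n} =
        ⋃ (T : Finset ℕ) (_ : T.card = n), {ω | P.serve y ω j m = T} := by
      ext ω
      simp [served]
    rw [this]
    exact .iUnion fun T => .iUnion fun _ => P.measurable_serve y j m T
  exact (Measurable.of_discrete (f := fun n : ℕ => (n : ℝ))).comp h

theorem memLp_routed (y : QueueState J M S.Dmax) (j : Fin J) (m : Fin M) :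
    MemLp (fun ω => P.routed y ω j m) 2 (P.slotLaw α) :=
  (P.memLp_work_arrivals α j).mono' (P.measurable_routed y j m).aestronglyMeasurable
    (ae_of_all _ fun ω => by
      rw [Real.norm_of_nonneg (P.routed_nonneg y ω j m)]
      exact P.routed_le y ω j m)

theorem memLp_served (y : QueueState J M S.Dmax) (j : Fin J) (m : Fin M) :
    MemLp (fun ω => (P.served y ω j m : ℝ)) 2 (P.slotLaw α) :=
  MemLp.of_bound (P.measurable_served y j m).aestronglyMeasurable S.smax
    (ae_of_all _ fun ω => by
      rw [Real.norm_of_nonneg (Nat.cast_nonneg _)]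
      exact_mod_cast P.served_le_smax y ω j m)

theorem memLp_work_next (y : QueueState J M S.Dmax) (j : Fin J) (m : Fin M) :
    MemLp (fun ω => (work (P.next y ω j m) : ℝ)) 2 (P.slotLaw α) := by
  simp only [P.work_next]
  have h : MemLp (fun ω => (work (y j m) : ℝ) + P.routed y ω j m) 2 (P.slotLaw α) :=
    MemLp.add (f := fun _ => (work (y j m) : ℝ)) (memLp_const _) (P.memLp_routed α y j m)
  exact h.sub (P.memLp_served α y j m)

theorem integrable_sum_work_mul_served (y : QueueState J M S.Dmax) :
    Integrable (fun ω => ∑ m, ∑ j, 2 * (work (y j m) : ℝ) * (P.served y ω j m : ℝ))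
      (P.slotLaw α) :=
  integrable_finsetSum _ fun m _ => integrable_finsetSum _ fun j _ =>
    ((P.memLp_served α y j m).integrable (by norm_num)).const_mul _

end Policy

/-! ### The drift of the sum of squares -/

theorem lyapunovV_queueVec {D : ℕ} (y : QueueState J M D) :
    lyapunovV (queueVec y) = ∑ m, ∑ j, (work (y j m) : ℝ) ^ 2 := rfl

namespace Policy

variable (P : Policy S) (α : ArrivalLaw J S.Dmax)

theorem integrable_lyapunovV_next (y : QueueState J M S.Dmax) :
    Integrable (fun ω => lyapunovV (queueVec (P.next y ω))) (P.slotLaw α) := by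
  simp only [lyapunovV_queueVec]
  exact integrable_finsetSum _ fun m _ => integrable_finsetSum _ fun j _ =>
    (P.memLp_work_next α y j m).integrable_sq

theorem integrable_drift (y : QueueState J M S.Dmax) :
    Integrable (fun ω => lyapunovV (queueVec (P.next y ω)) - lyapunovV (queueVec y))
      (P.slotLaw α) :=
  (P.integrable_lyapunovV_next α y).sub (integrable_const _)

/-- The one-step change of `V`, outcome by outcome, for an arbitrary policy. -/
theorem drift_le (y : QueueState J M S.Dmax) (ω : Arrivals J S.Dmax × P.Seed) :
    lyapunovV (queueVec (P.next y ω)) - lyapunovV (queueVec y) ≤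
      ∑ j, ((work (ω.1 j) : ℝ) ^ 2 + 2 * ((work (y j (P.route y ω j)) : ℝ) * work (ω.1 j)))
        + M * J * (S.smax : ℝ) ^ 2
        - ∑ m, ∑ j, 2 * (work (y j m) : ℝ) * (P.served y ω j m : ℝ) := by
  have h1 : ∀ j m, (work (P.next y ω j m) : ℝ) ^ 2 - (work (y j m) : ℝ) ^ 2 ≤
      (P.routed y ω j m ^ 2 + 2 * (work (y j m) * P.routed y ω j m)) + (S.smax : ℝ) ^ 2
        - 2 * (work (y j m) : ℝ) * (P.served y ω j m : ℝ) := by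
    intro j m
    rw [P.work_next]
    have h2 := P.routed_nonneg y ω j m
    have h3 : (0 : ℝ) ≤ P.served y ω j m := Nat.cast_nonneg _
    have h4 : (P.served y ω j m : ℝ) ≤ S.smax := by exact_mod_cast P.served_le_smax y ω j m
    nlinarith [mul_nonneg h2 h3]
  calc lyapunovV (queueVec (P.next y ω)) - lyapunovV (queueVec y)
      = ∑ m, ∑ j, ((work (P.next y ω j m) : ℝ) ^ 2 - (work (y j m) : ℝ) ^ 2) := by
        simp only [lyapunovV_queueVec, Finset.sum_sub_distrib]
    _ ≤ ∑ m, ∑ j, ((P.routed y ω j m ^ 2 + 2 * (work (y j m) * P.routed y ω j m))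
          + (S.smax : ℝ) ^ 2 - 2 * (work (y j m) : ℝ) * (P.served y ω j m : ℝ)) :=
        Finset.sum_le_sum fun m _ => Finset.sum_le_sum fun j _ => h1 j m
    _ = _ := by
        simp only [Finset.sum_sub_distrib, Finset.sum_add_distrib]
        congr 2
        · rw [Finset.sum_comm, Finset.sum_comm (s := Finset.univ) (t := Finset.univ)
            (f := fun m j => 2 * (work (y j m) * P.routed y ω j m))]
          simp only [← Finset.mul_sum, P.sum_routed_sq,
            P.sum_mul_routed y ω _ (fun m => (work (y _ m) : ℝ))]
        · simp
          ring

variable {P}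

/-- The minimum over a set of two is the mean minus half the distance. -/
theorem _root_.inf'_le_of_card_eq_two {M : ℕ} (q : Fin M → ℝ) (u v : Fin M) {T : Finset (Fin M)}
    (hT : T.card = 2) (hne : T.Nonempty) :
    T.inf' hne q ≤ (∑ x ∈ T, q x) / 2 - if T = {u, v} then |q u - q v| / 2 else 0 := by
  obtain ⟨a, b, hab, rfl⟩ := Finset.card_eq_two.1 hT
  have ha : Finset.inf' {a, b} hne q ≤ q a := Finset.inf'_le _ (by simp)
  have hb : Finset.inf' {a, b} hne q ≤ q b := Finset.inf'_le _ (by simp)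
  rw [Finset.sum_pair hab]
  split_ifs with h
  · have hu : u = a ∨ u = b := by
      have : u ∈ ({a, b} : Finset (Fin M)) := h ▸ (by simp)
      simpa using this
    have hv : v = a ∨ v = b := by
      have : v ∈ ({a, b} : Finset (Fin M)) := h ▸ (by simp)
      simpa using this
    rcases hu with hu | hu <;> rcases hv with hv | hv <;>
      rcases abs_cases (q u - q v) with ⟨h1, _⟩ | ⟨h1, _⟩ <;> rw [h1, hu, hv] <;> linarith
  · linarith

/-- Averaged over all sets of two servers, the shorter of two queues falls short of the mean queue
by a multiple of the distance of any two queues. -/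
theorem _root_.sum_powersetCard_two_inf'_le {M : ℕ} (q : Fin M → ℝ) (u v : Fin M)
    (g : Finset (Fin M) → ℝ) (hg : ∀ T, ∀ hne : T.Nonempty, g T = T.inf' hne q) :
    ∑ T ∈ Finset.powersetCard 2 Finset.univ, g T ≤
      ((M : ℝ) - 1) / 2 * ∑ m, q m - |q u - q v| / 2 := by
  have hM : 1 ≤ M := u.pos
  calc ∑ T ∈ Finset.powersetCard 2 Finset.univ, g T
      ≤ ∑ T ∈ Finset.powersetCard 2 Finset.univ,
        ((∑ x, if x ∈ T then q x else 0) / 2 - if T = {u, v} then |q u - q v| / 2 else 0) := by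
        refine Finset.sum_le_sum fun T hT => ?_
        rw [Finset.mem_powersetCard_univ] at hT
        have hne : T.Nonempty := Finset.card_pos.1 (by omega)
        rw [hg T hne]
        simpa using inf'_le_of_card_eq_two q u v hT hne
    _ = ((M : ℝ) - 1) / 2 * ∑ m, q m - |q u - q v| / 2 := by
        rw [Finset.sum_sub_distrib, ← Finset.sum_div, Finset.sum_comm]
        have h1 : ∀ x : Fin M, ∑ T ∈ Finset.powersetCard 2 Finset.univ,
            (if x ∈ T then q x else 0) = ((M : ℝ) - 1) * q x := by
          intro x
          rw [← Finset.sum_filter, Finset.sum_const]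
          have h2 := Finset.card_filter_powersetCard_subset {x} (Finset.univ : Finset (Fin M)) 2
            (by simp) (by simp)
          simp only [Finset.singleton_subset_iff, Finset.card_univ, Fintype.card_fin,
            Finset.card_singleton] at h2
          rw [h2]
          simp [Nat.cast_sub hM]
        rw [Finset.sum_congr rfl fun x _ => h1 x, ← Finset.mul_sum]
        have h3 : ∑ T ∈ Finset.powersetCard 2 (Finset.univ : Finset (Fin M)),
            (if T = {u, v} then |q u - q v| / 2 else 0) = |q u - q v| / 2 := by
          rw [Finset.sum_ite_eq']
          rcases eq_or_ne u v with rfl | h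
          · simp
          · rw [if_pos]
            rw [Finset.mem_powersetCard_univ, Finset.card_pair h]
        rw [h3]
        ring

/-- Power-of-two-choices routing sends the arrivals, on average, to a queue that is shorter than the
mean queue by a multiple of the distance of any two queues. The length of the chosen queue is the
minimum over the sampled set, which does not depend on the arrivals, whatever the tie-breaking. -/
theorem IsPowerOfTwoRouting.integral_work_route_le (h : P.IsPowerOfTwoRouting) (hM : 2 ≤ M)
    (y : QueueState J M S.Dmax) (j : Fin J) (u v : Fin M) :
    Integrable (fun ω => (work (y j (P.route y ω j)) : ℝ) * work (ω.1 j)) (P.slotLaw α) ∧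
    ∫ ω, (work (y j (P.route y ω j)) : ℝ) * work (ω.1 j) ∂(P.slotLaw α) ≤
      α.rate j * ((∑ m, (work (y j m) : ℝ)) / M
        - |(work (y j u) : ℝ) - work (y j v)| / (M : ℝ) ^ 2) := by
  obtain ⟨pair, hcard, hlaw, hmin⟩ := h
  let q : Fin M → ℝ := fun m => (work (y j m) : ℝ)
  let g : Finset (Fin M) → ℝ := fun T => if hne : T.Nonempty then T.inf' hne q else 0
  have hg : ∀ T, ∀ hne : T.Nonempty, g T = T.inf' hne q := fun T hne => dif_pos hne
  have hne : ∀ ξ, (pair ξ j).Nonempty := fun ξ => Finset.card_pos.1 (by rw [hcard]; omega)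
  have hroute : ∀ ω : Arrivals J S.Dmax × P.Seed,
      (work (y j (P.route y ω j)) : ℝ) = g (pair ω.2 j) := by
    rintro ⟨A, ξ⟩
    rw [hg _ (hne ξ)]
    refine le_antisymm (Finset.le_inf' _ _ fun m hm => ?_) (Finset.inf'_le q (hmin y A ξ j).1)
    exact Nat.cast_le.2 ((hmin y A ξ j).2 m hm)
  have hsum : ∀ ξ, g (pair ξ j) = ∑ T ∈ Finset.powersetCard 2 Finset.univ,
      {ξ | pair ξ j = T}.indicator (fun _ => g T) ξ := by
    intro ξ
    rw [Finset.sum_eq_single (pair ξ j)]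
    · simp
    · intro T _ hT
      exact Set.indicator_of_notMem (fun h : pair ξ j = T => hT h.symm) _
    · intro hT
      exact absurd (Finset.mem_powersetCard_univ.2 (hcard ξ j)) hT
  have hgi : ∀ T ∈ Finset.powersetCard 2 (Finset.univ : Finset (Fin M)),
      Integrable ({ξ | pair ξ j = T}.indicator (fun _ => g T)) P.seedLaw := fun T hT =>
    (integrable_const _).indicator (hlaw j T (Finset.mem_powersetCard_univ.1 hT)).1
  have hint : Integrable (fun ξ => g (pair ξ j)) P.seedLaw := by
    simp only [hsum]
    exact integrable_finsetSum _ hgi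
  have hM1 : (2 : ℝ) ≤ M := by exact_mod_cast hM
  have hchoose : ((M.choose 2 : ℕ) : ℝ)⁻¹ = 2 / (M * (M - 1)) := by
    rw [Nat.cast_choose_two, inv_div]
  have hval : ∫ ξ, g (pair ξ j) ∂P.seedLaw ≤ (∑ m, q m) / M - |q u - q v| / (M : ℝ) ^ 2 := by
    calc ∫ ξ, g (pair ξ j) ∂P.seedLaw
        = 2 / (M * (M - 1)) * ∑ T ∈ Finset.powersetCard 2 Finset.univ, g T := by
          simp only [hsum]
          rw [integral_finsetSum _ hgi, Finset.mul_sum]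
          refine Finset.sum_congr rfl fun T hT => ?_
          have hT' := hlaw j T (Finset.mem_powersetCard_univ.1 hT)
          rw [integral_indicator_const _ hT'.1, measureReal_def, hT'.2, ENNReal.toReal_inv,
            ENNReal.toReal_natCast, hchoose, smul_eq_mul]
      _ ≤ 2 / (M * (M - 1)) * (((M : ℝ) - 1) / 2 * ∑ m, q m - |q u - q v| / 2) := by
          refine mul_le_mul_of_nonneg_left (sum_powersetCard_two_inf'_le q u v g hg) ?_
          have : (0 : ℝ) ≤ M - 1 := by linarith
          positivity
      _ = (∑ m, q m) / M - |q u - q v| / (M * (M - 1)) := by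
          have h1 : (M : ℝ) ≠ 0 := by positivity
          have h2 : (M : ℝ) - 1 ≠ 0 := by linarith
          field_simp
      _ ≤ _ := by
          have h2 : 0 < (M : ℝ) - 1 := by linarith
          have h3 : (M : ℝ) * (M - 1) ≤ (M : ℝ) ^ 2 := by nlinarith
          have := div_le_div_of_nonneg_left (abs_nonneg (q u - q v)) (by positivity) h3
          linarith
  have hfun : (fun ω : Arrivals J S.Dmax × P.Seed =>
      (work (y j (P.route y ω j)) : ℝ) * work (ω.1 j)) =
      fun ω => (fun A : Arrivals J S.Dmax => (work (A j) : ℝ)) ω.1 *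
        (fun ξ => g (pair ξ j)) ω.2 := by
    ext ω
    rw [hroute, mul_comm]
  rw [hfun]
  unfold slotLaw
  refine ⟨((α.memLp j).integrable (by norm_num)).mul_prod hint, ?_⟩
  refine (integral_prod_mul (fun A : Arrivals J S.Dmax => (work (A j) : ℝ))
    (fun ξ => g (pair ξ j))).trans_le ?_
  exact mul_le_mul_of_nonneg_left hval (α.rate_nonneg j)

/-- The drift of `V` under power-of-two-choices routing. The choice of two servers `u j`, `v j` for
each type is free: it measures the imbalance of the queues. -/
theorem IsPowerOfTwoRouting.integral_drift_le (h : P.IsPowerOfTwoRouting) (hM : 2 ≤ M)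
    (y : QueueState J M S.Dmax) (u v : Fin J → Fin M) :
    ∫ ω, (lyapunovV (queueVec (P.next y ω)) - lyapunovV (queueVec y)) ∂(P.slotLaw α) ≤
      ∑ j, (α.rate j ^ 2 + α.var j) + M * J * (S.smax : ℝ) ^ 2
        + ∑ j, 2 * α.rate j * ((∑ m, (work (y j m) : ℝ)) / M
          - |(work (y j (u j)) : ℝ) - work (y j (v j))| / (M : ℝ) ^ 2)
        - ∫ ω, ∑ m, ∑ j, 2 * (work (y j m) : ℝ) * (P.served y ω j m : ℝ) ∂(P.slotLaw α) := by
  have hr := fun j => h.integral_work_route_le α hM y j (u j) (v j)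
  have hi1 : ∀ j, Integrable (fun ω : Arrivals J S.Dmax × P.Seed => (work (ω.1 j) : ℝ) ^ 2)
      (P.slotLaw α) := fun j => (P.memLp_work_arrivals α j).integrable_sq
  have hi2 : ∀ j, Integrable (fun ω : Arrivals J S.Dmax × P.Seed => (work (ω.1 j) : ℝ) ^ 2 +
      2 * ((work (y j (P.route y ω j)) : ℝ) * work (ω.1 j))) (P.slotLaw α) :=
    fun j => (hi1 j).add ((hr j).1.const_mul 2)
  have hi3 : Integrable (fun ω : Arrivals J S.Dmax × P.Seed => ∑ j, ((work (ω.1 j) : ℝ) ^ 2 +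
      2 * ((work (y j (P.route y ω j)) : ℝ) * work (ω.1 j)))) (P.slotLaw α) :=
    integrable_finsetSum _ fun j _ => hi2 j
  have hi4 : Integrable (fun ω : Arrivals J S.Dmax × P.Seed => ∑ j, ((work (ω.1 j) : ℝ) ^ 2 +
      2 * ((work (y j (P.route y ω j)) : ℝ) * work (ω.1 j))) + M * J * (S.smax : ℝ) ^ 2)
      (P.slotLaw α) := hi3.add (integrable_const _)
  have hi5 := P.integrable_sum_work_mul_served α y
  have h1 := integral_mono (P.integrable_drift α y) (hi4.sub hi5) fun ω => P.drift_le y ω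
  simp only [Pi.sub_apply] at h1
  rw [integral_sub hi4 hi5, integral_add hi3 (integrable_const _),
    integral_finsetSum _ fun j _ => hi2 j] at h1
  have h2 : ∀ j, ∫ ω, ((work (ω.1 j) : ℝ) ^ 2 +
      2 * ((work (y j (P.route y ω j)) : ℝ) * work (ω.1 j))) ∂(P.slotLaw α) ≤
      (α.rate j ^ 2 + α.var j) + 2 * α.rate j * ((∑ m, (work (y j m) : ℝ)) / M
          - |(work (y j (u j)) : ℝ) - work (y j (v j))| / (M : ℝ) ^ 2) := by
    intro j
    rw [integral_add (hi1 j) ((hr j).1.const_mul 2), integral_const_mul,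
      P.integral_arrivals α fun A => (work (A j) : ℝ) ^ 2, α.integral_sq]
    linarith [(hr j).2]
  have h3 := Finset.sum_le_sum fun j (_ : j ∈ Finset.univ) => h2 j
  rw [Finset.sum_add_distrib] at h3
  simp only [integral_const, probReal_univ, one_smul] at h1
  linarith

theorem _root_.sum_moments_le_driftConst (hM : 1 ≤ M) :
    ∑ j, (α.rate j ^ 2 + α.var j) + M * J * (S.smax : ℝ) ^ 2
      + 2 * M * J * S.Dmax * (S.smax : ℝ) ^ 2 ≤ driftConst S α := by
  have hM1 : (1 : ℝ) ≤ M := by exact_mod_cast hM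
  have h1 : 0 ≤ ∑ j, (α.rate j ^ 2 + α.var j) :=
    Finset.sum_nonneg fun j _ => add_nonneg (sq_nonneg _) (α.var_nonneg j)
  have h2 : (0 : ℝ) ≤ M * J * (S.smax : ℝ) ^ 2 := by positivity
  unfold driftConst
  nlinarith

/-- MaxWeight scheduling serves, in terms of the weights `q`, at least as well as any choice of
vectors `x m` in the capacity region, up to a constant. -/
theorem IsMaxWeightScheduling.le_integral_served (h : P.IsMaxWeightScheduling) (hid : S.Identical)
    (y : QueueState J M S.Dmax) {x : Fin M → JobVec J} (hx : ∀ m, x m ∈ S.capacity) :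
    2 / M * ∑ m, ∑ j, x m j * (work (y j m) : ℝ) - 2 * M * J * S.Dmax * (S.smax : ℝ) ^ 2 ≤
      ∫ ω, ∑ m, ∑ j, 2 * (work (y j m) : ℝ) * (P.served y ω j m : ℝ) ∂(P.slotLaw α) := by
  have hpt : ∀ ω, 2 / M * ∑ m, ∑ j, x m j * (work (y j m) : ℝ)
      - 2 * M * J * S.Dmax * (S.smax : ℝ) ^ 2 ≤
      ∑ m, ∑ j, 2 * (work (y j m) : ℝ) * (P.served y ω j m : ℝ) := by
    intro ω
    have h1 : ∀ m, 2 / M * ∑ j, x m j * (work (y j m) : ℝ) ≤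
        ∑ j, (2 * (work (y j m) : ℝ) * (P.served y ω j m : ℝ)
          + 2 * (S.Dmax * (S.smax : ℝ) ^ 2)) := by
      intro m
      have hMpos : (0 : ℝ) < M := by exact_mod_cast m.pos
      calc 2 / M * ∑ j, x m j * (work (y j m) : ℝ)
          ≤ 2 / M * (M * ∑ j, (P.sched y ω m j : ℝ) * work (y j m)) :=
            mul_le_mul_of_nonneg_left (h.sum_mul_work_le hid (hx m) y ω m) (by positivity)
        _ = ∑ j, 2 * ((P.sched y ω m j : ℝ) * work (y j m)) := by
            rw [← Finset.mul_sum]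
            field_simp
        _ ≤ _ := Finset.sum_le_sum fun j _ => by
            linarith [h.work_mul_sched_le y ω j m]
    have h2 := Finset.sum_le_sum fun m (_ : m ∈ Finset.univ) => h1 m
    rw [← Finset.mul_sum] at h2
    simp only [Finset.sum_add_distrib, Finset.sum_const, Finset.card_univ, Fintype.card_fin,
      nsmul_eq_mul] at h2
    linarith
  calc _ = ∫ ω, (2 / M * ∑ m, ∑ j, x m j * (work (y j m) : ℝ)
      - 2 * M * J * S.Dmax * (S.smax : ℝ) ^ 2) ∂(P.slotLaw α) := by simp
    _ ≤ _ := integral_mono (integrable_const _) (P.integrable_sum_work_mul_served α y) hpt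

/-- The drift of `V` under power-of-two-choices routing and MaxWeight scheduling, compared with
arbitrary vectors `x m` of the capacity region. -/
theorem integral_drift_le_of_capacity (hM : 2 ≤ M) (hid : S.Identical)
    (hroute : P.IsPowerOfTwoRouting) (hsched : P.IsMaxWeightScheduling)
    (y : QueueState J M S.Dmax) {x : Fin M → JobVec J} (hx : ∀ m, x m ∈ S.capacity)
    (u v : Fin J → Fin M) :
    ∫ ω, (lyapunovV (queueVec (P.next y ω)) - lyapunovV (queueVec y)) ∂(P.slotLaw α) ≤
      driftConst S α - 2 / M * ∑ m, ∑ j, (x m j - α.rate j) * (work (y j m) : ℝ)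
        - 2 / (M : ℝ) ^ 2 * ∑ j, α.rate j * |(work (y j (u j)) : ℝ) - work (y j (v j))| := by
  have h1 := hroute.integral_drift_le α hM y u v
  have h2 := hsched.le_integral_served α hid y hx
  have h3 := sum_moments_le_driftConst (S := S) α (by omega : 1 ≤ M)
  have h4 : ∑ j, 2 * α.rate j * ((∑ m, (work (y j m) : ℝ)) / M
          - |(work (y j (u j)) : ℝ) - work (y j (v j))| / (M : ℝ) ^ 2) =
      2 / M * ∑ m, ∑ j, α.rate j * (work (y j m) : ℝ)
        - 2 / (M : ℝ) ^ 2 * ∑ j, α.rate j * |(work (y j (u j)) : ℝ) - work (y j (v j))| := by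
    rw [Finset.sum_comm, Finset.mul_sum, Finset.mul_sum, ← Finset.sum_sub_distrib]
    refine Finset.sum_congr rfl fun j _ => ?_
    rw [← Finset.mul_sum]
    ring
  have h5 : ∑ m, ∑ j, (x m j - α.rate j) * (work (y j m) : ℝ) =
      ∑ m, ∑ j, x m j * (work (y j m) : ℝ) - ∑ m, ∑ j, α.rate j * (work (y j m) : ℝ) := by
    simp only [sub_mul, Finset.sum_sub_distrib]
  rw [h5, mul_sub]
  linarith

end Policy

end Slot

/-! ### Steady states -/

theorem exists_pos_add_smul_mem_of_mem_interior {E : Type*} [NormedAddCommGroup E]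
    [NormedSpace ℝ E] {C : Set E} {x : E} (hx : x ∈ interior C) (v : E) :
    ∃ δ > (0 : ℝ), x + δ • v ∈ C := by
  have h : Tendsto (fun δ : ℝ => x + δ • v) (𝓝[>] 0) (𝓝 x) := by
    have : Tendsto (fun δ : ℝ => x + δ • v) (𝓝 0) (𝓝 (x + (0 : ℝ) • v)) :=
      Continuous.tendsto (by fun_prop) 0
    rw [zero_smul, add_zero] at this
    exact this.mono_left nhdsWithin_le_nhds
  obtain ⟨δ, h1, h2⟩ :=
    ((h.eventually (mem_interior_iff_mem_nhds.1 hx)).and self_mem_nhdsWithin).exists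
  exact ⟨δ, h2, h1⟩

section Steady

variable {I J M : ℕ} {S : CloudSystem I J M}

namespace Policy

variable (P : Policy S) (α : ArrivalLaw J S.Dmax)

theorem kernel_apply (y : QueueState J M S.Dmax) :
    P.kernel α y = (P.slotLaw α).map (P.next y) := rfl

instance instIsMarkovKernelKernel : IsMarkovKernel (P.kernel α) :=
  ⟨fun y => Measure.isProbabilityMeasure_map (P.measurable_next y).aemeasurable⟩

theorem _root_.finite_setOf_sum_work_le (D : ℕ) (B : ℝ) :
    {y : QueueState J M D | ∑ m, ∑ j, (work (y j m) : ℝ) ≤ B}.Finite := by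
  refine (Set.Finite.pi' fun _ : Fin J => Set.Finite.pi' fun _ : Fin M =>
    finite_setOf_work_le (D := D) ⌈B⌉₊).subset fun y hy j m => ?_
  have h1 : (work (y j m) : ℝ) ≤ B :=
    ((Finset.single_le_sum (f := fun j => (work (y j m) : ℝ)) (fun _ _ => Nat.cast_nonneg _)
      (Finset.mem_univ j)).trans (Finset.single_le_sum
        (f := fun m => ∑ j, (work (y j m) : ℝ))
        (fun _ _ => Finset.sum_nonneg fun _ _ => Nat.cast_nonneg _) (Finset.mem_univ m))).trans hy
  have h2 : (work (y j m) : ℝ) ≤ ⌈B⌉₊ := h1.trans (Nat.le_ceil _)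
  exact_mod_cast h2

theorem _root_.lyapunovV_nonneg (q : QueueVec J M) : 0 ≤ lyapunovV q :=
  Finset.sum_nonneg fun _ _ => Finset.sum_nonneg fun _ _ => sq_nonneg _

theorem _root_.driftConst_nonneg : 0 ≤ driftConst S α := by
  have h1 : 0 ≤ ∑ j, (α.rate j ^ 2 + α.var j) :=
    Finset.sum_nonneg fun j _ => add_nonneg (sq_nonneg _) (α.var_nonneg j)
  unfold driftConst
  positivity

/-- For rates inside the capacity region, some `λ + δ (1, …, 1)` is in the region, and comparing the
service with this vector shows that `V` has drift at most `K' - (2 δ / M) ∑ q`. -/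
theorem exists_isSteadyState (hM : 2 ≤ M) (hid : S.Identical)
    (hroute : P.IsPowerOfTwoRouting) (hsched : P.IsMaxWeightScheduling)
    (hα : α.rate ∈ interior S.capacity) : ∃ π, P.IsSteadyState α π := by
  obtain ⟨δ, hδ, hmem⟩ := exists_pos_add_smul_mem_of_mem_interior hα
    (WithLp.toLp 2 fun _ => 1 : JobVec J)
  have hMpos : (0 : ℝ) < M := by
    have : 0 < M := by omega
    exact_mod_cast this
  have m0 : Fin M := ⟨0, by omega⟩
  let c : ℝ := 2 / M * δ
  have hc : 0 < c := by positivity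
  have hdrift : ∀ y, ∫ ω, (lyapunovV (queueVec (P.next y ω)) - lyapunovV (queueVec y))
      ∂(P.slotLaw α) ≤ driftConst S α - c * ∑ m, ∑ j, (work (y j m) : ℝ) := by
    intro y
    have h := integral_drift_le_of_capacity α hM hid hroute hsched y (fun _ => hmem)
      (fun _ => m0) (fun _ => m0)
    simp only [PiLp.add_apply, PiLp.smul_apply, smul_eq_mul, mul_one, add_sub_cancel_left,
      sub_self, abs_zero, mul_zero, Finset.sum_const_zero, sub_zero, ← Finset.mul_sum] at h
    rwa [← mul_assoc] at h
  refine (P.kernel α).exists_invariant_of_drift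
    (fun y => ENNReal.ofReal (lyapunovV (queueVec y)))
    (fun y => ENNReal.ofReal (c * ∑ m, ∑ j, (work (y j m) : ℝ))) (ENNReal.ofReal (driftConst S α))
    (fun y => ENNReal.ofReal_ne_top) ENNReal.ofReal_ne_top (fun y => ?_) (fun n => ?_)
  · have hs : 0 ≤ c * ∑ m, ∑ j, (work (y j m) : ℝ) := by positivity
    have hi := P.integrable_lyapunovV_next α y
    rw [kernel_apply, lintegral_map Measurable.of_discrete (P.measurable_next y),
      ← ofReal_integral_eq_lintegral_ofReal hi (ae_of_all _ fun _ => lyapunovV_nonneg _),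
      ← ENNReal.ofReal_add (integral_nonneg fun _ => lyapunovV_nonneg _) hs,
      ← ENNReal.ofReal_add (lyapunovV_nonneg _) (driftConst_nonneg α)]
    refine ENNReal.ofReal_le_ofReal ?_
    have h := hdrift y
    rw [integral_sub hi (integrable_const _)] at h
    simp only [integral_const, probReal_univ, one_smul] at h
    linarith
  · refine (finite_setOf_sum_work_le S.Dmax (n / c)).subset fun y hy => ?_
    have h1 : ENNReal.ofReal (c * ∑ m, ∑ j, (work (y j m) : ℝ)) < n := hy
    rw [← ENNReal.ofReal_natCast, ENNReal.ofReal_lt_ofReal_iff_of_nonneg (by positivity)] at h1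
    rw [Set.mem_ofPred_eq, le_div_iff₀ hc, mul_comm]
    exact h1.le

variable {P α} {π : Measure (QueueState J M S.Dmax)}

theorem IsSteadyState.lintegral_eq (h : P.IsSteadyState α π)
    (f : QueueState J M S.Dmax → ℝ≥0∞) :
    ∫⁻ y, f y ∂π = ∫⁻ y, ∫⁻ ω, f (P.next y ω) ∂(P.slotLaw α) ∂π := by
  conv_lhs => rw [← h.2.def]
  rw [Measure.lintegral_bind (Kernel.aemeasurable _) Measurable.of_discrete.aemeasurable]
  refine lintegral_congr fun y => ?_
  rw [kernel_apply, lintegral_map Measurable.of_discrete (P.measurable_next y)]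

theorem measurable_uncurry_next : Measurable (Function.uncurry P.next) :=
  measurable_from_prod_countable_right fun y => P.measurable_next y

/-- In a steady state, the state after one slot has the same law as the state before. -/
theorem IsSteadyState.map_next (h : P.IsSteadyState α π) :
    (π.prod (P.slotLaw α)).map (Function.uncurry P.next) = π := by
  have := h.1
  ext s hs
  have h1 := h.lintegral_eq (s.indicator 1)
  rw [lintegral_indicator_one hs] at h1
  rw [h1, Measure.map_apply P.measurable_uncurry_next hs,
    Measure.prod_apply (P.measurable_uncurry_next hs)]
  refine lintegral_congr fun y => ?_
  have h2 : (fun ω => s.indicator (1 : QueueState J M S.Dmax → ℝ≥0∞) (P.next y ω)) =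
      (Prod.mk y ⁻¹' (Function.uncurry P.next ⁻¹' s)).indicator 1 := rfl
  rw [h2, lintegral_indicator_one (measurable_prodMk_left (P.measurable_uncurry_next hs))]

theorem IsSteadyState.identDistrib (h : P.IsSteadyState α π) (f : QueueState J M S.Dmax → ℝ) :
    IdentDistrib (fun p : QueueState J M S.Dmax × (Arrivals J S.Dmax × P.Seed) => f p.1)
      (fun p => f (P.next p.1 p.2)) (π.prod (P.slotLaw α)) (π.prod (P.slotLaw α)) := by
  have := h.1
  have hf : Measurable f := Measurable.of_discrete
  refine ⟨(hf.comp measurable_fst).aemeasurable,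
    (hf.comp P.measurable_uncurry_next).aemeasurable, ?_⟩
  have h1 : Measure.map (fun p : QueueState J M S.Dmax × (Arrivals J S.Dmax × P.Seed) => f p.1)
      (π.prod (P.slotLaw α)) = π.map f := by
    change Measure.map (f ∘ Prod.fst) _ = _
    rw [← Measure.map_map hf measurable_fst, measurePreserving_fst.map_eq]
  have h2 : Measure.map (fun p : QueueState J M S.Dmax × (Arrivals J S.Dmax × P.Seed) =>
      f (P.next p.1 p.2)) (π.prod (P.slotLaw α)) = π.map f := by
    change Measure.map (f ∘ Function.uncurry P.next) _ = _
    rw [← Measure.map_map hf P.measurable_uncurry_next, h.map_next]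
  rw [h1, h2]

end Policy

end Steady

/-! ### Facets of the capacity region -/

namespace HyperplaneDescription

variable {J : ℕ} {C : Set (JobVec J)} (H : HyperplaneDescription C)

theorem inner_c_self (k : Fin H.K) : inner ℝ (H.c k) (H.c k) = 1 := by
  rw [real_inner_self_eq_norm_sq, H.norm_c, one_pow]

theorem c_le_one (k : Fin H.K) (j : Fin J) : H.c k j ≤ 1 := by
  have h := PiLp.norm_apply_le (H.c k) j
  rw [H.norm_c] at h
  exact (le_abs_self _).trans h

theorem mem_iff {x : JobVec J} :
    x ∈ C ↔ (∀ j, 0 ≤ x j) ∧ ∀ k, inner ℝ (H.c k) x ≤ H.b k :=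
  Set.ext_iff.1 H.eq_set x

theorem pos_of_mem_interior {C : Set (JobVec J)} (H : HyperplaneDescription C) {x : JobVec J}
    (hx : x ∈ interior C) (j : Fin J) : 0 < x j := by
  obtain ⟨δ, hδ, h⟩ := exists_pos_add_smul_mem_of_mem_interior hx
    (-EuclideanSpace.single j (1 : ℝ))
  have h1 := (H.mem_iff.1 h).1 j
  simp at h1
  linarith

theorem inner_lt_of_mem_interior {x : JobVec J} (hx : x ∈ interior C) (k : Fin H.K) :
    inner ℝ (H.c k) x < H.b k := by
  obtain ⟨δ, hδ, h⟩ := exists_pos_add_smul_mem_of_mem_interior hx (H.c k)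
  have h1 := (H.mem_iff.1 h).2 k
  rw [inner_add_right, inner_smul_right, H.inner_c_self] at h1
  linarith

/-- As `c k` is a unit normal vector, the distance is attained at `x + (b k - ⟪c k, x⟫) c k`. -/
theorem dist_eq {x : JobVec J} {k : Fin H.K} (hx : inner ℝ (H.c k) x ≤ H.b k) :
    H.dist k x = H.b k - inner ℝ (H.c k) x := by
  have hmem : x + (H.b k - inner ℝ (H.c k) x) • H.c k ∈ H.plane k := by
    simp only [plane, Set.mem_ofPred_eq, inner_add_right, inner_smul_right, H.inner_c_self]
    ring
  apply le_antisymm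
  · refine (Metric.infDist_le_dist_of_mem hmem).trans ?_
    rw [dist_eq_norm, show x - (x + (H.b k - inner ℝ (H.c k) x) • H.c k) =
      -((H.b k - inner ℝ (H.c k) x) • H.c k) by abel, norm_neg, norm_smul, H.norm_c, mul_one,
      Real.norm_of_nonneg (by linarith)]
  · refine (Metric.le_infDist ⟨_, hmem⟩).2 fun z hz => ?_
    have h1 : inner ℝ (H.c k) z = H.b k := hz
    have h2 := real_inner_le_norm (H.c k) (z - x)
    rw [H.norm_c, one_mul, inner_sub_right, h1] at h2
    rwa [dist_comm, dist_eq_norm]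

theorem dist_eq_of_mem_interior {x : JobVec J} (hx : x ∈ interior C) (k : Fin H.K) :
    H.dist k x = H.b k - inner ℝ (H.c k) x :=
  H.dist_eq (H.inner_lt_of_mem_interior hx k).le

theorem dist_pos_of_mem_interior {x : JobVec J} (hx : x ∈ interior C) (k : Fin H.K) :
    0 < H.dist k x := by
  rw [H.dist_eq_of_mem_interior hx]
  linarith [H.inner_lt_of_mem_interior hx k]

theorem dist_le_b_of_mem_interior {x : JobVec J} (hx : x ∈ interior C) (k : Fin H.K) :
    H.dist k x ≤ H.b k := by
  rw [H.dist_eq_of_mem_interior hx, JobVec.inner_eq_sum]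
  have : 0 ≤ ∑ j, H.c k j * x j :=
    Finset.sum_nonneg fun j _ => mul_nonneg (H.c_nonneg k j) (H.pos_of_mem_interior hx j).le
  linarith

theorem inner_proj {x : JobVec J} (hx : x ∈ interior C) (k : Fin H.K) :
    inner ℝ (H.c k) (H.proj k x) = H.b k := by
  rw [proj, inner_add_right, inner_smul_right, H.inner_c_self, H.dist_eq_of_mem_interior hx]
  ring

theorem proj_pos {x : JobVec J} (hx : x ∈ interior C) (k : Fin H.K) (j : Fin J) :
    0 < H.proj k x j := by
  have h1 := H.pos_of_mem_interior hx j
  have h2 := mul_nonneg (H.dist_pos_of_mem_interior hx k).le (H.c_nonneg k j)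
  simp only [proj, PiLp.add_apply, PiLp.smul_apply, smul_eq_mul]
  linarith

/-- As the `k`-th inequality cannot be dropped, some vector violates only this one. The segment from
an interior point to this vector crosses the `k`-th hyperplane at a point where all other
inequalities are strict. -/
theorem exists_mem_plane_strict {x : JobVec J} (hx : x ∈ interior C) (k : Fin H.K) :
    ∃ p ∈ H.plane k, (∀ j, 0 < p j) ∧ ∀ k', k' ≠ k → inner ℝ (H.c k') p < H.b k' := by
  obtain ⟨s, hs, hsk⟩ : ∃ s : JobVec J,
      ((∀ j, 0 ≤ s j) ∧ ∀ k', k' ≠ k → inner ℝ (H.c k') s ≤ H.b k') ∧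
        H.b k < inner ℝ (H.c k) s := by
    by_contra! hcon
    refine H.irredundant k (Set.ext fun s => ⟨fun h => ?_, fun h => ?_⟩)
    · have := H.mem_iff.1 h
      exact ⟨this.1, fun k' _ => this.2 k'⟩
    · refine H.mem_iff.2 ⟨h.1, fun k' => ?_⟩
      by_cases hk : k' = k
      · exact hk ▸ hcon s h
      · exact h.2 k' hk
  have hxk := H.inner_lt_of_mem_interior hx k
  set ux := inner ℝ (H.c k) x
  set us := inner ℝ (H.c k) s
  have hd : 0 < us - ux := by linarith
  let t : ℝ := (H.b k - ux) / (us - ux)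
  have ht0 : 0 < t := div_pos (by linarith) hd
  have ht1 : t < 1 := (div_lt_one hd).2 (by linarith)
  refine ⟨(1 - t) • x + t • s, ?_, fun j => ?_, fun k' hk' => ?_⟩
  · simp only [plane, Set.mem_ofPred_eq, inner_add_right, inner_smul_right]
    change (1 - t) * ux + t * us = H.b k
    have : t * (us - ux) = H.b k - ux := div_mul_cancel₀ _ hd.ne'
    linarith
  · have h1 := H.pos_of_mem_interior hx j
    have h2 := hs.1 j
    simp only [PiLp.add_apply, PiLp.smul_apply, smul_eq_mul]
    nlinarith
  · have h1 := H.inner_lt_of_mem_interior hx k'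
    have h2 := hs.2 k' hk'
    simp only [inner_add_right, inner_smul_right]
    nlinarith

/-- The `k`-th face spans the `k`-th hyperplane, so around a point of its relative interior the
whole hyperplane is in the region. -/
theorem exists_ball_subset_of_mem_strictlyDominant {x : JobVec J} (hx : x ∈ interior C)
    {k : Fin H.K} (hk : k ∈ H.strictlyDominant x) :
    ∃ δ > (0 : ℝ), ∀ v : JobVec J, inner ℝ (H.c k) v = 0 → ‖v‖ ≤ 1 → H.proj k x + δ • v ∈ C := by
  obtain ⟨p, hpk, hp0, hpk'⟩ := H.exists_mem_plane_strict hx k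
  have hface : ∀ v : JobVec J, inner ℝ (H.c k) v = 0 → ∃ t > (0 : ℝ), p + t • v ∈ H.face k := by
    intro v hv
    have hopen : p ∈ interior {z : JobVec J |
        (∀ j, 0 < z j) ∧ ∀ k', k' ≠ k → inner ℝ (H.c k') z < H.b k'} := by
      rw [IsOpen.interior_eq]
      · exact ⟨hp0, hpk'⟩
      · simp only [Set.ofPred_and, Set.ofPred_forall]
        refine IsOpen.inter (isOpen_iInter_of_finite fun j => ?_)
          (isOpen_iInter_of_finite fun k' => isOpen_iInter_of_finite fun _ => ?_)
        · exact isOpen_lt (by fun_prop) (by fun_prop)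
        · exact isOpen_lt (by fun_prop) (by fun_prop)
    obtain ⟨t, ht, hmem⟩ := exists_pos_add_smul_mem_of_mem_interior hopen v
    have hpl : inner ℝ (H.c k) (p + t • v) = H.b k := by
      rw [inner_add_right, inner_smul_right, hv, mul_zero, add_zero]
      exact hpk
    refine ⟨t, ht, H.mem_iff.2 ⟨fun j => (hmem.1 j).le, fun k' => ?_⟩, hpl⟩
    by_cases hk' : k' = k
    · rw [hk', hpl]
    · exact (hmem.2 k' hk').le
  have hp : p ∈ H.face k := by
    obtain ⟨t, -, ht⟩ := hface 0 (inner_zero_right _)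
    simpa using ht
  have hdir : ∀ v : JobVec J, inner ℝ (H.c k) v = 0 →
      v ∈ (affineSpan ℝ (H.face k)).direction := by
    intro v hv
    obtain ⟨t, ht, hmem⟩ := hface v hv
    have h1 := AffineSubspace.vsub_mem_direction (subset_affineSpan ℝ _ hmem)
      (subset_affineSpan ℝ _ hp)
    have h2 := Submodule.smul_mem _ t⁻¹ h1
    simpa [smul_smul, inv_mul_cancel₀ ht.ne'] using h2
  obtain ⟨z, hz, hzx⟩ := mem_intrinsicInterior.1 hk.2
  rw [mem_interior_iff_mem_nhds, Metric.mem_nhds_iff] at hz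
  obtain ⟨r, hr, hball⟩ := hz
  refine ⟨r / 2, by positivity, fun v hv hv1 => ?_⟩
  have hmem : H.proj k x + (r / 2) • v ∈ affineSpan ℝ (H.face k) := by
    rw [← hzx, add_comm]
    exact AffineSubspace.vadd_mem_of_mem_direction (Submodule.smul_mem _ _ (hdir v hv)) z.2
  have h1 : (⟨_, hmem⟩ : affineSpan ℝ (H.face k)) ∈ Metric.ball z r := by
    rw [Metric.mem_ball, Subtype.dist_eq, hzx, dist_eq_norm, add_sub_cancel_left, norm_smul,
      Real.norm_of_nonneg (by positivity)]
    nlinarith [norm_nonneg v]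
  exact (hball h1).1

end HyperplaneDescription

/-! ### Parallel and perpendicular components of the queue lengths -/

section Queues

variable {J M : ℕ}

/-- The queue lengths at server `m`. -/
noncomputable def serverQueue (q : QueueVec J M) (m : Fin M) : JobVec J :=
  WithLp.toLp 2 fun j => q (j, m)

@[simp] theorem serverQueue_apply (q : QueueVec J M) (m : Fin M) (j : Fin J) :
    serverQueue q m j = q (j, m) := rfl

theorem lyapunovV_eq_norm_sq (q : QueueVec J M) : lyapunovV q = ‖q‖ ^ 2 := by
  rw [EuclideanSpace.real_norm_sq_eq, Fintype.sum_prod_type_right]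
  rfl

theorem norm_sq_eq_sum_serverQueue (q : QueueVec J M) : ‖q‖ ^ 2 = ∑ m, ‖serverQueue q m‖ ^ 2 := by
  rw [← lyapunovV_eq_norm_sq]
  simp only [EuclideanSpace.real_norm_sq_eq, serverQueue_apply]
  rfl

theorem norm_le_sum_serverQueue (q : QueueVec J M) : ‖q‖ ≤ ∑ m, ‖serverQueue q m‖ := by
  refine le_of_sq_le_sq ?_ (Finset.sum_nonneg fun _ _ => norm_nonneg _)
  rw [norm_sq_eq_sum_serverQueue]
  exact Finset.sum_sq_le_sq_sum_of_nonneg fun _ _ => norm_nonneg _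

theorem EuclideanSpace.norm_le_sum_abs {ι : Type*} [Fintype ι] (x : EuclideanSpace ℝ ι) :
    ‖x‖ ≤ ∑ i, |x i| := by
  refine le_of_sq_le_sq ?_ (Finset.sum_nonneg fun _ _ => abs_nonneg _)
  rw [EuclideanSpace.real_norm_sq_eq]
  simp only [← sq_abs (x _)]
  exact Finset.sum_sq_le_sq_sum_of_nonneg fun _ _ => abs_nonneg _

theorem norm_spread (hM : 0 < M) {c : JobVec J} (hc : ‖c‖ = 1) : ‖spread M c‖ = 1 := by
  have hM' : (0 : ℝ) < M := by exact_mod_cast hM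
  have h : ‖spread M c‖ ^ 2 = 1 := by
    have h1 : ∑ j, c j ^ 2 = 1 := by rw [← EuclideanSpace.real_norm_sq_eq, hc, one_pow]
    rw [← lyapunovV_eq_norm_sq]
    simp only [lyapunovV, spread, div_pow, Real.sq_sqrt hM'.le, ← Finset.sum_div, h1]
    simp [hM'.ne']
  rwa [pow_eq_one_iff_of_nonneg (norm_nonneg _) two_ne_zero] at h

theorem inner_spread (c : JobVec J) (q : QueueVec J M) :
    inner ℝ (spread M c) q = (∑ m, inner ℝ c (serverQueue q m)) / √(M : ℝ) := by
  simp only [PiLp.inner_apply, Fintype.sum_prod_type_right, Finset.sum_div]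
  refine Finset.sum_congr rfl fun m _ => Finset.sum_congr rfl fun j _ => ?_
  simp only [spread, serverQueue_apply, RCLike.inner_apply, conj_trivial]
  ring

theorem norm_perp_sq {d : QueueVec J M} (hd : ‖d‖ = 1) (q : QueueVec J M) :
    ‖perp d q‖ ^ 2 = ‖q‖ ^ 2 - inner ℝ d q ^ 2 := by
  rw [perp, norm_sub_sq_real, inner_smul_right, norm_smul, hd, mul_one, real_inner_comm,
    Real.norm_eq_abs, sq_abs]
  ring

theorem norm_perp_le {d : QueueVec J M} (hd : ‖d‖ = 1) (q : QueueVec J M) :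
    ‖perp d q‖ ≤ ‖q‖ := by
  refine le_of_sq_le_sq ?_ (norm_nonneg _)
  rw [norm_perp_sq hd]
  linarith [sq_nonneg (inner ℝ d q)]

theorem abs_norm_perp_sub_le {d : QueueVec J M} (hd : ‖d‖ = 1) (q q' : QueueVec J M) :
    |‖perp d q'‖ - ‖perp d q‖| ≤ ‖q' - q‖ := by
  refine (abs_norm_sub_norm_le _ _).trans ?_
  have : perp d q' - perp d q = perp d (q' - q) := by
    simp only [perp, inner_sub_right, sub_smul]
    abel
  rw [this]
  exact norm_perp_le hd _

theorem serverQueue_perp_spread (hM : 0 < M) (c : JobVec J) (q : QueueVec J M) (m : Fin M) :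
    serverQueue (perp (spread M c) q) m =
      serverQueue q m - ((∑ m', inner ℝ c (serverQueue q m')) / M) • c := by
  have hM' : (0 : ℝ) < M := by exact_mod_cast hM
  ext j
  simp only [perp, serverQueue_apply, PiLp.sub_apply, PiLp.smul_apply, smul_eq_mul, inner_spread]
  simp only [spread]
  have h := Real.mul_self_sqrt hM'.le
  have h0 : √(M : ℝ) ≠ 0 := by positivity
  congr 1
  rw [div_mul_div_comm, h]
  ring

/-- The component of the queue lengths perpendicular to `spread M c` is small when at each server
the queues are nearly proportional to `c`, and the queues of each type are balanced over the
servers. -/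
theorem norm_perp_spread_le (hM : 0 < M) {c : JobVec J} (hc : ‖c‖ = 1) (q : QueueVec J M)
    {d : Fin J → ℝ} (hd : ∀ j m m', |q (j, m) - q (j, m')| ≤ d j) :
    ‖perp (spread M c) q‖ ≤
      ∑ m, ‖serverQueue q m - inner ℝ c (serverQueue q m) • c‖ + M * ∑ j, d j := by
  have hM' : (0 : ℝ) < M := by exact_mod_cast hM
  have hcj : ∀ j, |c j| ≤ 1 := fun j => by
    have := PiLp.norm_apply_le c j
    rwa [hc] at this
  set X := ∑ m, inner ℝ c (serverQueue q m) with hX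
  have hdiff : ∀ m m', inner ℝ c (serverQueue q m) - inner ℝ c (serverQueue q m') ≤ ∑ j, d j ∧
      -∑ j, d j ≤ inner ℝ c (serverQueue q m) - inner ℝ c (serverQueue q m') := by
    intro m m'
    rw [← inner_sub_right, JobVec.inner_eq_sum, and_comm, ← abs_le]
    refine (Finset.abs_sum_le_sum_abs _ _).trans (Finset.sum_le_sum fun j _ => ?_)
    rw [abs_mul]
    calc |c j| * |(serverQueue q m - serverQueue q m') j| ≤ 1 * d j := by
          refine mul_le_mul (hcj j) (hd j m m') (abs_nonneg _) zero_le_one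
      _ = d j := one_mul _
  have havg : ∀ m, |inner ℝ c (serverQueue q m) - X / M| ≤ ∑ j, d j := by
    intro m
    have h1 : inner ℝ c (serverQueue q m) - X / M =
        (∑ m', (inner ℝ c (serverQueue q m) - inner ℝ c (serverQueue q m'))) / M := by
      rw [Finset.sum_sub_distrib, Finset.sum_const, Finset.card_univ, Fintype.card_fin,
        nsmul_eq_mul, ← hX]
      field_simp
    have h2 := Finset.sum_le_sum fun m' (_ : m' ∈ Finset.univ) => (hdiff m m').1
    have h3 := Finset.sum_le_sum fun m' (_ : m' ∈ Finset.univ) => (hdiff m m').2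
    simp only [Finset.sum_const, Finset.card_univ, Fintype.card_fin, nsmul_eq_mul] at h2 h3
    rw [h1, abs_le]
    constructor
    · rw [le_div_iff₀ hM']
      linarith
    · rw [div_le_iff₀ hM']
      linarith
  calc ‖perp (spread M c) q‖ ≤ ∑ m, ‖serverQueue (perp (spread M c) q) m‖ :=
        norm_le_sum_serverQueue _
    _ ≤ ∑ m, (‖serverQueue q m - inner ℝ c (serverQueue q m) • c‖ + ∑ j, d j) := by
        refine Finset.sum_le_sum fun m _ => ?_
        rw [serverQueue_perp_spread hM]
        calc ‖serverQueue q m - (X / M) • c‖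
            = ‖(serverQueue q m - inner ℝ c (serverQueue q m) • c) +
                (inner ℝ c (serverQueue q m) - X / M) • c‖ := by
              rw [sub_smul]
              congr 1
              abel
          _ ≤ _ := by
              refine (norm_add_le _ _).trans ?_
              rw [norm_smul, hc, mul_one, Real.norm_eq_abs]
              gcongr
              exact havg m
    _ = _ := by
        rw [Finset.sum_add_distrib]
        simp

theorem norm_le_sum_perp_add_inner {c : JobVec J} (hc : ‖c‖ = 1) (q : QueueVec J M) :
    ‖q‖ ≤ ∑ m, (‖serverQueue q m - inner ℝ c (serverQueue q m) • c‖ +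
      |inner ℝ c (serverQueue q m)|) := by
  refine (norm_le_sum_serverQueue q).trans (Finset.sum_le_sum fun m _ => ?_)
  calc ‖serverQueue q m‖ = ‖(serverQueue q m - inner ℝ c (serverQueue q m) • c) +
        inner ℝ c (serverQueue q m) • c‖ := by rw [sub_add_cancel]
    _ ≤ _ := by
        refine (norm_add_le _ _).trans ?_
        rw [norm_smul, hc, mul_one, Real.norm_eq_abs]

end Queues

/-! ### The workload in the direction of a normal vector -/

section Collapse

variable {I J M : ℕ} {S : CloudSystem I J M}

/-- The total work present, with type `j` weighted by `c j`. -/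
noncomputable def weightedWork {D : ℕ} (c : JobVec J) (y : QueueState J M D) : ℝ :=
  ∑ m, ∑ j, c j * (work (y j m) : ℝ)

theorem inner_serverQueue_queueVec {D : ℕ} (c : JobVec J) (y : QueueState J M D) (m : Fin M) :
    inner ℝ c (serverQueue (queueVec y) m) = ∑ j, c j * (work (y j m) : ℝ) :=
  JobVec.inner_eq_sum _ _

theorem inner_spread_queueVec {D : ℕ} (c : JobVec J) (y : QueueState J M D) :
    inner ℝ (spread M c) (queueVec y) = weightedWork c y / √(M : ℝ) := by
  rw [inner_spread]
  simp only [inner_serverQueue_queueVec, weightedWork]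

theorem weightedWork_nonneg {D : ℕ} {c : JobVec J} (hc : ∀ j, 0 ≤ c j) (y : QueueState J M D) :
    0 ≤ weightedWork c y :=
  Finset.sum_nonneg fun _ _ => Finset.sum_nonneg fun j _ => mul_nonneg (hc j) (Nat.cast_nonneg _)

namespace Policy

variable (P : Policy S)

/-- The service in the direction `c` that is missing to the value `b`. -/
noncomputable def unused (c : JobVec J) (b : ℝ) (y : QueueState J M S.Dmax)
    (ω : Arrivals J S.Dmax × P.Seed) : ℝ :=
  b - ∑ m, ∑ j, c j * (P.served y ω j m : ℝ)

/-- The recursion of a single-server queue, valid for every policy. Neither the routing nor the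
configurations enter the net input; they are hidden in the unused service. -/
theorem weightedWork_next (c : JobVec J) (b : ℝ) (y : QueueState J M S.Dmax)
    (ω : Arrivals J S.Dmax × P.Seed) :
    weightedWork c (P.next y ω) =
      weightedWork c y + (∑ j, c j * (work (ω.1 j) : ℝ) - b) + P.unused c b y ω := by
  have h : ∑ m, ∑ j, c j * P.routed y ω j m = ∑ j, c j * (work (ω.1 j) : ℝ) := by
    rw [Finset.sum_comm]
    simp only [← Finset.mul_sum, P.sum_routed]
  simp only [weightedWork, unused, P.work_next, mul_add, mul_sub, Finset.sum_add_distrib,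
    Finset.sum_sub_distrib, h]
  ring

variable (H : HyperplaneDescription S.capacity) (k : Fin H.K)

theorem sum_sched_le (y : QueueState J M S.Dmax) (ω : Arrivals J S.Dmax × P.Seed) :
    ∑ m, ∑ j, H.c k j * (P.sched y ω m j : ℝ) ≤ H.b k := by
  have h := (H.mem_iff.1 (S.sum_configVec_mem_capacity (P.sched_feasible y ω))).2 k
  rw [JobVec.inner_eq_sum] at h
  simp only [Finset.mul_sum] at h
  rwa [Finset.sum_comm] at h

/-- The served jobs form, summed over the servers, a vector dominated by one of the capacity
region, so the service in the direction `c k` never exceeds `b k`. -/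
theorem unused_nonneg (y : QueueState J M S.Dmax) (ω : Arrivals J S.Dmax × P.Seed) :
    0 ≤ P.unused (H.c k) (H.b k) y ω := by
  have h1 : ∑ m, ∑ j, H.c k j * (P.served y ω j m : ℝ) ≤
      ∑ m, ∑ j, H.c k j * (P.sched y ω m j : ℝ) :=
    Finset.sum_le_sum fun m _ => Finset.sum_le_sum fun j _ =>
      mul_le_mul_of_nonneg_left (Nat.cast_le.2 (P.serve_card_le y ω j m)) (H.c_nonneg k j)
  unfold unused
  linarith [P.sum_sched_le H k y ω]

theorem unused_le (y : QueueState J M S.Dmax) (ω : Arrivals J S.Dmax × P.Seed) :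
    P.unused (H.c k) (H.b k) y ω ≤ H.b k := by
  have : 0 ≤ ∑ m, ∑ j, H.c k j * (P.served y ω j m : ℝ) :=
    Finset.sum_nonneg fun _ _ => Finset.sum_nonneg fun j _ =>
      mul_nonneg (H.c_nonneg k j) (Nat.cast_nonneg _)
  unfold unused
  linarith

theorem measurable_unused (c : JobVec J) (b : ℝ) (y : QueueState J M S.Dmax) :
    Measurable (P.unused c b y) := by
  unfold unused
  exact measurable_const.sub (Finset.measurable_sum _ fun m _ => Finset.measurable_sum _ fun j _ =>
    (P.measurable_served y j m).const_mul _)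

variable (α : ArrivalLaw J S.Dmax)

theorem integrable_input (c : JobVec J) (b : ℝ) :
    Integrable (fun ω : Arrivals J S.Dmax × P.Seed => ∑ j, c j * (work (ω.1 j) : ℝ) - b)
      (P.slotLaw α) :=
  (integrable_finsetSum _ fun j _ =>
    ((P.memLp_work_arrivals α j).integrable (by norm_num)).const_mul _).sub (integrable_const _)

theorem integral_input (hα : α.rate ∈ interior S.capacity) :
    ∫ ω, (∑ j, H.c k j * (work (ω.1 j) : ℝ) - H.b k) ∂(P.slotLaw α) = -H.dist k α.rate := by
  have hi : ∀ j, Integrable (fun ω : Arrivals J S.Dmax × P.Seed =>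
      H.c k j * (work (ω.1 j) : ℝ)) (P.slotLaw α) := fun j =>
    ((P.memLp_work_arrivals α j).integrable (by norm_num)).const_mul _
  rw [integral_sub (integrable_finsetSum _ fun j _ => hi j) (integrable_const _),
    integral_finsetSum _ fun j _ => hi j, H.dist_eq_of_mem_interior hα, JobVec.inner_eq_sum]
  simp only [integral_const_mul, P.integral_work_arrivals, integral_const, probReal_univ, one_smul]
  ring

/-! ### State-space collapse -/

variable {P α}

/-- The drift of `V` compared with a point of the relative interior of a face: there is a negative
term for the component of the queues of each server perpendicular to the normal vector, a term for
the imbalance of the servers, and a term proportional to the distance from the face. -/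
theorem integral_drift_le_of_strictlyDominant (hM : 2 ≤ M) (hid : S.Identical)
    (hroute : P.IsPowerOfTwoRouting) (hsched : P.IsMaxWeightScheduling) {δ : ℝ}
    (hδ : ∀ v : JobVec J, inner ℝ (H.c k) v = 0 → ‖v‖ ≤ 1 → H.proj k α.rate + δ • v ∈ S.capacity)
    (y : QueueState J M S.Dmax) (u v : Fin J → Fin M) :
    ∫ ω, (lyapunovV (queueVec (P.next y ω)) - lyapunovV (queueVec y)) ∂(P.slotLaw α) ≤
      driftConst S α - 2 / M * (H.dist k α.rate * weightedWork (H.c k) y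
          + δ * ∑ m, ‖serverQueue (queueVec y) m -
            inner ℝ (H.c k) (serverQueue (queueVec y) m) • H.c k‖)
        - 2 / (M : ℝ) ^ 2 * ∑ j, α.rate j * |(work (y j (u j)) : ℝ) - work (y j (v j))| := by
  let w : Fin M → JobVec J := fun m => serverQueue (queueVec y) m -
    inner ℝ (H.c k) (serverQueue (queueVec y) m) • H.c k
  have hcw : ∀ m, inner ℝ (H.c k) (w m) = 0 := fun m => by
    simp only [w, inner_sub_right, inner_smul_right, H.inner_c_self]
    ring
  have hww : ∀ m, inner ℝ (w m) (serverQueue (queueVec y) m) = ‖w m‖ ^ 2 := by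
    intro m
    have h1 : serverQueue (queueVec y) m =
        w m + inner ℝ (H.c k) (serverQueue (queueVec y) m) • H.c k := by simp [w]
    rw [h1, inner_add_right, inner_smul_right, real_inner_self_eq_norm_sq,
      real_inner_comm (H.c k) (w m), hcw]
    ring
  have hx : ∀ m, H.proj k α.rate + δ • (‖w m‖⁻¹ • w m) ∈ S.capacity := by
    intro m
    refine hδ _ ?_ ?_
    · rw [inner_smul_right, hcw, mul_zero]
    · rw [norm_smul, norm_inv, norm_norm]
      exact inv_mul_le_one
  have h := integral_drift_le_of_capacity α hM hid hroute hsched y hx u v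
  have h1 : ∀ m, ∑ j, ((H.proj k α.rate + δ • (‖w m‖⁻¹ • w m)) j - α.rate j) *
      (work (y j m) : ℝ) =
      H.dist k α.rate * ∑ j, H.c k j * (work (y j m) : ℝ) + δ * ‖w m‖ := by
    intro m
    have h2 : ∑ j, ((H.proj k α.rate + δ • (‖w m‖⁻¹ • w m)) j - α.rate j) *
        (work (y j m) : ℝ) = inner ℝ (H.dist k α.rate • H.c k + δ • (‖w m‖⁻¹ • w m))
          (serverQueue (queueVec y) m) := by
      rw [inner_serverQueue_queueVec]
      refine Finset.sum_congr rfl fun j _ => ?_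
      simp only [HyperplaneDescription.proj, PiLp.add_apply, PiLp.smul_apply, smul_eq_mul]
      ring
    rw [h2, inner_add_left, real_inner_smul_left, real_inner_smul_left, real_inner_smul_left, hww,
      inner_serverQueue_queueVec]
    rcases eq_or_ne ‖w m‖ 0 with h0 | h0
    · simp [h0]
    · field_simp
  rw [Finset.sum_congr rfl fun m _ => h1 m, Finset.sum_add_distrib, ← Finset.mul_sum,
    ← Finset.mul_sum] at h
  exact h

/-- The square of the component of the queues along `spread M (c k)` grows on average at least as if
the service in the direction `c k` were always `b k`. -/
theorem integral_norm_perp_sq_le (hM : 0 < M) (hα : α.rate ∈ interior S.capacity)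
    (y : QueueState J M S.Dmax) :
    ∫ ω, (‖perp (spread M (H.c k)) (queueVec (P.next y ω))‖ ^ 2 -
        ‖perp (spread M (H.c k)) (queueVec y)‖ ^ 2) ∂(P.slotLaw α) ≤
      ∫ ω, (lyapunovV (queueVec (P.next y ω)) - lyapunovV (queueVec y)) ∂(P.slotLaw α)
        + 2 / M * (H.dist k α.rate * weightedWork (H.c k) y) := by
  have hM' : (0 : ℝ) < M := by exact_mod_cast hM
  have hX := weightedWork_nonneg (H.c_nonneg k) y
  set X := weightedWork (H.c k) y with hXdef
  have hd := norm_spread hM (H.norm_c k)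
  have hi1 := P.integrable_drift α y
  have hi2 : Integrable (fun ω => 2 / M * (X *
      (∑ j, H.c k j * (work (ω.1 j) : ℝ) - H.b k))) (P.slotLaw α) :=
    ((P.integrable_input α (H.c k) (H.b k)).const_mul X).const_mul _
  have hmono : ∀ ω, ‖perp (spread M (H.c k)) (queueVec (P.next y ω))‖ ^ 2 -
      ‖perp (spread M (H.c k)) (queueVec y)‖ ^ 2 ≤
      (lyapunovV (queueVec (P.next y ω)) - lyapunovV (queueVec y)) -
        2 / M * (X * (∑ j, H.c k j * (work (ω.1 j) : ℝ) - H.b k)) := by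
    intro ω
    rw [norm_perp_sq hd, norm_perp_sq hd, ← lyapunovV_eq_norm_sq, ← lyapunovV_eq_norm_sq,
      inner_spread_queueVec, inner_spread_queueVec, div_pow, div_pow, Real.sq_sqrt hM'.le,
      P.weightedWork_next (H.c k) (H.b k), ← hXdef]
    have h1 := P.unused_nonneg H k y ω
    set U := P.unused (H.c k) (H.b k) y ω
    set A := ∑ j, H.c k j * (work (ω.1 j) : ℝ) - H.b k
    have h2 : X ^ 2 / M + 2 / M * (X * A) ≤ (X + A + U) ^ 2 / M := by
      rw [show X ^ 2 / M + 2 / M * (X * A) = (X ^ 2 + 2 * (X * A)) / (M : ℝ) by ring]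
      gcongr
      nlinarith [sq_nonneg (A + U), mul_nonneg hX h1]
    linarith
  have hi3 : Integrable (fun ω => ‖perp (spread M (H.c k)) (queueVec (P.next y ω))‖ ^ 2)
      (P.slotLaw α) := by
    refine (P.integrable_lyapunovV_next α y).mono' ((Measurable.of_discrete (f := fun z =>
      ‖perp (spread M (H.c k)) (queueVec z)‖ ^ 2)).comp
        (P.measurable_next y)).aestronglyMeasurable (ae_of_all _ fun ω => ?_)
    rw [Real.norm_of_nonneg (sq_nonneg _), lyapunovV_eq_norm_sq]
    gcongr
    exact norm_perp_le hd _
  have h1 := integral_mono (hi3.sub (integrable_const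
    (‖perp (spread M (H.c k)) (queueVec y)‖ ^ 2))) (hi1.sub hi2) hmono
  simp only [Pi.sub_apply] at h1
  rw [integral_sub hi1 hi2, integral_const_mul, integral_const_mul,
    P.integral_input H k α hα] at h1
  linarith

/-- The arrival laws with workloads at most `amax` whose rates are inside the capacity region and
have `lamk` as closest point on the `k`-th hyperplane, in the relative interior of the face. -/
structure _root_.ArrivalLaw.IsNormalApproach (α : ArrivalLaw J S.Dmax)
    (H : HyperplaneDescription S.capacity) (k : Fin H.K) (lamk : JobVec J) (amax : ℕ) : Prop where
  mem_interior : α.rate ∈ interior S.capacity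
  mem_strictlyDominant : k ∈ H.strictlyDominant α.rate
  proj_eq : H.proj k α.rate = lamk
  bounded : ∀ j, ∀ᵐ A ∂α.law, work (A j) ≤ amax

variable {amax : ℕ}

theorem ae_forall_work_le (hα : ∀ j, ∀ᵐ A ∂α.law, work (A j) ≤ amax) :
    ∀ᵐ ω ∂(P.slotLaw α), ∀ j, work (ω.1 j) ≤ amax :=
  (P.measurePreserving_arrivals α).quasiMeasurePreserving.ae (ae_all_iff.2 hα)

/-- Jumps are bounded. The summand `1` makes the bound positive in all cases. -/
theorem ae_norm_queueVec_next_sub_le (hα : ∀ j, ∀ᵐ A ∂α.law, work (A j) ≤ amax)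
    (y : QueueState J M S.Dmax) :
    ∀ᵐ ω ∂(P.slotLaw α), ‖queueVec (P.next y ω) - queueVec y‖ ≤
      J * M * ((amax : ℝ) + S.smax) + 1 := by
  filter_upwards [ae_forall_work_le (P := P) hα] with ω hω
  refine (EuclideanSpace.norm_le_sum_abs _).trans ?_
  calc ∑ p, |(queueVec (P.next y ω) - queueVec y) p|
      ≤ ∑ p : Fin J × Fin M, ((amax : ℝ) + S.smax) := by
        refine Finset.sum_le_sum fun p _ => ?_
        have h1 : (queueVec (P.next y ω) - queueVec y) p =
            P.routed y ω p.1 p.2 - P.served y ω p.1 p.2 := by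
          have := P.work_next y ω p.1 p.2
          simp only [queueVec, PiLp.sub_apply]
          linarith
        have h2 := P.routed_nonneg y ω p.1 p.2
        have h3 : P.routed y ω p.1 p.2 ≤ amax :=
          (P.routed_le y ω p.1 p.2).trans (Nat.cast_le.2 (hω p.1))
        have h4 : (0 : ℝ) ≤ P.served y ω p.1 p.2 := Nat.cast_nonneg _
        have h5 : (P.served y ω p.1 p.2 : ℝ) ≤ S.smax :=
          Nat.cast_le.2 (P.served_le_smax y ω p.1 p.2)
        rw [h1, abs_le]
        constructor <;> linarith
    _ ≤ _ := by
        simp only [Finset.sum_const, Finset.card_univ, Fintype.card_prod, Fintype.card_fin,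
          nsmul_eq_mul]
        push_cast
        linarith

theorem _root_.driftConst_le (hα : ∀ j, ∀ᵐ A ∂α.law, work (A j) ≤ amax) :
    driftConst S α ≤ M * (J * (amax : ℝ) ^ 2 +
      2 * (J : ℝ) * (S.smax : ℝ) ^ 2 * (1 + (S.Dmax : ℝ))) := by
  have h1 : ∀ j, α.rate j ^ 2 + α.var j ≤ (amax : ℝ) ^ 2 := by
    intro j
    rw [← α.integral_sq]
    calc ∫ A, (work (A j) : ℝ) ^ 2 ∂α.law ≤ ∫ A, (amax : ℝ) ^ 2 ∂α.law := by
          refine integral_mono_ae (α.memLp j).integrable_sq (integrable_const _) ?_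
          filter_upwards [hα j] with A hA
          have : (work (A j) : ℝ) ≤ amax := Nat.cast_le.2 hA
          gcongr
      _ = _ := by simp
  have h2 : ∑ j, (α.rate j ^ 2 + α.var j) ≤ J * (amax : ℝ) ^ 2 := by
    refine (Finset.sum_le_sum fun j _ => h1 j).trans ?_
    simp
  unfold driftConst
  gcongr

/-- Two servers with the largest imbalance. -/
theorem _root_.exists_max_abs_sub (hM : 0 < M) (q : Fin M → ℝ) :
    ∃ u v, ∀ m m', |q m - q m'| ≤ |q u - q v| := by
  have : Nonempty (Fin M) := ⟨⟨0, hM⟩⟩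
  obtain ⟨⟨u, v⟩, h⟩ := Finite.exists_max fun p : Fin M × Fin M => |q p.1 - q p.2|
  exact ⟨u, v, fun m m' => h (m, m')⟩

/-- Moments of the queue lengths, uniformly over rates that keep a distance `ε₀` from the face:
there the drift of `V` bounds the queue lengths in all directions. -/
theorem exists_moment_bound_norm (hM : 2 ≤ M) (hid : S.Identical)
    (hroute : P.IsPowerOfTwoRouting) (hsched : P.IsMaxWeightScheduling) (lamk : JobVec J)
    (amax : ℕ) {ε₀ : ℝ} (hε₀ : 0 < ε₀) :
    ∃ N : ℕ → ℝ, ∀ α : ArrivalLaw J S.Dmax, α.IsNormalApproach H k lamk amax →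
      ε₀ ≤ H.dist k α.rate → ∀ π, P.IsSteadyState α π → ∀ n : ℕ,
        ∫⁻ y, ENNReal.ofReal (‖queueVec y‖ ^ n) ∂π ≤ ENNReal.ofReal (N n) := by
  have hMpos : 0 < M := by omega
  have hM' : (0 : ℝ) < M := by exact_mod_cast hMpos
  by_cases hex : ∃ α : ArrivalLaw J S.Dmax, α.IsNormalApproach H k lamk amax
  swap
  · exact ⟨0, fun α hα => absurd ⟨α, hα⟩ hex⟩
  obtain ⟨α₀, hα₀⟩ := hex
  obtain ⟨δ, hδ, hball⟩ := H.exists_ball_subset_of_mem_strictlyDominant hα₀.mem_interior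
    hα₀.mem_strictlyDominant
  rw [hα₀.proj_eq] at hball
  obtain ⟨N, hN⟩ := exists_moment_bound_of_drift (fun y : QueueState J M S.Dmax => ‖queueVec y‖)
    P.next P.measurable_next (fun y => norm_nonneg _)
    (D := J * M * ((amax : ℝ) + S.smax) + 1)
    (K := M * (J * (amax : ℝ) ^ 2 + 2 * (J : ℝ) * (S.smax : ℝ) ^ 2 * (1 + (S.Dmax : ℝ))) + 1)
    (η := min ε₀ δ / M) (by positivity) (by positivity) (div_pos (lt_min hε₀ hδ) hM')
  refine ⟨N, fun α hα hε π hπ => hN π (P.slotLaw α) hπ.1 inferInstance hπ.lintegral_eq ?_ ?_⟩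
  · intro y
    filter_upwards [ae_norm_queueVec_next_sub_le (P := P) hα.bounded y] with ω hω
    exact (abs_norm_sub_norm_le _ _).trans hω
  · intro y
    have h0 : Nonempty (Fin J → Fin M) := ⟨fun _ => ⟨0, hMpos⟩⟩
    obtain ⟨u⟩ := h0
    have h1 := integral_drift_le_of_strictlyDominant H k (α := α) hM hid hroute hsched (δ := δ)
      (by rw [hα.proj_eq]; exact hball) y u u
    simp only [sub_self, abs_zero, mul_zero, Finset.sum_const_zero, sub_zero,
      lyapunovV_eq_norm_sq] at h1
    have h2 := norm_le_sum_perp_add_inner (H.norm_c k) (queueVec y)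
    have h3 : ∀ m, 0 ≤ inner ℝ (H.c k) (serverQueue (queueVec y) m) := fun m => by
      rw [inner_serverQueue_queueVec]
      exact Finset.sum_nonneg fun j _ => mul_nonneg (H.c_nonneg k j) (Nat.cast_nonneg _)
    simp only [abs_of_nonneg (h3 _), Finset.sum_add_distrib] at h2
    have h4 : ∑ m, inner ℝ (H.c k) (serverQueue (queueVec y) m) = weightedWork (H.c k) y := by
      simp only [inner_serverQueue_queueVec, weightedWork]
    rw [h4] at h2
    set w := ∑ m, ‖serverQueue (queueVec y) m -
            inner ℝ (H.c k) (serverQueue (queueVec y) m) • H.c k‖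
    have hw : 0 ≤ w := Finset.sum_nonneg fun _ _ => norm_nonneg _
    have hX := weightedWork_nonneg (H.c_nonneg k) y
    set X := weightedWork (H.c k) y
    have h5 : min ε₀ δ * ‖queueVec y‖ ≤ H.dist k α.rate * X + δ * w := by
      calc min ε₀ δ * ‖queueVec y‖ ≤ min ε₀ δ * (w + X) := by
            have := lt_min hε₀ hδ
            gcongr
        _ = min ε₀ δ * X + min ε₀ δ * w := by ring
        _ ≤ _ := by
            gcongr
            · exact (min_le_left _ _).trans hε
            · exact min_le_right _ _
    have h6 : 2 / M * (min ε₀ δ * ‖queueVec y‖) ≤ 2 / M * (H.dist k α.rate * X + δ * w) := by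
      gcongr
    have h7 : 2 * (min ε₀ δ / M) * ‖queueVec y‖ = 2 / M * (min ε₀ δ * ‖queueVec y‖) := by ring
    have h8 := driftConst_le (M := M) hα.bounded
    linarith

/-- **State-space collapse.** Near the face all arrival rates are bounded below, so that routing
balances the servers, and the perpendicular component has negative drift. Away from the face some
rates may be small, but there the queue lengths themselves have bounded moments. -/
theorem exists_moment_bound_perp (hM : 2 ≤ M) (hid : S.Identical)
    (hroute : P.IsPowerOfTwoRouting) (hsched : P.IsMaxWeightScheduling) (lamk : JobVec J)
    (amax : ℕ) :
    ∃ N : ℕ → ℝ, ∀ α : ArrivalLaw J S.Dmax, α.IsNormalApproach H k lamk amax →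
      ∀ π, P.IsSteadyState α π → ∀ n : ℕ,
        ∫⁻ y, ENNReal.ofReal (‖perp (spread M (H.c k)) (queueVec y)‖ ^ n) ∂π ≤
          ENNReal.ofReal (N n) := by
  have hMpos : 0 < M := by omega
  have hM' : (0 : ℝ) < M := by exact_mod_cast hMpos
  by_cases hex : ∃ α : ArrivalLaw J S.Dmax, α.IsNormalApproach H k lamk amax
  swap
  · exact ⟨0, fun α hα => absurd ⟨α, hα⟩ hex⟩
  obtain ⟨α₀, hα₀⟩ := hex
  obtain ⟨δ, hδ, hball⟩ := H.exists_ball_subset_of_mem_strictlyDominant hα₀.mem_interior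
    hα₀.mem_strictlyDominant
  rw [hα₀.proj_eq] at hball
  have hd := norm_spread hMpos (H.norm_c k)
  -- half of a lower bound for the coordinates of `lamk`
  obtain ⟨ℓ, hℓ, hℓj⟩ : ∃ ℓ > 0, ∀ j, 2 * ℓ ≤ lamk j := by
    have hpos : ∀ j, 0 < lamk j := fun j => hα₀.proj_eq ▸ H.proj_pos hα₀.mem_interior k j
    rcases isEmpty_or_nonempty (Fin J) with hJ | hJ
    · exact ⟨1, one_pos, fun j => hJ.elim j⟩
    · obtain ⟨j₀, hj₀⟩ := Finite.exists_min fun j => lamk j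
      exact ⟨lamk j₀ / 2, half_pos (hpos j₀), fun j => by linarith [hj₀ j]⟩
  obtain ⟨N₁, hN₁⟩ := exists_moment_bound_norm H k hM hid hroute hsched lamk amax hℓ
  have hη : 0 < min (δ / M) (ℓ / (M : ℝ) ^ 3) := lt_min (by positivity) (by positivity)
  obtain ⟨N₂, hN₂⟩ := exists_moment_bound_of_drift
    (fun y : QueueState J M S.Dmax => ‖perp (spread M (H.c k)) (queueVec y)‖)
    P.next P.measurable_next (fun y => norm_nonneg _)
    (D := J * M * ((amax : ℝ) + S.smax) + 1)
    (K := M * (J * (amax : ℝ) ^ 2 + 2 * (J : ℝ) * (S.smax : ℝ) ^ 2 * (1 + (S.Dmax : ℝ))) + 1)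
    (η := min (δ / M) (ℓ / (M : ℝ) ^ 3)) (by positivity) (by positivity) hη
  refine ⟨fun n => max (N₁ n) (N₂ n), fun α hα π hπ n => ?_⟩
  rcases le_or_gt ℓ (H.dist k α.rate) with hε | hε
  · calc ∫⁻ y, ENNReal.ofReal (‖perp (spread M (H.c k)) (queueVec y)‖ ^ n) ∂π
        ≤ ∫⁻ y, ENNReal.ofReal (‖queueVec y‖ ^ n) ∂π := by
          refine lintegral_mono fun y => ENNReal.ofReal_le_ofReal ?_
          gcongr
          exact norm_perp_le hd _
      _ ≤ ENNReal.ofReal (N₁ n) := hN₁ α hα hε π hπ n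
      _ ≤ _ := ENNReal.ofReal_le_ofReal (le_max_left _ _)
  refine (hN₂ π (P.slotLaw α) hπ.1 inferInstance hπ.lintegral_eq ?_ ?_ n).trans
    (ENNReal.ofReal_le_ofReal (le_max_right _ _))
  · intro y
    filter_upwards [ae_norm_queueVec_next_sub_le (P := P) hα.bounded y] with ω hω
    exact (abs_norm_perp_sub_le hd _ _).trans hω
  · intro y
    choose u v huv using fun j => exists_max_abs_sub hMpos fun m => (work (y j m) : ℝ)
    have h1 := integral_drift_le_of_strictlyDominant H k (α := α) hM hid hroute hsched (δ := δ)
      (by rw [hα.proj_eq]; exact hball) y u v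
    have h2 := integral_norm_perp_sq_le (P := P) H k hMpos hα.mem_interior y
    have h3 := norm_perp_spread_le hMpos (H.norm_c k) (queueVec y) (fun j m m' => huv j m m')
    have hrate : ∀ j, ℓ ≤ α.rate j := by
      intro j
      have h4 := hℓj j
      rw [← hα.proj_eq] at h4
      simp only [HyperplaneDescription.proj, PiLp.add_apply, PiLp.smul_apply, smul_eq_mul] at h4
      have h5 : H.dist k α.rate * H.c k j ≤ ℓ * 1 :=
        mul_le_mul hε.le (H.c_le_one k j) (H.c_nonneg k j) hℓ.le
      linarith
    have h4 : ℓ * ∑ j, |(work (y j (u j)) : ℝ) - work (y j (v j))| ≤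
        ∑ j, α.rate j * |(work (y j (u j)) : ℝ) - work (y j (v j))| := by
      rw [Finset.mul_sum]
      exact Finset.sum_le_sum fun j _ => mul_le_mul_of_nonneg_right (hrate j) (abs_nonneg _)
    set w := ∑ m, ‖serverQueue (queueVec y) m -
            inner ℝ (H.c k) (serverQueue (queueVec y) m) • H.c k‖
    have hw : 0 ≤ w := Finset.sum_nonneg fun _ _ => norm_nonneg _
    set s := ∑ j, |(work (y j (u j)) : ℝ) - work (y j (v j))|
    have hs : 0 ≤ s := Finset.sum_nonneg fun _ _ => abs_nonneg _
    set t := ∑ j, α.rate j * |(work (y j (u j)) : ℝ) - work (y j (v j))|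
    have h5 : 2 * min (δ / M) (ℓ / (M : ℝ) ^ 3) * ‖perp (spread M (H.c k)) (queueVec y)‖ ≤
        2 / M * (δ * w) + 2 / (M : ℝ) ^ 2 * t := by
      calc 2 * min (δ / M) (ℓ / (M : ℝ) ^ 3) * ‖perp (spread M (H.c k)) (queueVec y)‖
          ≤ 2 * min (δ / M) (ℓ / (M : ℝ) ^ 3) * (w + M * s) := by gcongr
        _ = 2 * min (δ / M) (ℓ / (M : ℝ) ^ 3) * w +
              2 * min (δ / M) (ℓ / (M : ℝ) ^ 3) * (M * s) := by ring
        _ ≤ 2 * (δ / M) * w + 2 * (ℓ / (M : ℝ) ^ 3) * (M * s) := by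
            gcongr
            · exact min_le_left _ _
            · exact min_le_right _ _
        _ = 2 / M * (δ * w) + 2 / (M : ℝ) ^ 2 * (ℓ * s) := by
            field_simp
        _ ≤ _ := by gcongr
    have h8 := driftConst_le (M := M) hα.bounded
    rw [mul_add] at h1
    linarith

end Policy

end Collapse

/-! ### The weighted workload as a single-server queue -/

section Bounds

variable {I J M : ℕ} {S : CloudSystem I J M}

theorem meanWeighted_eq {D : ℕ} {π : Measure (QueueState J M D)} {c : JobVec J}
    (hc : ∀ j, 0 ≤ c j) (hi : Integrable (weightedWork c) π) :
    meanWeighted π (spread M c) = ENNReal.ofReal ((∫ y, weightedWork c y ∂π) / √(M : ℝ)) := by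
  unfold meanWeighted
  simp only [inner_spread_queueVec]
  rw [← ofReal_integral_eq_lintegral_ofReal (hi.div_const _)
    (ae_of_all _ fun y => div_nonneg (weightedWork_nonneg hc y) (Real.sqrt_nonneg _)),
    integral_div]

theorem integrable_weightedWork_of_meanWeighted_ne_top {D : ℕ} {π : Measure (QueueState J M D)}
    {c : JobVec J} (hc : ∀ j, 0 ≤ c j) (hM : 0 < M)
    (h : meanWeighted π (spread M c) ≠ ∞) : Integrable (weightedWork c) π := by
  have hM' : (0 : ℝ) < M := by exact_mod_cast hM
  unfold meanWeighted at h
  simp only [inner_spread_queueVec] at h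
  have h1 := (lintegral_ofReal_ne_top_iff_integrable
    (Measurable.of_discrete (f := fun y => weightedWork c y / √(M : ℝ))).aestronglyMeasurable
    (ae_of_all _ fun y => div_nonneg (weightedWork_nonneg hc y) (Real.sqrt_nonneg _))).1 h
  have h2 := h1.mul_const √(M : ℝ)
  have h3 : √(M : ℝ) ≠ 0 := by positivity
  simpa [div_mul_cancel₀ _ h3] using h2

namespace Policy

variable (P : Policy S) (H : HyperplaneDescription S.capacity) (k : Fin H.K)
  (α : ArrivalLaw J S.Dmax)

theorem memLp_input (c : JobVec J) (b : ℝ) :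
    MemLp (fun ω : Arrivals J S.Dmax × P.Seed => ∑ j, c j * (work (ω.1 j) : ℝ) - b) 2
      (P.slotLaw α) :=
  MemLp.sub (g := fun _ => b)
    (memLp_finsetSum _ fun j _ => (P.memLp_work_arrivals α j).const_mul (c j)) (memLp_const _)

theorem measurable_input (c : JobVec J) (b : ℝ) :
    Measurable fun ω : Arrivals J S.Dmax × P.Seed => ∑ j, c j * (work (ω.1 j) : ℝ) - b :=
  (Finset.measurable_sum _ fun j _ => (P.measurable_work_arrivals j).const_mul (c j)).sub_const b

/-- The second moment of the net input, for uncorrelated workloads. -/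
theorem integral_input_sq (hα : α.rate ∈ interior S.capacity) (hunc : α.Uncorrelated) :
    ∫ ω, (∑ j, H.c k j * (work (ω.1 j) : ℝ) - H.b k) ^ 2 ∂(P.slotLaw α) =
      ∑ j, H.c k j ^ 2 * α.var j + H.dist k α.rate ^ 2 := by
  have h1 := variance_eq_sub (P.memLp_input α (H.c k) (H.b k))
  rw [P.integral_input H k α hα] at h1
  have h2 : Var[fun ω : Arrivals J S.Dmax × P.Seed =>
      ∑ j, H.c k j * (work (ω.1 j) : ℝ) - H.b k; P.slotLaw α] = ∑ j, H.c k j ^ 2 * α.var j := by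
    have hL : ∀ j, MemLp (fun A : Arrivals J S.Dmax => H.c k j * (work (A j) : ℝ)) 2 α.law :=
      fun j => (α.memLp j).const_mul _
    have h3 : Var[fun ω : Arrivals J S.Dmax × P.Seed =>
        ∑ j, H.c k j * (work (ω.1 j) : ℝ); P.slotLaw α] =
        Var[fun A : Arrivals J S.Dmax => ∑ j, H.c k j * (work (A j) : ℝ); α.law] := by
      rw [← (P.measurePreserving_arrivals α).map_eq,
        variance_map Measurable.of_discrete.aemeasurable measurable_fst.aemeasurable]
      rfl
    rw [variance_sub_const (by
      have := (P.measurable_input (H.c k) 0).aestronglyMeasurable (μ := P.slotLaw α)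
      simpa using this), h3, variance_fun_sum hL]
    refine Finset.sum_congr rfl fun i _ => ?_
    rw [Finset.sum_eq_single i]
    · rw [covariance_const_mul_left, covariance_const_mul_right,
        covariance_self Measurable.of_discrete.aemeasurable]
      simp only [ArrivalLaw.var]
      ring
    · intro j _ hj
      rw [covariance_const_mul_left, covariance_const_mul_right, hunc i j hj.symm]
      simp
    · simp
  rw [h2] at h1
  simp only [Pi.pow_apply] at h1
  linarith

variable {P α} {π : Measure (QueueState J M S.Dmax)}

/-- In a steady state, with the state and the next slot on a common probability space, the weighted
workload is a stationary queue with net input `∑ j, c j * a j - b`. -/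
theorem IsSteadyState.identDistrib_weightedWork (h : P.IsSteadyState α π) (c : JobVec J) (b : ℝ) :
    IdentDistrib
      (fun p : QueueState J M S.Dmax × (Arrivals J S.Dmax × P.Seed) => weightedWork c p.1)
      (fun p => weightedWork c p.1 + (∑ j, c j * (work (p.2.1 j) : ℝ) - b)
        + P.unused c b p.1 p.2) (π.prod (P.slotLaw α)) (π.prod (P.slotLaw α)) := by
  have h1 := h.identDistrib (weightedWork c)
  simp only [P.weightedWork_next c b] at h1
  exact h1

theorem IsSteadyState.indepFun_input (h : P.IsSteadyState α π) (c : JobVec J) (b : ℝ) :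
    IndepFun
      (fun p : QueueState J M S.Dmax × (Arrivals J S.Dmax × P.Seed) => weightedWork c p.1)
      (fun p => ∑ j, c j * (work (p.2.1 j) : ℝ) - b) (π.prod (P.slotLaw α)) := by
  have := h.1
  exact indepFun_prod (X := weightedWork c)
    (Y := fun ω : Arrivals J S.Dmax × P.Seed => ∑ j, c j * (work (ω.1 j) : ℝ) - b)
    Measurable.of_discrete (P.measurable_input c b)

theorem measurable_uncurry_unused (c : JobVec J) (b : ℝ) :
    Measurable fun p : QueueState J M S.Dmax × (Arrivals J S.Dmax × P.Seed) =>
      P.unused c b p.1 p.2 :=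
  measurable_from_prod_countable_right fun y => P.measurable_unused c b y

theorem memLp_uncurry_unused [IsProbabilityMeasure π] :
    MemLp (fun p : QueueState J M S.Dmax × (Arrivals J S.Dmax × P.Seed) =>
      P.unused (H.c k) (H.b k) p.1 p.2) 2 (π.prod (P.slotLaw α)) :=
  MemLp.of_bound (measurable_uncurry_unused _ _).aestronglyMeasurable (H.b k)
    (ae_of_all _ fun p => by
      rw [Real.norm_of_nonneg (P.unused_nonneg H k p.1 p.2)]
      exact P.unused_le H k p.1 p.2)

theorem integral_prod_fst [IsProbabilityMeasure π] (f : QueueState J M S.Dmax → ℝ) :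
    ∫ p, f p.1 ∂(π.prod (P.slotLaw α)) = ∫ y, f y ∂π := by
  rw [integral_fun_fst]
  simp

theorem integral_prod_snd [IsProbabilityMeasure π]
    (f : Arrivals J S.Dmax × P.Seed → ℝ) :
    ∫ p, f p.2 ∂(π.prod (P.slotLaw α)) = ∫ ω, f ω ∂(P.slotLaw α) := by
  rw [integral_fun_snd]
  simp

/-- **Lower bound** for the weighted workload in a steady state of any policy. -/
theorem IsSteadyState.le_meanWeighted (hM : 2 ≤ M) (hα : α.rate ∈ interior S.capacity)
    (hunc : α.Uncorrelated) (h : P.IsSteadyState α π) :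
    ENNReal.ofReal (zeta M (H.c k) α.var (H.dist k α.rate) / 2 - H.b k * H.dist k α.rate / 2) ≤
      ENNReal.ofReal (H.dist k α.rate) * meanWeighted π (spread M (H.c k)) := by
  have hπ := h.1
  have hε := H.dist_pos_of_mem_interior hα k
  have hMpos : 0 < M := by omega
  have hM' : (2 : ℝ) ≤ M := by exact_mod_cast hM
  rcases eq_or_ne (meanWeighted π (spread M (H.c k))) ∞ with htop | htop
  · rw [htop, ENNReal.mul_top (by simpa using hε)]
    exact le_top
  have hi := integrable_weightedWork_of_meanWeighted_ne_top (H.c_nonneg k) hMpos htop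
  rw [meanWeighted_eq (H.c_nonneg k) hi, ← ENNReal.ofReal_mul hε.le]
  refine ENNReal.ofReal_le_ofReal ?_
  have hUL := memLp_uncurry_unused (P := P) (π := π) (α := α) H k
  have hYL : MemLp (fun p : QueueState J M S.Dmax × (Arrivals J S.Dmax × P.Seed) =>
      ∑ j, H.c k j * (work (p.2.1 j) : ℝ) - H.b k) 2 (π.prod (P.slotLaw α)) :=
    (P.memLp_input α (H.c k) (H.b k)).comp_measurePreserving measurePreserving_snd
  have key := integral_sq_le_of_stationary_queue (μ := π.prod (P.slotLaw α))
    (X := fun p => weightedWork (H.c k) p.1)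
    (Y := fun p => ∑ j, H.c k j * (work (p.2.1 j) : ℝ) - H.b k)
    (U := fun p => P.unused (H.c k) (H.b k) p.1 p.2) (b := H.b k) (ε := H.dist k α.rate)
    ((Measurable.of_discrete (f := weightedWork (H.c k))).comp measurable_fst)
    ((P.measurable_input (H.c k) (H.b k)).comp measurable_snd)
    (fun p => weightedWork_nonneg (H.c_nonneg k) _)
    (fun p => by
      rw [← P.weightedWork_next (H.c k) (H.b k)]
      exact weightedWork_nonneg (H.c_nonneg k) _)
    (fun p => P.unused_nonneg H k _ _) (fun p => P.unused_le H k _ _)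
    (measurePreserving_fst.integrable_comp
      (Measurable.of_discrete (f := weightedWork (H.c k))).aestronglyMeasurable |>.2 hi)
    hYL (hUL.integrable (by norm_num)) (h.indepFun_input _ _)
    (h.identDistrib_weightedWork _ _)
    (by
      rw [integral_prod_snd (fun ω => ∑ j, H.c k j * (work (ω.1 j) : ℝ) - H.b k)]
      exact P.integral_input H k α hα) hε.le
  rw [integral_prod_snd (fun ω => (∑ j, H.c k j * (work (ω.1 j) : ℝ) - H.b k) ^ 2),
    P.integral_input_sq H k α hα hunc, integral_prod_fst (weightedWork (H.c k))] at key
  have hsqrt : 1 ≤ √(M : ℝ) := Real.one_le_sqrt.2 (by linarith)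
  have hbε : 0 ≤ H.b k * H.dist k α.rate := mul_nonneg (H.b_nonneg k) hε.le
  unfold zeta
  rw [← add_div, mul_div_assoc', div_div, div_sub_div _ _ (by positivity) (by positivity),
    div_le_div_iff₀ (by positivity) (by positivity)]
  set V := ∑ j, H.c k j ^ 2 * α.var j + H.dist k α.rate ^ 2
  set E := ∫ y, weightedWork (H.c k) y ∂π
  set s := √(M : ℝ)
  have h1 : V - s * (H.b k * H.dist k α.rate) ≤ 2 * (H.dist k α.rate * E) := by
    nlinarith
  nlinarith [mul_le_mul_of_nonneg_left h1 (by positivity : 0 ≤ 2 * s)]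

/-- **Unused service is rare when the workload is large.** If service in the direction `c` is
missing, then either some server does not use its allotment for a type with `c j > 0`, so this queue
is short, or the configuration of some server is not optimal in the direction `c`, while it is
optimal for the queues at this server. In both cases the perpendicular component of the queue
lengths is comparable to the workload. -/
theorem exists_weightedWork_mul_unused_le (hM : 0 < M) (hid : S.Identical)
    (hsched : P.IsMaxWeightScheduling) {lamk : JobVec J} (hmem : lamk ∈ S.capacity)
    (hplane : inner ℝ (H.c k) lamk = H.b k) :
    ∃ L ≥ 0, ∀ y ω, weightedWork (H.c k) y * P.unused (H.c k) (H.b k) y ω ≤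
      L * (1 + ‖perp (spread M (H.c k)) (queueVec y)‖) * P.unused (H.c k) (H.b k) y ω := by
  have hM' : (0 : ℝ) < M := by exact_mod_cast hM
  -- the gap of the configurations that are not optimal in the direction `c`
  obtain ⟨g, hg, hgap⟩ : ∃ g > 0, ∀ m, ∀ s ∈ S.feasible m,
      ∑ j, H.c k j * (s j : ℝ) < H.b k / M → ∑ j, H.c k j * (s j : ℝ) ≤ H.b k / M - g := by
    let T : Set (Fin J → ℕ) :=
      {s | (∃ m, s ∈ S.feasible m) ∧ ∑ j, H.c k j * (s j : ℝ) < H.b k / M}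
    have hT : T.Finite := by
      refine (Set.finite_iUnion fun m => S.finite_feasible m).subset fun s hs => ?_
      exact Set.mem_iUnion.2 hs.1
    rcases T.eq_empty_or_nonempty with h0 | h0
    · refine ⟨1, one_pos, fun m s hs hlt => ?_⟩
      have : s ∈ T := ⟨⟨m, hs⟩, hlt⟩
      rw [h0] at this
      exact this.elim
    · obtain ⟨s₀, hs₀, hmin⟩ := Set.exists_min_image T
        (fun s => H.b k / M - ∑ j, H.c k j * (s j : ℝ)) hT h0
      refine ⟨H.b k / M - ∑ j, H.c k j * (s₀ j : ℝ), by linarith [hs₀.2], fun m s hs hlt => ?_⟩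
      have := hmin s ⟨⟨m, hs⟩, hlt⟩
      linarith
  let L₁ : ℝ := ∑ j, (H.c k j)⁻¹
  have hL₁ : 0 ≤ L₁ := Finset.sum_nonneg fun j _ => inv_nonneg.2 (H.c_nonneg k j)
  let Q : ℝ := M * (J * S.smax) + ‖lamk‖
  have hQ : 0 ≤ Q := by positivity
  refine ⟨M * L₁ * (S.Dmax * S.smax + 1) + Q / g, by positivity, fun y ω => ?_⟩
  have hU := P.unused_nonneg H k y ω
  rcases eq_or_ne (P.unused (H.c k) (H.b k) y ω) 0 with h0 | h0
  · rw [h0, mul_zero, mul_zero]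
  refine mul_le_mul_of_nonneg_right ?_ hU
  have hX := weightedWork_nonneg (H.c_nonneg k) y
  set X := weightedWork (H.c k) y with hXdef
  set r := perp (spread M (H.c k)) (queueVec y) with hr
  have hrow : ∀ m, serverQueue (queueVec y) m = (X / M) • H.c k + serverQueue r m := by
    intro m
    rw [hr, serverQueue_perp_spread hM]
    simp only [inner_serverQueue_queueVec]
    simp [hXdef, weightedWork]
  have hbr : 0 ≤ ‖r‖ := norm_nonneg _
  by_cases hcase : ∃ j m, 0 < H.c k j ∧ P.served y ω j m < P.sched y ω m j
  · obtain ⟨j, m, hcj, hlt⟩ := hcase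
    have h1 : (work (y j m) : ℝ) ≤ S.Dmax * S.smax := by
      exact_mod_cast hsched.work_le_of_served_lt hlt
    have h2 : (work (y j m) : ℝ) = X / M * H.c k j + r (j, m) :=
      congrArg (fun z : JobVec J => z j) (hrow m)
    have h3 : |r (j, m)| ≤ ‖r‖ := PiLp.norm_apply_le r (j, m)
    have h4 : X / M * H.c k j ≤ S.Dmax * S.smax + ‖r‖ := by
      linarith [neg_abs_le (r (j, m))]
    have h5 : (H.c k j)⁻¹ ≤ L₁ := Finset.single_le_sum (f := fun j => (H.c k j)⁻¹)
      (fun j _ => inv_nonneg.2 (H.c_nonneg k j)) (Finset.mem_univ j)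
    calc X = M * (H.c k j)⁻¹ * (X / M * H.c k j) := by field_simp
      _ ≤ M * L₁ * (S.Dmax * S.smax + ‖r‖) := by
          gcongr
      _ ≤ M * L₁ * ((S.Dmax * S.smax + 1) * (1 + ‖r‖)) := by
          gcongr
          have : (0 : ℝ) ≤ S.Dmax * S.smax := by positivity
          nlinarith
      _ ≤ _ := by
          have : 0 ≤ Q / g * (1 + ‖r‖) := by positivity
          linarith
  · push Not at hcase
    have h1 : ∑ m, ∑ j, H.c k j * (P.served y ω j m : ℝ) =
        ∑ m, ∑ j, H.c k j * (P.sched y ω m j : ℝ) := by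
      refine Finset.sum_congr rfl fun m _ => Finset.sum_congr rfl fun j _ => ?_
      rcases (H.c_nonneg k j).eq_or_lt with h | h
      · rw [← h, zero_mul, zero_mul]
      · have : P.served y ω j m = P.sched y ω m j :=
          le_antisymm (P.serve_card_le y ω j m) (hcase j m h)
        rw [this]
    obtain ⟨m, hm⟩ : ∃ m, ∑ j, H.c k j * (P.sched y ω m j : ℝ) < H.b k / M := by
      by_contra! hcon
      have h2 := Finset.sum_le_sum fun m (_ : m ∈ Finset.univ) => hcon m
      have h3 : ∑ _m : Fin M, H.b k / M = H.b k := by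
        simp
        field_simp
      rw [h3, ← h1] at h2
      refine h0 (le_antisymm ?_ hU)
      unfold unused
      linarith
    have h2 := hgap m _ (P.sched_feasible y ω m) hm
    have h3 := hsched.sum_mul_work_le hid hmem y ω m
    have h4 : ∑ j, lamk j * (work (y j m) : ℝ) =
        X / M * H.b k + inner ℝ lamk (serverQueue r m) := by
      rw [← inner_serverQueue_queueVec, hrow, inner_add_right, inner_smul_right,
        real_inner_comm, hplane]
    have h5 : ∑ j, (P.sched y ω m j : ℝ) * (work (y j m) : ℝ) =
        X / M * ∑ j, H.c k j * (P.sched y ω m j : ℝ) +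
          inner ℝ (configVec (P.sched y ω m)) (serverQueue r m) := by
      have : ∑ j, (P.sched y ω m j : ℝ) * (work (y j m) : ℝ) =
          inner ℝ (configVec (P.sched y ω m)) (serverQueue (queueVec y) m) := by
        rw [inner_serverQueue_queueVec]
        rfl
      rw [this, hrow, inner_add_right, inner_smul_right, real_inner_comm, JobVec.inner_eq_sum]
      rfl
    have hrm : ‖serverQueue r m‖ ≤ ‖r‖ := by
      refine le_of_sq_le_sq ?_ (norm_nonneg _)
      rw [norm_sq_eq_sum_serverQueue]
      exact Finset.single_le_sum (f := fun m => ‖serverQueue r m‖ ^ 2) (fun _ _ => sq_nonneg _)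
        (Finset.mem_univ m)
    have hs : ‖configVec (P.sched y ω m)‖ ≤ J * S.smax := by
      refine (EuclideanSpace.norm_le_sum_abs _).trans ?_
      calc ∑ j, |configVec (P.sched y ω m) j| ≤ ∑ _j : Fin J, (S.smax : ℝ) := by
            refine Finset.sum_le_sum fun j _ => ?_
            rw [configVec_apply, Nat.abs_cast]
            exact Nat.cast_le.2 (S.le_smax (P.sched_feasible y ω m) j)
        _ = _ := by simp
    have h6 : inner ℝ (configVec (P.sched y ω m)) (serverQueue r m) ≤ J * S.smax * ‖r‖ :=
      (real_inner_le_norm _ _).trans (mul_le_mul hs hrm (norm_nonneg _) (by positivity))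
    have h7 : -(‖lamk‖ * ‖r‖) ≤ inner ℝ lamk (serverQueue r m) := by
      have h8 := abs_real_inner_le_norm lamk (serverQueue r m)
      have h9 : ‖lamk‖ * ‖serverQueue r m‖ ≤ ‖lamk‖ * ‖r‖ := by gcongr
      linarith [neg_abs_le (inner ℝ lamk (serverQueue r m))]
    rw [h4, h5] at h3
    have h8 : X / M * ∑ j, H.c k j * (P.sched y ω m j : ℝ) ≤ X / M * (H.b k / M - g) := by
      gcongr
    have h9 : X * g ≤ Q * ‖r‖ := by
      have h10 : (M : ℝ) * (X / M * ∑ j, H.c k j * (P.sched y ω m j : ℝ) +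
          inner ℝ (configVec (P.sched y ω m)) (serverQueue r m)) ≤
          M * (X / M * (H.b k / M - g) + J * S.smax * ‖r‖) := by gcongr
      have h11 : (M : ℝ) * (X / M * (H.b k / M - g) + J * S.smax * ‖r‖) =
          X / M * H.b k - X * g + M * (J * S.smax) * ‖r‖ := by
        field_simp
      simp only [Q]
      linarith
    have h12 : X ≤ Q / g * ‖r‖ := by
      rw [div_mul_eq_mul_div, le_div_iff₀ hg]
      exact h9
    have h13 : 0 ≤ M * L₁ * (S.Dmax * S.smax + 1) * (1 + ‖r‖) := by positivity
    have h14 : 0 ≤ Q / g := by positivity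
    linarith

/-- **Upper bound** for the weighted workload. By the identity for a single queue it remains to
bound `E [X' U]`; as `U` vanishes unless the perpendicular component is comparable to the workload,
this follows from state-space collapse and `E U = ε`. -/
theorem exists_meanWeighted_le (hM : 2 ≤ M) (hid : S.Identical)
    (hroute : P.IsPowerOfTwoRouting) (hsched : P.IsMaxWeightScheduling) (lamk : JobVec J)
    (amax : ℕ) :
    ∃ B : ℝ, ∀ α : ArrivalLaw J S.Dmax, α.IsNormalApproach H k lamk amax → α.Uncorrelated →
      ∀ π, P.IsSteadyState α π →
        ENNReal.ofReal (H.dist k α.rate) * meanWeighted π (spread M (H.c k)) ≤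
          ENNReal.ofReal (zeta M (H.c k) α.var (H.dist k α.rate) / 2
            + B * √(H.dist k α.rate)) := by
  have hMpos : 0 < M := by omega
  have hM' : (2 : ℝ) ≤ M := by exact_mod_cast hM
  by_cases hex : ∃ α : ArrivalLaw J S.Dmax, α.IsNormalApproach H k lamk amax
  swap
  · exact ⟨0, fun α hα => absurd ⟨α, hα⟩ hex⟩
  obtain ⟨α₀, hα₀⟩ := hex
  obtain ⟨N, hN⟩ := exists_moment_bound_perp H k hM hid hroute hsched lamk amax
  obtain ⟨L, hL, hXU⟩ := exists_weightedWork_mul_unused_le (P := P) H k hMpos hid hsched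
    (lamk := lamk) (hα₀.proj_eq ▸ hα₀.mem_strictlyDominant.1)
    (hα₀.proj_eq ▸ H.inner_proj hα₀.mem_interior k)
  have hb := H.b_nonneg k
  set b := H.b k with hbdef
  let C : ℝ := L + J * amax + b
  have hC : 0 ≤ C := by positivity
  refine ⟨C * √b + L / 2 * (max (N 2) 0 + b), fun α hα hunc π h => ?_⟩
  have hπ := h.1
  have hε := H.dist_pos_of_mem_interior hα.mem_interior k
  have hεb := H.dist_le_b_of_mem_interior hα.mem_interior k
  have hmeanY := P.integral_input H k α hα.mem_interior
  have hsqY := P.integral_input_sq H k α hα.mem_interior hunc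
  set ε := H.dist k α.rate with hεdef
  let W : QueueState J M S.Dmax → ℝ := fun y => ‖perp (spread M (H.c k)) (queueVec y)‖
  -- finiteness of second moments
  have hWlint := hN α hα π h 2
  have hWi : Integrable (fun y => W y ^ 2) π :=
    (lintegral_ofReal_ne_top_iff_integrable Measurable.of_discrete.aestronglyMeasurable
      (ae_of_all _ fun y => sq_nonneg _)).1 (ne_top_of_le_ne_top ENNReal.ofReal_ne_top hWlint)
  have hWle : ∫ y, W y ^ 2 ∂π ≤ max (N 2) 0 := by
    rw [← ENNReal.ofReal_le_ofReal_iff (le_max_right _ _),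
      ofReal_integral_eq_lintegral_ofReal hWi (ae_of_all _ fun y => sq_nonneg _)]
    exact hWlint.trans (ENNReal.ofReal_le_ofReal (le_max_left _ _))
  have hqi : Integrable (fun y => ‖queueVec y‖ ^ 2) π := by
    obtain ⟨N', hN'⟩ := exists_moment_bound_norm H k hM hid hroute hsched lamk amax hε
    exact (lintegral_ofReal_ne_top_iff_integrable Measurable.of_discrete.aestronglyMeasurable
      (ae_of_all _ fun y => sq_nonneg _)).1
        (ne_top_of_le_ne_top ENNReal.ofReal_ne_top (hN' α hα le_rfl π h 2))
  have hXL : MemLp (weightedWork (H.c k)) 2 π := by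
    rw [memLp_two_iff_integrable_sq Measurable.of_discrete.aestronglyMeasurable]
    refine (hqi.const_mul (M : ℝ)).mono' Measurable.of_discrete.aestronglyMeasurable
      (ae_of_all _ fun y => ?_)
    have h1 := norm_perp_sq (norm_spread hMpos (H.norm_c k)) (queueVec y)
    rw [inner_spread_queueVec, div_pow, Real.sq_sqrt (by positivity)] at h1
    have h2 : weightedWork (H.c k) y ^ 2 / M ≤ ‖queueVec y‖ ^ 2 := by
      linarith [sq_nonneg ‖perp (spread M (H.c k)) (queueVec y)‖]
    rw [div_le_iff₀ (by positivity)] at h2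
    rw [Real.norm_of_nonneg (sq_nonneg _)]
    linarith
  have hXi := hXL.integrable (by norm_num : (1 : ℝ≥0∞) ≤ 2)
  let μ := π.prod (P.slotLaw α)
  have hUL : MemLp (fun p : QueueState J M S.Dmax × (Arrivals J S.Dmax × P.Seed) =>
      P.unused (H.c k) b p.1 p.2) 2 μ := memLp_uncurry_unused (P := P) (α := α) H k
  have hUi := hUL.integrable (by norm_num : (1 : ℝ≥0∞) ≤ 2)
  have hYL : MemLp (fun p : QueueState J M S.Dmax × (Arrivals J S.Dmax × P.Seed) =>
      ∑ j, H.c k j * (work (p.2.1 j) : ℝ) - b) 2 μ :=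
    (P.memLp_input α (H.c k) b).comp_measurePreserving measurePreserving_snd
  have hXL' : MemLp (fun p : QueueState J M S.Dmax × (Arrivals J S.Dmax × P.Seed) =>
      weightedWork (H.c k) p.1) 2 μ := hXL.comp_measurePreserving measurePreserving_fst
  have hY0 : ∫ p, (∑ j, H.c k j * (work (p.2.1 j) : ℝ) - b) ∂μ = -ε := by
    rw [integral_prod_snd (fun ω => ∑ j, H.c k j * (work (ω.1 j) : ℝ) - b)]
    exact hmeanY
  have hst := h.identDistrib_weightedWork (H.c k) b
  have key := stationary_queue_le_integral hXL' hYL hUL (h.indepFun_input _ _) hst hY0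
  have hUmean := integral_unused_eq (hXL'.integrable (by norm_num)) (hYL.integrable (by norm_num))
    hUi hst hY0
  rw [integral_prod_snd (fun ω => (∑ j, H.c k j * (work (ω.1 j) : ℝ) - b) ^ 2),
    hsqY, integral_prod_fst (weightedWork (H.c k))] at key
  have hWi' : Integrable (fun p : QueueState J M S.Dmax × (Arrivals J S.Dmax × P.Seed) =>
      W p.1 ^ 2) μ := measurePreserving_fst.integrable_comp
        (Measurable.of_discrete (f := fun y => W y ^ 2)).aestronglyMeasurable |>.2 hWi
  have hsε : 0 < √ε := Real.sqrt_pos.2 hε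
  have hsε2 : √ε * √ε = ε := Real.mul_self_sqrt hε.le
  -- the correlation of workload and unused service
  have hcorr : ∫ p, (weightedWork (H.c k) p.1 + (∑ j, H.c k j * (work (p.2.1 j) : ℝ) - b)
      + P.unused (H.c k) b p.1 p.2) * P.unused (H.c k) b p.1 p.2 ∂μ ≤
      (C * √b + L / 2 * (max (N 2) 0 + b)) * √ε := by
    have hae : ∀ᵐ p ∂μ, ∀ j, work (p.2.1 j) ≤ amax :=
      (measurePreserving_snd (μ := π) (ν := P.slotLaw α)).quasiMeasurePreserving.ae
        (ae_forall_work_le (P := P) hα.bounded)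
    have hXL2 : MemLp (fun p : QueueState J M S.Dmax × (Arrivals J S.Dmax × P.Seed) =>
        weightedWork (H.c k) p.1 + (∑ j, H.c k j * (work (p.2.1 j) : ℝ) - b)
          + P.unused (H.c k) b p.1 p.2) 2 μ := (hXL'.add hYL).add hUL
    have h1 : ∫ p, (weightedWork (H.c k) p.1 + (∑ j, H.c k j * (work (p.2.1 j) : ℝ) - b)
        + P.unused (H.c k) b p.1 p.2) * P.unused (H.c k) b p.1 p.2 ∂μ ≤
        ∫ p, ((C + L / 2 * (b / √ε)) * P.unused (H.c k) b p.1 p.2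
          + L / 2 * √ε * W p.1 ^ 2) ∂μ := by
      refine integral_mono_ae (hXL2.integrable_mul hUL)
        ((hUi.const_mul _).add (hWi'.const_mul _)) ?_
      filter_upwards [hae] with p hp
      have hU0 := P.unused_nonneg H k p.1 p.2
      have hUb := P.unused_le H k p.1 p.2
      have hXUp := hXU p.1 p.2
      rw [← hbdef] at hU0 hUb
      have hA : ∑ j, H.c k j * (work (p.2.1 j) : ℝ) ≤ J * amax := by
        calc ∑ j, H.c k j * (work (p.2.1 j) : ℝ) ≤ ∑ _j : Fin J, 1 * (amax : ℝ) :=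
              Finset.sum_le_sum fun j _ => mul_le_mul (H.c_le_one k j) (Nat.cast_le.2 (hp j))
                (Nat.cast_nonneg _) zero_le_one
          _ = _ := by simp
      set U := P.unused (H.c k) b p.1 p.2
      set A := ∑ j, H.c k j * (work (p.2.1 j) : ℝ)
      have h2 : (A - b + U) * U ≤ (J * amax + b) * U := by
        gcongr
        linarith
      -- the inequality of arithmetic and geometric means, balanced by `√ε`
      have h3 : W p.1 * U ≤ 1 / 2 * (√ε * W p.1 ^ 2 + b / √ε * U) := by
        have h4 : 2 * (W p.1 * U) * √ε ≤ (√ε * W p.1) ^ 2 + U ^ 2 := by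
          nlinarith [sq_nonneg (√ε * W p.1 - U)]
        have h5 : U ^ 2 ≤ b * U := by nlinarith
        have h6 : 1 / 2 * (√ε * W p.1 ^ 2 + b / √ε * U) =
            ((√ε * W p.1) ^ 2 + b * U) / (2 * √ε) := by
          field_simp
        rw [h6, le_div_iff₀ (by positivity)]
        linarith
      have h7 : L * (W p.1 * U) ≤ L * (1 / 2 * (√ε * W p.1 ^ 2 + b / √ε * U)) := by gcongr
      have h8 : weightedWork (H.c k) p.1 * U ≤ L * U + L * (W p.1 * U) := by
        refine hXUp.trans (le_of_eq ?_)
        simp only [W]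
        ring
      simp only [C]
      linarith
    rw [integral_add (hUi.const_mul _) (hWi'.const_mul _), integral_const_mul, integral_const_mul,
      hUmean, integral_prod_fst (fun y => W y ^ 2)] at h1
    have h2 : L / 2 * √ε * ∫ y, W y ^ 2 ∂π ≤ L / 2 * √ε * max (N 2) 0 := by gcongr
    have h3 : (C + L / 2 * (b / √ε)) * ε = C * ε + L / 2 * b * √ε := by
      have : b / √ε * ε = b * √ε := by
        rw [div_mul_eq_mul_div, div_eq_iff hsε.ne', mul_assoc, hsε2]
      rw [add_mul, mul_assoc (L / 2) (b / √ε), this, mul_assoc]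
    have h4 : ε ≤ √b * √ε := by
      nth_rewrite 1 [← hsε2]
      gcongr
    have h5 : C * ε ≤ C * (√b * √ε) := by gcongr
    linarith
  rw [meanWeighted_eq (H.c_nonneg k) hXi, ← ENNReal.ofReal_mul hε.le]
  refine ENNReal.ofReal_le_ofReal ?_
  have hsqrt : 1 ≤ √(M : ℝ) := Real.one_le_sqrt.2 (by linarith)
  set B := C * √b + L / 2 * (max (N 2) 0 + b)
  have hB : 0 ≤ B * √ε := by
    have : 0 ≤ max (N 2) 0 := le_max_right _ _
    positivity
  unfold zeta
  set V := ∑ j, H.c k j ^ 2 * α.var j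
  set E := ∫ y, weightedWork (H.c k) y ∂π
  set s := √(M : ℝ)
  have h1 : ε * E ≤ (V + ε ^ 2) / 2 + B * √ε := by linarith
  calc ε * (E / s) = ε * E / s := by ring
    _ ≤ ((V + ε ^ 2) / 2 + B * √ε) / s := by gcongr
    _ = (V / s + ε ^ 2 / s) / 2 + B * √ε / s := by ring
    _ ≤ _ := by
        gcongr
        exact div_le_self hB hsqrt

end Policy

end Bounds

/-! ### The heavy-traffic limit -/

theorem tendsto_zeta {J : ℕ} (M : ℕ) (c : JobVec J) {ι : Type*} {l : Filter ι}
    {var : ι → Fin J → ℝ} {σ : Fin J → ℝ} {ε : ι → ℝ} (hvar : ∀ i j, 0 ≤ var i j)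
    (hε : Tendsto ε l (𝓝 0)) (hσ : ∀ j, Tendsto (fun i => √(var i j)) l (𝓝 (σ j))) :
    Tendsto (fun i => zeta M c (var i) (ε i)) l (𝓝 (zeta M c (fun j => σ j ^ 2) 0)) := by
  have hv : ∀ j, Tendsto (fun i => var i j) l (𝓝 (σ j ^ 2)) := by
    intro j
    have := (hσ j).pow 2
    simpa only [Real.sq_sqrt (hvar _ j)] using this
  unfold zeta
  exact ((tendsto_finsetSum _ fun j _ => (hv j).const_mul (c j ^ 2)).div_const _).add
    ((hε.pow 2).div_const _)

theorem mainTheorem3 {I J M : ℕ} (S : CloudSystem I J M) (hM : 2 ≤ M) (hid : S.Identical)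
    (H : HyperplaneDescription S.capacity) (P : Policy S)
    (hroute : P.IsPowerOfTwoRouting) (hsched : P.IsMaxWeightScheduling) :
    -- drift inequality for `V`
    (∀ (α : ArrivalLaw J S.Dmax) (y : QueueState J M S.Dmax),
      Integrable (fun ω => lyapunovV (queueVec (P.next y ω)) - lyapunovV (queueVec y))
        (P.slotLaw α) ∧
      ∫ ω, (lyapunovV (queueVec (P.next y ω)) - lyapunovV (queueVec y)) ∂(P.slotLaw α) ≤
        driftConst S α + ∑ j, 2 * α.rate j * ∑ m, (work (y j m) : ℝ) / M
          - ∫ ω, ∑ m, ∑ j, 2 * (work (y j m) : ℝ) * (P.served y ω j m : ℝ) ∂(P.slotLaw α)) ∧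
    -- steady states exist
    (∀ α : ArrivalLaw J S.Dmax, α.rate ∈ interior S.capacity → ∃ π, P.IsSteadyState α π) ∧
    -- lower bound, for every policy
    (∀ (Q : Policy S) (α : ArrivalLaw J S.Dmax), α.rate ∈ interior S.capacity → α.Uncorrelated →
      ∀ k ∈ H.strictlyDominant α.rate, ∀ π, Q.IsSteadyState α π →
        ENNReal.ofReal (zeta M (H.c k) α.var (H.dist k α.rate) / 2
            - H.b k * H.dist k α.rate / 2) ≤
          ENNReal.ofReal (H.dist k α.rate) * meanWeighted π (spread M (H.c k))) ∧
    -- systems with bounded arrivals whose rates approach a face along its normal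
    (∀ (ι : Type) (α : ι → ArrivalLaw J S.Dmax) (k : Fin H.K) (lamk : JobVec J) (amax : ℕ),
      (∀ i, (α i).rate ∈ interior S.capacity) →
      (∀ i, k ∈ H.strictlyDominant (α i).rate) →
      (∀ i, H.proj k (α i).rate = lamk) →
      (∀ i j, ∀ᵐ A ∂(α i).law, work (A j) ≤ amax) →
      -- state-space collapse
      (∃ N : ℕ → ℝ, ∀ i π, P.IsSteadyState (α i) π → ∀ n : ℕ,
        ∫⁻ y, ENNReal.ofReal (‖perp (spread M (H.c k)) (queueVec y)‖ ^ n) ∂π ≤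
          ENNReal.ofReal (N n)) ∧
      ((∀ i, (α i).Uncorrelated) →
        -- upper bound
        (∃ B : ℝ, ∀ i π, P.IsSteadyState (α i) π →
          ENNReal.ofReal (H.dist k (α i).rate) * meanWeighted π (spread M (H.c k)) ≤
            ENNReal.ofReal (zeta M (H.c k) (α i).var (H.dist k (α i).rate) / 2
              + B * √(H.dist k (α i).rate))) ∧
        -- heavy-traffic limit and optimality
        (∀ (l : Filter ι) (σ : Fin J → ℝ),
          Tendsto (fun i => H.dist k (α i).rate) l (𝓝[>] 0) →
          (∀ j, Tendsto (fun i => √((α i).var j)) l (𝓝 (σ j))) →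
          (∀ π : ι → Measure (QueueState J M S.Dmax), (∀ i, P.IsSteadyState (α i) (π i)) →
            Tendsto (fun i => ENNReal.ofReal (H.dist k (α i).rate) *
                meanWeighted (π i) (spread M (H.c k))) l
              (𝓝 (ENNReal.ofReal (zeta M (H.c k) (fun j => σ j ^ 2) 0 / 2)))) ∧
          (∀ (Q : ι → Policy S) (π : ι → Measure (QueueState J M S.Dmax)),
            (∀ i, (Q i).IsSteadyState (α i) (π i)) →
            ENNReal.ofReal (zeta M (H.c k) (fun j => σ j ^ 2) 0 / 2) ≤
              liminf (fun i => ENNReal.ofReal (H.dist k (α i).rate) *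
                meanWeighted (π i) (spread M (H.c k))) l)))) := by
  have hMpos : 0 < M := by omega
  refine ⟨fun α y => ⟨P.integrable_drift α y, ?_⟩,
    fun α hα => P.exists_isSteadyState α hM hid hroute hsched hα,
    fun Q α hα hunc k _ π h => h.le_meanWeighted H k hM hα hunc, ?_⟩
  · -- any two servers will do, as the gain from the imbalance is not needed
    have h1 := hroute.integral_drift_le α hM y (fun _ => ⟨0, hMpos⟩) (fun _ => ⟨0, hMpos⟩)
    have h2 := sum_moments_le_driftConst (S := S) α (by omega : 1 ≤ M)
    have h3 : (0 : ℝ) ≤ 2 * M * J * S.Dmax * (S.smax : ℝ) ^ 2 := by positivity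
    simp only [sub_self, abs_zero, zero_div, sub_zero, Finset.sum_div] at h1
    linarith
  intro ι α k lamk amax hint hk hproj hbdd
  have hα : ∀ i, (α i).IsNormalApproach H k lamk amax := fun i =>
    ⟨hint i, hk i, hproj i, hbdd i⟩
  refine ⟨?_, fun hunc => ?_⟩
  · obtain ⟨N, hN⟩ := Policy.exists_moment_bound_perp H k hM hid hroute hsched lamk amax
    exact ⟨N, fun i π h n => hN (α i) (hα i) π h n⟩
  obtain ⟨B, hB⟩ := Policy.exists_meanWeighted_le H k hM hid hroute hsched lamk amax
  refine ⟨⟨B, fun i π h => hB (α i) (hα i) (hunc i) π h⟩, fun l σ hε hσ => ?_⟩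
  have hε0 : Tendsto (fun i => H.dist k (α i).rate) l (𝓝 0) := hε.mono_right nhdsWithin_le_nhds
  have hzeta := tendsto_zeta M (H.c k) (fun i j => (α i).var_nonneg j) hε0 hσ
  have hlower : Tendsto (fun i => ENNReal.ofReal (zeta M (H.c k) (α i).var (H.dist k (α i).rate) / 2
      - H.b k * H.dist k (α i).rate / 2)) l
      (𝓝 (ENNReal.ofReal (zeta M (H.c k) (fun j => σ j ^ 2) 0 / 2))) := by
    refine ENNReal.tendsto_ofReal ?_
    simpa using (hzeta.div_const 2).sub ((hε0.const_mul (H.b k)).div_const 2)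
  refine ⟨fun π hπ => ?_, fun Q π hπ => ?_⟩
  · have hupper : Tendsto (fun i => ENNReal.ofReal (zeta M (H.c k) (α i).var
        (H.dist k (α i).rate) / 2 + B * √(H.dist k (α i).rate))) l
        (𝓝 (ENNReal.ofReal (zeta M (H.c k) (fun j => σ j ^ 2) 0 / 2))) := by
      refine ENNReal.tendsto_ofReal ?_
      have := (hzeta.div_const 2).add ((hε0.sqrt).const_mul B)
      simpa using this
    exact tendsto_of_tendsto_of_tendsto_of_le_of_le hlower hupper
      (fun i => (hπ i).le_meanWeighted H k hM (hint i) (hunc i))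
      (fun i => hB (α i) (hα i) (hunc i) (π i) (hπ i))
  · rcases l.eq_or_neBot with rfl | hl
    · simp
    · rw [← hlower.liminf_eq]
      exact liminf_le_liminf (Eventually.of_forall fun i =>
        (hπ i).le_meanWeighted H k hM (hint i) (hunc i))
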